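/- Let $\Omega\subset\mathbb{R}^3$ be open: either $\Omega=\mathbb{R}^3$, or $\Omega$ lies locally on one side of its boundary, $\partial\Omega$ is a $C^1$ surface of bounded curvature, and its outer unit normal $n$ extends to a $C^1$ map on $\mathbb{R}^3$. Let $b:\mathbb{R}^3\times S^2\to\mathbb{R}$ satisfy $0\le b\in L^1(\mathbb{R}^3\times S^2)$ and $b(w,\omega)=q(|w|,|w\cdot\omega|)$ for some function $q$, and let $f_0:\Omega\times\mathbb{R}^3\to\mathbb{R}$ be measurable with $0\le f_0\le 1$ a.e. Put $$Q(f)=\int_{S^2}\int_{\mathbb{R}^3}b(v-v_*,\omega)\bigl(f'f_*'(1-f)(1-f_*)-ff_*(1-f')(1-f'_*)\bigr)\,dv_*\,d\omega,$$ where $f=f(t,x,v)$, $f_*=f(t,x,v_*)$, $f'=f(t,x,v')$, $f'_*=f(t,x,v'_*)$, $v'=v-((v-v_*)\cdot\omega)\,\omega$ and $v_*'=v_*+((v-v_*)\cdot\omega)\,\omega$. For $t\ge0$ let $\Psi^t(x,v)$ be the point of phase space reached at time $t$ by the trajectory issuing from $(x,v)\in\Omega\times\mathbb{R}^3$ that moves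 in straight lines at constant velocity inside $\Omega$ and whose velocity is changed from $v$ to $R_y(v)=v-2(v\cdot n(y))n(y)$ when it meets a point $y\in\partial\Omega$ (with $t\mapsto\Psi^t(x,v)$ continuous from the right), and let $f^\sharp(t,x,v)=f(t,\Psi^t(x,v))$. Let $f$ be the solution, with $0\le f\le1$ a.e. on $\mathbb{R}_+\times\Omega\times\mathbb{R}^3$, of the Boltzmann–Fermi–Dirac problem with specular reflection, that is: $\partial_tf+v\cdot\nabla_xf=Q(f)$ in the sense of distributions on $(0,\infty)\times\Omega\times\mathbb{R}^3$; $f(0,\cdot,\cdot)=f_0$ a.e.; and, for almost all $(x,v)\in\Omega\times\mathbb{R}^3$, the map $t\mapsto f^\sharp(t,x,v)$ is continuous on $\mathbb{R}_+=[0,\infty)$. Then: 1. If $f_0\in L^1(\Omega\times\mathbb{R}^3)$, then $f\in C^0(\mathbb{R}_+;L^1(\Omega\times\mathbb{R}^3))$ and, for all $t\in\mathbb{R}_+$, $$\iint_{\Omega\times\mathbb{R}^3}f(t,x,v)\,dx\,dv=\iint_{\Omega\times\mathbb{R}^3}f_0(x,v)\,dx\,dv.$$ 2. If $\iint_{\Omega\times\mathbb{R}^3}|v|^2f_0\,dx\,dv<+\infty$,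 then $(t,x,v)\mapsto|v|^2f(t,x,v)$ belongs to $C^0(\mathbb{R}_+;L^1(\Omega\times\mathbb{R}^3))$ and, for all $t\in\mathbb{R}_+$, $$\iint_{\Omega\times\mathbb{R}^3}|v|^2f(t,x,v)\,dx\,dv=\iint_{\Omega\times\mathbb{R}^3}|v|^2f_0(x,v)\,dx\,dv.$$ Moreover, $(t,x,v)\mapsto|v|^2Q(f)(t,x,v)$ belongs to $L^\infty(\mathbb{R}_+;L^1(\Omega\times\mathbb{R}^3))$. -/

import Mathlib

open MeasureTheory Set Filter Topology
open scoped NNReal ENNReal ContDiff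

noncomputable section

/-- Euclidean space `ℝ³` (used for positions and velocities). -/
abbrev R3 : Type := EuclideanSpace ℝ (Fin 3)

/-- The unit sphere `S²` of `ℝ³`. -/
abbrev S2 : Type := Metric.sphere (0 : R3) 1

/-- The surface measure `dσ` on `S²`. -/
def surfaceS2 : Measure S2 := (volume : Measure R3).toSphere

/-- `Ω` is an open subset of `ℝ³`, possibly `ℝ³` itself (then the boundary is empty), lying locally
on one side of its boundary, which is a `C¹` surface; `n` is a continuously differentiable map on
`ℝ³` that restricts to the outer unit normal on `∂Ω`; and the curvature of `∂Ω` is bounded, that is,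
the derivative of the unit normal in tangential directions is bounded on `∂Ω`. -/
structure IsRegularDomain (Ω : Set R3) (n : R3 → R3) : Prop where
  isOpen : IsOpen Ω
  contDiff_normal : ContDiff ℝ 1 n
  boundary : ∀ y ∈ frontier Ω, ∃ (U : Set R3) (φ : R3 → ℝ),
    IsOpen U ∧ y ∈ U ∧ ContDiffOn ℝ 1 φ U ∧ (∀ z ∈ U, gradient φ z ≠ 0) ∧
    Ω ∩ U = {z ∈ U | φ z < 0} ∧
    ∀ z ∈ U, φ z = 0 → n z = ‖gradient φ z‖⁻¹ • gradient φ z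
  curvature : ∃ κ : ℝ, ∀ y ∈ frontier Ω, ∀ w : R3, inner ℝ (n y) w = 0 →
    ‖fderiv ℝ n y w‖ ≤ κ * ‖w‖

/-- The measure `dx dv` on the phase space `Ω × ℝ³`. -/
def phaseMeasure (Ω : Set R3) : Measure (R3 × R3) := volume.restrict (Ω ×ˢ univ)

/-- The measure `dt dx dv` on `ℝ₊ × Ω × ℝ³`. -/
def timePhaseMeasure (Ω : Set R3) : Measure (ℝ × R3 × R3) :=
  volume.restrict (Ici 0 ×ˢ Ω ×ˢ univ)

/-! ### Characteristic lines with specular reflection -/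

/-- The specular reflection law `R_y(v) = v - 2 (v · n(y)) n(y)`. -/
def specular (n : R3 → R3) (y v : R3) : R3 := v - (2 * inner ℝ v (n y)) • n y

/-- The first time `t > 0` at which the straight line `x + t v` meets `∂Ω` (`⊤` if it never does). -/
def hitTime (Ω : Set R3) (p : R3 × R3) : ℝ≥0∞ :=
  ⨅ (t : ℝ) (_ : 0 < t) (_ : p.1 + t • p.2 ∈ frontier Ω), ENNReal.ofReal t

/-- The state just after the first collision with `∂Ω`: position at the boundary, reflected
velocity.  It is meaningful when `hitTime Ω p < ⊤`. -/
def collide (Ω : Set R3) (n : R3 → R3) (p : R3 × R3) : R3 × R3 :=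
  (p.1 + (hitTime Ω p).toReal • p.2, specular n (p.1 + (hitTime Ω p).toReal • p.2) p.2)

/-- `collisionTime Ω n k p` is the time of the `k`-th collision (`0` for `k = 0`, and `⊤` if there
are fewer than `k` collisions) of the trajectory issuing from `p`. -/
def collisionTime (Ω : Set R3) (n : R3 → R3) (k : ℕ) (p : R3 × R3) : ℝ≥0∞ :=
  ∑ j ∈ Finset.range k, hitTime Ω ((collide Ω n)^[j] p)

open Classical in
/-- The trajectory maps `Ψᵗ`, for `t ≥ 0`: if `t` lies between the `k`-th collision time (included,
so that trajectories are continuous from the right) and the next one (excluded), then `Ψᵗ(p)` is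
reached by free flight from the state after the `k`-th collision.  On trajectories that have
infinitely many collisions before time `t` the value is the irrelevant default `p`. -/
def trajectory (Ω : Set R3) (n : R3 → R3) (t : ℝ) (p : R3 × R3) : R3 × R3 :=
  if h : ∃ k : ℕ, collisionTime Ω n k p ≤ ENNReal.ofReal t ∧
      ENNReal.ofReal t < collisionTime Ω n (k + 1) p then
    let k := Nat.find h
    let q := (collide Ω n)^[k] p
    (q.1 + (t - (collisionTime Ω n k p).toReal) • q.2, q.2)
  else p

/-- `f♯(t, x, v) = f(t, Ψᵗ(x, v))`. -/
def sharp (Ω : Set R3) (n : R3 → R3) (f : ℝ → R3 × R3 → ℝ) (t : ℝ) (p : R3 × R3) : ℝ :=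
  f t (trajectory Ω n t p)

/-! ### The collision integral -/

/-- `v' = v - ((v - v_*) · σ) σ`. -/
def velPrime (v vs : R3) (σ : S2) : R3 := v - (inner ℝ (v - vs) (σ : R3) : ℝ) • (σ : R3)

/-- `v_*' = v_* + ((v - v_*) · σ) σ`. -/
def velStarPrime (v vs : R3) (σ : S2) : R3 := vs + (inner ℝ (v - vs) (σ : R3) : ℝ) • (σ : R3)

/-- The collision integral for fermions, acting on a function `g` of the velocity:
`∫∫ b(v - v_*, σ) (g' g_*' (1 - g) (1 - g_*) - g g_* (1 - g') (1 - g_*')) dv_* dσ`. -/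
def collisionIntegral (b : R3 → S2 → ℝ) (g : R3 → ℝ) (v : R3) : ℝ :=
  ∫ p : R3 × S2, b (v - p.1) p.2 *
      (g (velPrime v p.1 p.2) * g (velStarPrime v p.1 p.2) * (1 - g v) * (1 - g p.1)
        - g v * g p.1 * (1 - g (velPrime v p.1 p.2)) * (1 - g (velStarPrime v p.1 p.2)))
    ∂((volume : Measure R3).prod surfaceS2)

/-- `Q(f)(t, x, v)`. -/
def Q (b : R3 → S2 → ℝ) (f : ℝ → R3 × R3 → ℝ) (t : ℝ) (p : R3 × R3) : ℝ :=
  collisionIntegral b (fun w => f t (p.1, w)) p.2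

/-- Collision kernels: `0 ≤ b ∈ L¹(ℝ³ × S²)` and `b(w, σ) = q(|w|, |w · σ|)`. -/
structure IsCollisionKernel (b : R3 → S2 → ℝ) : Prop where
  integrable : Integrable (fun p : R3 × S2 => b p.1 p.2) ((volume : Measure R3).prod surfaceS2)
  nonneg : ∀ᵐ p : R3 × S2 ∂((volume : Measure R3).prod surfaceS2), 0 ≤ b p.1 p.2
  symmetric : ∃ q : ℝ → ℝ → ℝ, ∀ᵐ p : R3 × S2 ∂((volume : Measure R3).prod surfaceS2),
    b p.1 p.2 = q ‖p.1‖ |inner ℝ p.1 (p.2 : R3)|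

/-! ### Solutions -/

/-- `∂ₜ f + v · ∇ₓ f = h` in the sense of distributions on `(0, ∞) × Ω × ℝ³`. -/
def IsDistribSolution (Ω : Set R3) (f h : ℝ → R3 × R3 → ℝ) : Prop :=
  ∀ φ : ℝ × R3 × R3 → ℝ, ContDiff ℝ ∞ φ → HasCompactSupport φ →
    tsupport φ ⊆ Ioi 0 ×ˢ Ω ×ˢ univ →
    ∫ p : ℝ × R3 × R3,
      (f p.1 p.2 * fderiv ℝ φ p (1, p.2.2, 0) + h p.1 p.2 * φ p) = 0

/-- `f` is a solution, with `0 ≤ f ≤ 1`, of the Boltzmann–Fermi–Dirac equation in `Ω` with initial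
datum `f₀` and specular reflection at the boundary, the latter being expressed by the continuity of
`t ↦ f♯(t, x, v)` on `ℝ₊` for almost all `(x, v)`. -/
structure IsBFDSolution (Ω : Set R3) (n : R3 → R3) (b : R3 → S2 → ℝ)
    (f₀ : R3 × R3 → ℝ) (f : ℝ → R3 × R3 → ℝ) : Prop where
  aemeasurable : AEMeasurable (fun p : ℝ × R3 × R3 => f p.1 p.2) (timePhaseMeasure Ω)
  bounds : ∀ᵐ p ∂(timePhaseMeasure Ω), 0 ≤ f p.1 p.2 ∧ f p.1 p.2 ≤ 1
  equation : IsDistribSolution Ω f (Q b f)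
  initial : f 0 =ᵐ[phaseMeasure Ω] f₀
  boundary : ∀ᵐ p ∂(phaseMeasure Ω), ContinuousOn (fun t => sharp Ω n f t p) (Ici 0)

/-! ### Function spaces in time -/

/-- `g ∈ C⁰(ℝ₊; L¹(Ω × ℝ³))`. -/
def MemC0L1 (Ω : Set R3) (g : ℝ → R3 × R3 → ℝ) : Prop :=
  ∃ F : C(ℝ≥0, Lp ℝ 1 (phaseMeasure Ω)), ∀ t : ℝ≥0, F t =ᵐ[phaseMeasure Ω] g t

/-- `g ∈ L^∞(ℝ₊; L¹(Ω × ℝ³))`. -/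
def MemLinftyL1 (Ω : Set R3) (g : ℝ → R3 × R3 → ℝ) : Prop :=
  AEStronglyMeasurable (fun p : ℝ × R3 × R3 => g p.1 p.2) (timePhaseMeasure Ω) ∧
    ∃ C : ℝ, ∀ᵐ t ∂(volume.restrict (Ici (0 : ℝ))),
      Integrable (g t) (phaseMeasure Ω) ∧ ∫ p, |g t p| ∂(phaseMeasure Ω) ≤ C

end

/-!
Write `Ψᵗ` for the flow, `f♯(t, p) = f(t, Ψᵗ p)`, and let `m` be one of the collision invariants
`1` and `|v|²`.  Formally, `m f♯(t) = m f₀ + ∫₀ᵗ m Q(f)♯ ds`; since `Ψˢ` preserves `dx dv` and `m`,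
and since `∫ m Q(f) dv = 0`, integration over phase space gives the conservation laws.  Three points
have to be justified: that the flow exists almost everywhere and preserves the measure, that the
distributional equation may be integrated along the trajectories across collisions with the
boundary, and that `m f` is integrable at later times.

*The flow.*  Call a phase point admissible for a step of length `h` if its trajectory has during this
step no collision, or a single and transversal one (`stepSet`).  On admissible points `Ψʰ` is
injective and reversible.  With the free flights before and after the collision split off, it replaces
a line by its reflection, and the derivative of that map is block triangular with two reflections on
the diagonal, so that its determinant is `± 1` (`hasFDerivAt_reflectLine`,
`volume_stepSet_inter_preimage_le`).  In a bounded region the points which are not admissible have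
volume `o(h)` as `h → 0`: apart from a null set, their trajectories collide, start at a distance of
order `h` from the boundary at most, and are tangential up to `ε`, where `ε → 0` as `h → 0` because
the normal is continuous; a packing argument shows that such points have a volume of order `ε h`
(`IsBoundaryChart.near_grazing`, `exists_volume_badSet_closedBall_le`).  Thus the total volume lost
in `t / h` steps tends to `0`.  It follows that almost every trajectory is defined for all times
(`ae_definedAt`), that `Ψᵗ` does not increase the volume of preimages, and, since the velocity
reversal conjugates `Ψᵗ` to its inverse, that it preserves the phase measure
(`measurePreserving_trajectory`).

*The mild form.*  Testing the equation with products of a function of time and a function that is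
constant along straight lines, one finds that on almost every straight line the equation holds weakly
in time as long as the line stays in `Ω` (`IsDistribSolution.ae_line`).  Between collisions this is
the mild equation; the hypothesis that `f♯` is continuous in time glues the pieces together across
the collision times (`ae_mild`).
Replacing `f` by a version that satisfies the mild equation at all times gives a mild solution
(`IsBFDSolution.exists_isMildSolution`).  From there on all functions take values in `[0, ∞]`, with
gains and losses kept separate.

*Integrability and conservation.*  The collision map preserves `dv dv_* dσ` and exchanges gain and
loss, so both have the same integral against `m` (`lintegral_mul_collisionOp_comp`,
`lintegral_mul_gainOp`).  This gives the conservation law once `∫ m f(t)` is known to be locally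
bounded in time, which is not part of the hypotheses: a bound by Gronwall's inequality for `f` itself
would be circular.  The Picard iterates `gₖ` of the equation without losses and exclusion factors,
started at `0`, satisfy the Gronwall bound uniformly in `k`, and since `f ≤ 1` one has
`f(t) ≤ gₖ(t) + (2 ‖b‖ t)ᵏ / k!` (`IsMildSolution.le_picard`).  Fatou's lemma yields
`IsMildSolution.lintegral_mul_le`, hence `IsMildSolution.lintegral_mul_eq`.

*Continuity in time.*  Along the trajectories `m f` is Lipschitz in time with values in `L¹`
(`IsMildSolution.lintegral_sharp_sub_le`), and the flow acts strongly continuously on `L¹`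
(`tendsto_lintegral_comp_back`), by density of continuous functions with compact support.  The same
estimate of the gain and loss terms bounds `m Q(f)` in `L¹` by `2 ‖b‖ ∫ m f₀`, uniformly in time.
-/

noncomputable section

section

/-! ### Trajectories: measurability and the semigroup law -/

/-- Free flight during the (possibly negative) time `s`. -/
def freeFlight (s : ℝ) (p : R3 × R3) : R3 × R3 := (p.1 + s • p.2, p.2)

/-- Reversal of the velocity. -/
def reverse (p : R3 × R3) : R3 × R3 := (p.1, -p.2)

/-- The trajectory issuing from `p` is defined at time `t`: it has only finitely many collisions
up to time `t`. -/
def DefinedAt (Ω : Set R3) (n : R3 → R3) (t : ℝ) (p : R3 × R3) : Prop :=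
  ∃ k : ℕ, collisionTime Ω n k p ≤ ENNReal.ofReal t ∧
    ENNReal.ofReal t < collisionTime Ω n (k + 1) p

variable {Ω : Set R3} {n : R3 → R3}

lemma freeFlight_freeFlight (s t : ℝ) (p : R3 × R3) :
    freeFlight s (freeFlight t p) = freeFlight (t + s) p := by
  simp [freeFlight, add_smul, add_assoc]

@[simp] lemma freeFlight_zero (p : R3 × R3) : freeFlight 0 p = p := by simp [freeFlight]

@[simp] lemma reverse_reverse (p : R3 × R3) : reverse (reverse p) = p := by simp [reverse]

@[fun_prop] lemma continuous_reverse : Continuous reverse := by unfold reverse; fun_prop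

lemma continuous_freeFlight_uncurry :
    Continuous (fun q : ℝ × R3 × R3 => freeFlight q.1 q.2) := by unfold freeFlight; fun_prop

@[fun_prop] lemma continuous_freeFlight (s : ℝ) : Continuous (freeFlight s) := by
  unfold freeFlight; fun_prop

lemma hitTime_lt_iff {p : R3 × R3} {c : ℝ≥0∞} :
    hitTime Ω p < c ↔ ∃ t : ℝ, 0 < t ∧ p.1 + t • p.2 ∈ frontier Ω ∧ ENNReal.ofReal t < c := by
  simp only [hitTime, iInf_lt_iff, exists_prop]

lemma hitTime_le {p : R3 × R3} {t : ℝ} (ht : 0 < t) (h : p.1 + t • p.2 ∈ frontier Ω) :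
    hitTime Ω p ≤ ENNReal.ofReal t :=
  iInf₂_le_of_le t ht (iInf_le _ h)

lemma le_hitTime_iff {p : R3 × R3} {c : ℝ≥0∞} :
    c ≤ hitTime Ω p ↔ ∀ t : ℝ, 0 < t → p.1 + t • p.2 ∈ frontier Ω → c ≤ ENNReal.ofReal t := by
  simp [hitTime]

lemma notMem_frontier_of_lt_hitTime {p : R3 × R3} {t : ℝ} (ht : 0 < t)
    (h : ENNReal.ofReal t < hitTime Ω p) : p.1 + t • p.2 ∉ frontier Ω :=
  fun h' => (hitTime_le ht h').not_gt h

lemma measurable_hitTime (Ω : Set R3) : Measurable (hitTime Ω) := by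
  refine measurable_of_Iio fun c => ?_
  have hcl : ∀ a b : ℝ, IsClosed {p : R3 × R3 | ∃ t ∈ Icc a b, p.1 + t • p.2 ∈ frontier Ω} := by
    intro a b
    have h := isClosedMap_snd_of_compactSpace (X := Icc a b) (Y := R3 × R3)
      {q | q.2.1 + (q.1 : ℝ) • q.2.2 ∈ frontier Ω}
      (isClosed_frontier.preimage (by fun_prop))
    convert! h using 1
    ext p
    constructor
    · rintro ⟨t, ht, h⟩; exact ⟨(⟨t, ht⟩, p), h, rfl⟩
    · rintro ⟨⟨t, p'⟩, h, rfl⟩; exact ⟨t, t.2, h⟩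
  have : hitTime Ω ⁻¹' Iio c = ⋃ (a : ℚ) (b : ℚ) (_ : 0 < (a : ℝ) ∧ ENNReal.ofReal b < c),
      {p : R3 × R3 | ∃ t ∈ Icc (a : ℝ) b, p.1 + t • p.2 ∈ frontier Ω} := by
    ext p
    simp only [mem_preimage, mem_Iio, hitTime_lt_iff, mem_iUnion, mem_ofPred_eq, exists_prop]
    constructor
    · rintro ⟨t, ht, h, hc⟩
      obtain ⟨a, ha, hat⟩ := exists_rat_btwn ht
      obtain ⟨b, -, hb, hbc⟩ := ENNReal.lt_iff_exists_rat_btwn.1 hc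
      refine ⟨a, b, ⟨ha, hbc⟩, t, ⟨hat.le, ?_⟩, h⟩
      exact ((ENNReal.ofReal_lt_ofReal_iff_of_nonneg ht.le).1 hb).le
    · rintro ⟨a, b, ⟨ha, hb⟩, t, ⟨h1, h2⟩, h⟩
      exact ⟨t, ha.trans_le h1, h, (ENNReal.ofReal_le_ofReal h2).trans_lt hb⟩
  rw [this]
  exact MeasurableSet.iUnion fun a => MeasurableSet.iUnion fun b => MeasurableSet.iUnion fun _ =>
    (hcl a b).measurableSet

lemma measurable_collide (hn : Continuous n) : Measurable (collide Ω n) := by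
  have h1 : Measurable fun p : R3 × R3 => p.1 + (hitTime Ω p).toReal • p.2 :=
    measurable_fst.add ((measurable_hitTime Ω).ennreal_toReal.smul measurable_snd)
  have h2 := hn.measurable.comp h1
  refine h1.prodMk ?_
  unfold specular
  exact measurable_snd.sub (((measurable_snd.inner (𝕜 := ℝ) h2).const_mul (2 : ℝ)).smul h2)

lemma measurable_collide_iterate (hn : Continuous n) (k : ℕ) : Measurable (collide Ω n)^[k] :=
  (measurable_collide hn).iterate k

lemma measurable_collisionTime (hn : Continuous n) (k : ℕ) : Measurable (collisionTime Ω n k) := by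
  unfold collisionTime
  exact Finset.measurable_fun_sum _ fun j _ =>
    (measurable_hitTime Ω).comp (measurable_collide_iterate hn j)

@[simp] lemma collisionTime_zero (p : R3 × R3) : collisionTime Ω n 0 p = 0 := by
  simp [collisionTime]

lemma collisionTime_succ (k : ℕ) (p : R3 × R3) :
    collisionTime Ω n (k + 1) p = collisionTime Ω n k p + hitTime Ω ((collide Ω n)^[k] p) := by
  simp [collisionTime, Finset.sum_range_succ]

lemma collisionTime_succ' (k : ℕ) (p : R3 × R3) :
    collisionTime Ω n (k + 1) p = hitTime Ω p + collisionTime Ω n k (collide Ω n p) := by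
  simp [collisionTime, Finset.sum_range_succ', add_comm]

lemma collisionTime_mono (p : R3 × R3) : Monotone fun k => collisionTime Ω n k p :=
  monotone_nat_of_le_succ fun k => by rw [collisionTime_succ]; exact le_self_add

lemma trajectory_eq {k : ℕ} {t : ℝ} {p : R3 × R3}
    (h1 : collisionTime Ω n k p ≤ ENNReal.ofReal t)
    (h2 : ENNReal.ofReal t < collisionTime Ω n (k + 1) p) :
    trajectory Ω n t p =
      freeFlight (t - (collisionTime Ω n k p).toReal) ((collide Ω n)^[k] p) := by
  have h : ∃ k : ℕ, collisionTime Ω n k p ≤ ENNReal.ofReal t ∧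
      ENNReal.ofReal t < collisionTime Ω n (k + 1) p := ⟨k, h1, h2⟩
  have hk : Nat.find h = k := by
    refine le_antisymm (Nat.find_min' h ⟨h1, h2⟩) ?_
    by_contra! hlt
    have := (Nat.find_spec h).2
    exact absurd (this.trans_le ((collisionTime_mono p (Nat.succ_le_of_lt hlt)).trans h1))
      (lt_irrefl _)
  simp only [trajectory]
  rw [dif_pos h, hk, freeFlight]

lemma trajectory_of_not {t : ℝ} {p : R3 × R3} (h : ¬ DefinedAt Ω n t p) :
    trajectory Ω n t p = p := by
  unfold DefinedAt at h
  simp only [trajectory]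
  rw [dif_neg h]

lemma measurable_trajectory_uncurry (hn : Continuous n) :
    Measurable (fun q : ℝ × R3 × R3 => trajectory Ω n q.1 q.2) := by
  set A : ℕ → Set (ℝ × R3 × R3) := fun k => {q | collisionTime Ω n k q.2 ≤ ENNReal.ofReal q.1 ∧
    ENNReal.ofReal q.1 < collisionTime Ω n (k + 1) q.2} with hA
  have ht : Measurable fun q : ℝ × R3 × R3 => ENNReal.ofReal q.1 := by fun_prop
  have hc : ∀ k, Measurable fun q : ℝ × R3 × R3 => collisionTime Ω n k q.2 :=
    fun k => (measurable_collisionTime hn k).comp measurable_snd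
  have hAm : ∀ k, MeasurableSet (A k) := fun k =>
    (measurableSet_le (hc k) ht).inter (measurableSet_lt ht (hc (k + 1)))
  set g : ℕ → ℝ × R3 × R3 → R3 × R3 := fun k q =>
    freeFlight (q.1 - (collisionTime Ω n k q.2).toReal) ((collide Ω n)^[k] q.2) with hg
  have hgm : ∀ k, Measurable (g k) := fun k =>
    continuous_freeFlight_uncurry.measurable.comp
      ((measurable_fst.sub (hc k).ennreal_toReal).prodMk
        ((measurable_collide_iterate hn k).comp measurable_snd))
  intro B hB
  have : (fun q : ℝ × R3 × R3 => trajectory Ω n q.1 q.2) ⁻¹' B =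
      (⋃ k, A k ∩ g k ⁻¹' B) ∪ ((⋃ k, A k)ᶜ ∩ Prod.snd ⁻¹' B) := by
    ext q
    by_cases h : ∃ k, q ∈ A k
    · obtain ⟨k, hk⟩ := h
      have hq : ∀ j, q ∈ A j → trajectory Ω n q.1 q.2 = g j q := fun j hj =>
        trajectory_eq hj.1 hj.2
      simp only [mem_preimage, mem_union, mem_iUnion, mem_inter_iff, mem_compl_iff]
      constructor
      · intro hB; exact Or.inl ⟨k, hk, by rwa [← hq k hk]⟩
      · rintro (⟨j, hj, hB⟩ | ⟨h, -⟩)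
        · rwa [hq j hj]
        · exact absurd ⟨k, hk⟩ h
    · have h' : trajectory Ω n q.1 q.2 = q.2 := trajectory_of_not h
      simp only [mem_preimage, mem_union, mem_iUnion, mem_inter_iff, mem_compl_iff, h', h,
        not_false_eq_true, true_and]
      constructor
      · exact Or.inr
      · rintro (⟨j, hj, -⟩ | hB)
        · exact absurd ⟨j, hj⟩ h
        · exact hB
  rw [this]
  exact (MeasurableSet.iUnion fun k => (hAm k).inter (hgm k hB)).union
    ((MeasurableSet.iUnion hAm).compl.inter (measurable_snd hB))

lemma measurable_trajectory (hn : Continuous n) (t : ℝ) : Measurable (trajectory Ω n t) := by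
  have key : ∀ F : ℝ × R3 × R3 → R3 × R3, Measurable F → Measurable fun p => F (t, p) :=
    fun F hF => hF.comp measurable_prodMk_left
  exact key _ (measurable_trajectory_uncurry hn)

lemma hitTime_freeFlight {p : R3 × R3} {r : ℝ} (hr : 0 ≤ r) (h : ENNReal.ofReal r < hitTime Ω p) :
    ENNReal.ofReal r + hitTime Ω (freeFlight r p) = hitTime Ω p := by
  apply le_antisymm
  · rw [le_hitTime_iff]
    intro t ht hf
    have hrt : r < t := by
      have := h.trans_le (hitTime_le ht hf)
      exact (ENNReal.ofReal_lt_ofReal_iff_of_nonneg hr).1 this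
    calc ENNReal.ofReal r + hitTime Ω (freeFlight r p)
        ≤ ENNReal.ofReal r + ENNReal.ofReal (t - r) := by
          gcongr
          refine hitTime_le (sub_pos.2 hrt) ?_
          simpa [freeFlight, add_assoc, ← add_smul] using hf
      _ = ENNReal.ofReal t := by
          rw [← ENNReal.ofReal_add hr (sub_pos.2 hrt).le]; congr 1; ring
  · rw [← tsub_le_iff_left, le_hitTime_iff]
    intro t ht hf
    rw [tsub_le_iff_left, ← ENNReal.ofReal_add hr ht.le]
    refine hitTime_le (by positivity) ?_
    simpa [freeFlight, add_assoc, ← add_smul] using hf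

lemma collide_freeFlight {p : R3 × R3} {r : ℝ} (hr : 0 ≤ r) (h : ENNReal.ofReal r < hitTime Ω p)
    (hp : hitTime Ω p ≠ ⊤) : collide Ω n (freeFlight r p) = collide Ω n p := by
  have h1 := hitTime_freeFlight hr h
  have hq : hitTime Ω (freeFlight r p) ≠ ⊤ := by
    intro hq; rw [hq] at h1; exact hp (by rw [← h1]; simp)
  have h2 : r + (hitTime Ω (freeFlight r p)).toReal = (hitTime Ω p).toReal := by
    rw [← h1, ENNReal.toReal_add ENNReal.ofReal_ne_top hq, ENNReal.toReal_ofReal hr]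
  have h3 : p.1 + r • p.2 + (hitTime Ω (freeFlight r p)).toReal • p.2 =
      p.1 + (hitTime Ω p).toReal • p.2 := by rw [← h2, add_smul, add_assoc]
  unfold collide
  change (p.1 + r • p.2 + (hitTime Ω (freeFlight r p)).toReal • p.2, specular n
    (p.1 + r • p.2 + (hitTime Ω (freeFlight r p)).toReal • p.2) p.2) = _
  rw [h3]

/-- Infinitely many collisions before time `t` are the only obstruction. -/
lemma definedAt_iff {t : ℝ} {p : R3 × R3} :
    DefinedAt Ω n t p ↔ ∃ k : ℕ, ENNReal.ofReal t < collisionTime Ω n k p := by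
  classical
  constructor
  · rintro ⟨k, -, h⟩; exact ⟨k + 1, h⟩
  · intro h
    have h0 : Nat.find h ≠ 0 := by
      intro h0
      have := Nat.find_spec h
      rw [h0] at this; simp at this
    obtain ⟨k, hk⟩ := Nat.exists_eq_succ_of_ne_zero h0
    refine ⟨k, ?_, ?_⟩
    · have := Nat.find_min h (m := k) (by omega)
      exact not_lt.1 this
    · have := Nat.find_spec h
      rwa [hk] at this

lemma DefinedAt.mono {s t : ℝ} (hst : s ≤ t) {p : R3 × R3} (h : DefinedAt Ω n t p) :
    DefinedAt Ω n s p := by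
  rw [definedAt_iff] at h ⊢
  obtain ⟨k, hk⟩ := h
  exact ⟨k, (ENNReal.ofReal_le_ofReal hst).trans_lt hk⟩

lemma definedAt_of_lt_hitTime {t : ℝ} {p : R3 × R3} (h : ENNReal.ofReal t < hitTime Ω p) :
    DefinedAt Ω n t p := ⟨0, by simp, by simpa [collisionTime_succ] using h⟩

lemma trajectory_of_lt_hitTime {t : ℝ} {p : R3 × R3} (h : ENNReal.ofReal t < hitTime Ω p) :
    trajectory Ω n t p = freeFlight t p := by
  rw [trajectory_eq (k := 0) (by simp) (by simpa [collisionTime_succ] using h)]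
  simp

/-- The state at a time where the trajectory is defined has a positive distance in time to the next
collision, and later collisions are those of the original trajectory. -/
lemma hitTime_trajectory {s : ℝ} (hs : 0 ≤ s) {p : R3 × R3} {k : ℕ}
    (h1 : collisionTime Ω n k p ≤ ENNReal.ofReal s)
    (h2 : ENNReal.ofReal s < collisionTime Ω n (k + 1) p) :
    ENNReal.ofReal (s - (collisionTime Ω n k p).toReal) < hitTime Ω ((collide Ω n)^[k] p) ∧
    0 ≤ s - (collisionTime Ω n k p).toReal ∧
    ENNReal.ofReal s + hitTime Ω (trajectory Ω n s p) = collisionTime Ω n (k + 1) p := by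
  set c := collisionTime Ω n k p with hc
  have hct : c ≠ ⊤ := ne_top_of_le_ne_top ENNReal.ofReal_ne_top h1
  have hcs : c.toReal ≤ s := ENNReal.toReal_le_of_le_ofReal hs h1
  have hsplit : ENNReal.ofReal s = c + ENNReal.ofReal (s - c.toReal) := by
    nth_rewrite 1 [← ENNReal.ofReal_toReal hct]
    rw [← ENNReal.ofReal_add ENNReal.toReal_nonneg (by linarith)]
    congr 1
    ring
  have hlt : ENNReal.ofReal (s - c.toReal) < hitTime Ω ((collide Ω n)^[k] p) := by
    rw [collisionTime_succ, ← hc, hsplit] at h2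
    exact (ENNReal.add_lt_add_iff_left hct).1 h2
  refine ⟨hlt, by linarith, ?_⟩
  rw [trajectory_eq h1 h2, ← hc, hsplit, add_assoc, hitTime_freeFlight (by linarith) hlt,
    collisionTime_succ]

lemma hitTime_trajectory_pos {s : ℝ} (hs : 0 ≤ s) {p : R3 × R3} (h : DefinedAt Ω n s p) :
    0 < hitTime Ω (trajectory Ω n s p) := by
  obtain ⟨k, h1, h2⟩ := h
  have := (hitTime_trajectory hs h1 h2).2.2
  by_contra! h0
  rw [nonpos_iff_eq_zero.1 h0, add_zero] at this
  exact h2.ne this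

/-- The semigroup law `Ψ^{s+r} = Ψ^r ∘ Ψ^s`. -/
lemma trajectory_add {s r : ℝ} (hs : 0 ≤ s) (hr : 0 ≤ r) {p : R3 × R3} (h : DefinedAt Ω n s p)
    (h' : DefinedAt Ω n r (trajectory Ω n s p)) :
    DefinedAt Ω n (s + r) p ∧
      trajectory Ω n (s + r) p = trajectory Ω n r (trajectory Ω n s p) := by
  obtain ⟨k, h1, h2⟩ := h
  obtain ⟨hlt, hnn, hadd⟩ := hitTime_trajectory hs h1 h2
  have hq := trajectory_eq h1 h2
  set q := trajectory Ω n s p with hqdef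
  obtain ⟨j, h3, h4⟩ := h'
  rcases j with _ | j
  · have h4' : ENNReal.ofReal r < hitTime Ω q := by simpa [collisionTime_succ] using h4
    have hb : ENNReal.ofReal (s + r) < collisionTime Ω n (k + 1) p := by
      rw [← hadd, ENNReal.ofReal_add hs hr]
      exact (ENNReal.add_lt_add_iff_left ENNReal.ofReal_ne_top).2 h4'
    have ha : collisionTime Ω n k p ≤ ENNReal.ofReal (s + r) :=
      h1.trans (ENNReal.ofReal_le_ofReal (by linarith))
    refine ⟨⟨k, ha, hb⟩, ?_⟩
    rw [trajectory_eq ha hb, trajectory_of_lt_hitTime h4', hq, freeFlight_freeFlight]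
    congr 1; ring
  · have hqtop : hitTime Ω q ≠ ⊤ := by
      intro hqt
      rw [collisionTime_succ', hqt, top_add] at h3
      exact ENNReal.ofReal_ne_top (top_le_iff.1 h3)
    have hctop : hitTime Ω ((collide Ω n)^[k] p) ≠ ⊤ := by
      rw [← hitTime_freeFlight hnn hlt, ← hq]
      exact ENNReal.add_ne_top.2 ⟨ENNReal.ofReal_ne_top, hqtop⟩
    have hcol : collide Ω n q = (collide Ω n)^[k + 1] p := by
      rw [hq, collide_freeFlight hnn hlt hctop, Function.iterate_succ_apply']
    have hct : ∀ i, ENNReal.ofReal s + collisionTime Ω n (i + 1) q =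
        collisionTime Ω n (k + 1 + i) p := by
      intro i
      induction i with
      | zero => rw [collisionTime_succ', collisionTime_zero, add_zero, hadd, add_zero]
      | succ i ih =>
        rw [collisionTime_succ, ← add_assoc, ih, Function.iterate_succ_apply, hcol,
          ← Function.iterate_add_apply, ← add_assoc (k + 1), collisionTime_succ,
          add_comm i (k + 1)]
    have ha : collisionTime Ω n (k + 1 + j) p ≤ ENNReal.ofReal (s + r) := by
      rw [← hct, ENNReal.ofReal_add hs hr]; gcongr
    have hb : ENNReal.ofReal (s + r) < collisionTime Ω n (k + 1 + j + 1) p := by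
      rw [add_assoc (k + 1), ← hct, ENNReal.ofReal_add hs hr]
      exact (ENNReal.add_lt_add_iff_left ENNReal.ofReal_ne_top).2 h4
    refine ⟨⟨_, ha, hb⟩, ?_⟩
    rw [trajectory_eq ha hb, trajectory_eq h3 h4, Function.iterate_succ_apply, hcol,
      ← Function.iterate_add_apply, add_comm j (k + 1), ← hct, ENNReal.toReal_add
      ENNReal.ofReal_ne_top (ne_top_of_le_ne_top ENNReal.ofReal_ne_top h3),
      ENNReal.toReal_ofReal hs]
    congr 1; ring

lemma trajectory_add_of_lt {s r : ℝ} (hs : 0 ≤ s) (hr : 0 ≤ r) {p : R3 × R3}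
    (h : DefinedAt Ω n s p) (h' : ENNReal.ofReal r < hitTime Ω (trajectory Ω n s p)) :
    trajectory Ω n (s + r) p = freeFlight r (trajectory Ω n s p) := by
  rw [(trajectory_add hs hr h (definedAt_of_lt_hitTime h')).2, trajectory_of_lt_hitTime h']

end

section

variable {Ω : Set R3} {n : R3 → R3}

/-! ### Boundary charts -/

/-- A local equation `φ = 0` of the boundary of `Ω` on the open set `U`, with gradient `g`. -/
structure IsBoundaryChart (Ω : Set R3) (n : R3 → R3) (U : Set R3) (φ : R3 → ℝ) (g : R3 → R3) :
    Prop where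
  isOpen : IsOpen U
  contDiffAt : ∀ z ∈ U, ContDiffAt ℝ 1 φ z
  hasFDerivAt : ∀ z ∈ U, HasFDerivAt φ (innerSL ℝ (g z)) z
  continuousOn : ContinuousOn g U
  ne_zero : ∀ z ∈ U, g z ≠ 0
  mem_iff : ∀ z ∈ U, z ∈ Ω ↔ φ z < 0
  mem_frontier_iff : ∀ z ∈ U, z ∈ frontier Ω ↔ φ z = 0
  normal_eq : ∀ z ∈ U, φ z = 0 → n z = ‖g z‖⁻¹ • g z

lemma IsBoundaryChart.hasDerivAt {U : Set R3} {φ : R3 → ℝ} {g : R3 → R3}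
    (hc : IsBoundaryChart Ω n U φ g) {x v : R3} {t : ℝ} (h : x + t • v ∈ U) :
    HasDerivAt (fun s : ℝ => φ (x + s • v)) (inner ℝ (g (x + t • v)) v) t := by
  have h1 : HasDerivAt (fun s : ℝ => x + s • v) v t := by
    simpa using ((hasDerivAt_id t).smul_const v).const_add x
  exact (hc.hasFDerivAt _ h).comp_hasDerivAt t h1

lemma neg_of_hasDerivAt_pos {f : ℝ → ℝ} {f' t : ℝ} (hf : HasDerivAt f f' t) (h0 : f t = 0)
    (hf' : 0 < f') : ∀ᶠ s in 𝓝[<] t, f s < 0 := by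
  have := (hasDerivAt_iff_tendsto_slope_left_right.1 hf).1
  filter_upwards [this.eventually (lt_mem_nhds hf'), self_mem_nhdsWithin] with s hs hst
  rw [slope_def_field, h0, sub_zero] at hs
  have hst' : s - t < 0 := sub_neg.2 hst
  rcases lt_trichotomy (f s) 0 with h | h | h
  · exact h
  · simp [h] at hs
  · exact absurd hs (not_lt.2 (div_nonpos_of_nonneg_of_nonpos h.le hst'.le))

lemma neg_of_hasDerivAt_neg {f : ℝ → ℝ} {f' t : ℝ} (hf : HasDerivAt f f' t) (h0 : f t = 0)
    (hf' : f' < 0) : ∀ᶠ s in 𝓝[>] t, f s < 0 := by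
  have := (hasDerivAt_iff_tendsto_slope_left_right.1 hf).2
  filter_upwards [this.eventually (gt_mem_nhds hf'), self_mem_nhdsWithin] with s hs hst
  rw [slope_def_field, h0, sub_zero] at hs
  have hst' : 0 < s - t := sub_pos.2 hst
  rcases lt_or_ge (f s) 0 with h | h
  · exact h
  · exact absurd hs (not_lt.2 (div_nonneg h hst'.le))

lemma IsRegularDomain.exists_chart (hΩ : IsRegularDomain Ω n) {y : R3} (hy : y ∈ frontier Ω) :
    ∃ U φ g, y ∈ U ∧ IsBoundaryChart Ω n U φ g := by
  obtain ⟨U, φ, hU, hyU, hφ, hg0, hlt, hn⟩ := hΩ.boundary y hy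
  have hcd : ∀ z ∈ U, ContDiffAt ℝ 1 φ z := fun z hz => hφ.contDiffAt (hU.mem_nhds hz)
  have hfd : ∀ z ∈ U, HasFDerivAt φ (innerSL ℝ (gradient φ z)) z := fun z hz => by
    have := ((hcd z hz).differentiableAt one_ne_zero).hasGradientAt
    exact this.hasFDerivAt
  have hmem : ∀ z ∈ U, z ∈ Ω ↔ φ z < 0 := fun z hz => by
    have : z ∈ Ω ∩ U ↔ z ∈ {z ∈ U | φ z < 0} := by rw [hlt]
    simpa [hz] using this
  refine ⟨U, φ, gradient φ, hyU, hU, hcd, hfd, ?_, hg0, hmem, ?_, hn⟩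
  · have h1 : ContinuousOn (fun z => fderiv ℝ φ z) U := hφ.continuousOn_fderiv_of_isOpen hU le_rfl
    exact (InnerProductSpace.toDual ℝ R3).symm.continuous.comp_continuousOn h1
  · intro z hz
    rw [hΩ.isOpen.frontier_eq]
    have hcont : ContinuousAt φ z := (hcd z hz).continuousAt
    constructor
    · rintro ⟨hcl, hnot⟩
      rw [hmem z hz, not_lt] at hnot
      refine le_antisymm ?_ hnot
      by_contra! hpos
      rw [mem_closure_iff_frequently] at hcl
      have := (hcl.and_eventually ((hcont.eventually (lt_mem_nhds hpos)).and
        (hU.mem_nhds hz))).exists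
      obtain ⟨w, hw, hw1, hw2⟩ := this
      exact absurd ((hmem w hw2).1 hw) hw1.le.not_gt
    · intro h0
      refine ⟨?_, by rw [hmem z hz, h0]; exact lt_irrefl _⟩
      have hd : HasDerivAt (fun s : ℝ => φ (z + s • gradient φ z))
          (inner ℝ (gradient φ z) (gradient φ z)) 0 := by
        have h1 : HasDerivAt (fun s : ℝ => z + s • gradient φ z) (gradient φ z) 0 := by
          simpa using ((hasDerivAt_id (0 : ℝ)).smul_const (gradient φ z)).const_add z
        have h2 : HasFDerivAt φ (innerSL ℝ (gradient φ z)) (z + (0 : ℝ) • gradient φ z) := by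
          simpa using hfd z hz
        exact h2.comp_hasDerivAt (0 : ℝ) h1
      have hneg := neg_of_hasDerivAt_pos hd (by simpa using h0) (by
        rw [real_inner_self_eq_norm_sq]; have := norm_pos_iff.2 (hg0 z hz); positivity)
      have hct : Tendsto (fun s : ℝ => z + s • gradient φ z) (𝓝[<] 0) (𝓝 z) := by
        have : Continuous fun s : ℝ => z + s • gradient φ z := by fun_prop
        have := (this.tendsto 0).mono_left (nhdsWithin_le_nhds (s := Iio 0))
        simpa using this
      refine mem_closure_of_tendsto hct ?_
      filter_upwards [hneg, hct.eventually (hU.mem_nhds hz)] with s hs hsU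
      exact (hmem _ hsU).2 hs

lemma IsRegularDomain.norm_normal (hΩ : IsRegularDomain Ω n) {y : R3} (hy : y ∈ frontier Ω) :
    ‖n y‖ = 1 := by
  obtain ⟨U, φ, g, hyU, hc⟩ := hΩ.exists_chart hy
  rw [hc.normal_eq y hyU ((hc.mem_frontier_iff y hyU).1 hy), norm_smul, norm_inv, norm_norm]
  exact inv_mul_cancel₀ (norm_ne_zero_iff.2 (hc.ne_zero y hyU))

/-! ### Specular reflection -/

lemma inner_specular {y v : R3} (hn : ‖n y‖ = 1) :
    inner ℝ (specular n y v) (n y) = -inner ℝ v (n y) := by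
  simp only [specular, inner_sub_left, inner_smul_left, real_inner_self_eq_norm_sq, hn]
  simp; ring

lemma specular_specular {y v : R3} (hn : ‖n y‖ = 1) : specular n y (specular n y v) = v := by
  conv_lhs => rw [specular, inner_specular hn]
  simp [specular]

lemma specular_neg (y v : R3) : specular n y (-v) = -specular n y v := by
  simp [specular, sub_eq_add_neg]; abel

lemma norm_specular {y v : R3} (hn : ‖n y‖ = 1) : ‖specular n y v‖ = ‖v‖ := by
  have h : ‖specular n y v‖ ^ 2 = ‖v‖ ^ 2 := by
    rw [specular, norm_sub_sq_real, norm_smul, inner_smul_right, hn, mul_one, Real.norm_eq_abs,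
      sq_abs]
    ring
  exact (sq_eq_sq₀ (norm_nonneg _) (norm_nonneg _)).1 h

/-! ### Straight segments and the boundary -/

lemma mem_of_forall_notMem_frontier (hΩ : IsOpen Ω) {x v : R3} {a b s₀ : ℝ} (hs₀ : s₀ ∈ Icc a b)
    (h₀ : x + s₀ • v ∈ Ω) (h : ∀ s ∈ Icc a b, x + s • v ∉ frontier Ω) :
    ∀ s ∈ Icc a b, x + s • v ∈ Ω := by
  have hpre : IsPreconnected ((fun s : ℝ => x + s • v) '' Icc a b) :=
    isPreconnected_Icc.image _ (by fun_prop)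
  have hne : ((fun s : ℝ => x + s • v) '' Icc a b ∩ Ω).Nonempty :=
    ⟨x + s₀ • v, ⟨s₀, hs₀, rfl⟩, h₀⟩
  have hsub := hpre.subset_left_of_subset_union hΩ isClosed_closure.isOpen_compl
    (disjoint_compl_right.mono_left subset_closure) (by
      rintro _ ⟨s, hs, rfl⟩
      have := h s hs
      rw [hΩ.frontier_eq] at this
      by_cases hc : x + s • v ∈ closure Ω
      · left; by_contra h'; exact this ⟨hc, h'⟩
      · right; exact hc) hne
  exact fun s hs => hsub ⟨s, hs, rfl⟩

lemma notMem_frontier_of_mem (hΩ : IsOpen Ω) {x : R3} (hx : x ∈ Ω) : x ∉ frontier Ω := by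
  rw [hΩ.frontier_eq]; exact fun h => h.2 hx

/-- If the line is in `Ω` at some positive time before the first hitting time, then it is so at
all such times. -/
lemma mem_of_lt_hitTime (hΩ : IsOpen Ω) {p : R3 × R3} {s₀ : ℝ} (hs₀ : 0 < s₀)
    (hs₀' : ENNReal.ofReal s₀ < hitTime Ω p) (h₀ : p.1 + s₀ • p.2 ∈ Ω) {s : ℝ} (hs : 0 < s)
    (hs' : ENNReal.ofReal s < hitTime Ω p) : p.1 + s • p.2 ∈ Ω := by
  refine mem_of_forall_notMem_frontier hΩ (a := min s₀ s) (b := max s₀ s) (s₀ := s₀)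
    (mem_Icc.2 ⟨min_le_left _ _, le_max_left _ _⟩) h₀ (fun r hr => ?_) s
    (mem_Icc.2 ⟨min_le_right _ _, le_max_right _ _⟩)
  refine notMem_frontier_of_lt_hitTime (lt_of_lt_of_le (lt_min hs₀ hs) hr.1) ?_
  refine (ENNReal.ofReal_le_ofReal hr.2).trans_lt ?_
  rcases max_cases s₀ s with h | h <;> rw [h.1] <;> assumption

lemma eventually_line_mem {U : Set R3} (hU : IsOpen U) {x v : R3} {t : ℝ} (h : x + t • v ∈ U) :
    ∀ᶠ s in 𝓝 t, x + s • v ∈ U :=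
  (show Continuous fun s : ℝ => x + s • v by fun_prop).continuousAt.eventually (hU.mem_nhds h)

lemma lt_hitTime_of_forall_mem (hΩ : IsOpen Ω) {p : R3 × R3} {T : ℝ} (hT : 0 ≤ T)
    (h : ∀ t, 0 < t → t ≤ T → p.1 + t • p.2 ∈ Ω) (hlast : p.1 + T • p.2 ∈ Ω) :
    ENNReal.ofReal T < hitTime Ω p := by
  obtain ⟨ε, hε, hball⟩ := Metric.eventually_nhds_iff.1 (eventually_line_mem hΩ hlast)
  refine lt_of_lt_of_le (b := ENNReal.ofReal (T + ε))
    ((ENNReal.ofReal_lt_ofReal_iff_of_nonneg hT).2 (by linarith)) ?_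
  rw [le_hitTime_iff]
  intro t ht hf
  refine ENNReal.ofReal_le_ofReal ?_
  by_contra! hlt
  refine notMem_frontier_of_mem hΩ ?_ hf
  rcases le_or_gt t T with h1 | h1
  · exact h t ht h1
  · exact hball (by rw [Real.dist_eq, abs_of_pos (by linarith)]; linarith)

lemma hitTime_pos (hΩ : IsOpen Ω) {p : R3 × R3} (hp : p.1 ∈ Ω) : 0 < hitTime Ω p := by
  simpa using lt_hitTime_of_forall_mem hΩ le_rfl (p := p)
    (fun t h1 h2 => absurd h1 h2.not_gt) (by simpa using hp)

lemma mem_of_lt_hitTime' (hΩ : IsOpen Ω) {p : R3 × R3} (hp : p.1 ∈ Ω) {s : ℝ} (hs : 0 ≤ s)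
    (hs' : ENNReal.ofReal s < hitTime Ω p) : p.1 + s • p.2 ∈ Ω := by
  refine mem_of_forall_notMem_frontier hΩ (a := 0) (b := s) (s₀ := 0) ⟨le_rfl, hs⟩ (by simpa)
    (fun r hr => ?_) s ⟨hs, le_rfl⟩
  rcases hr.1.eq_or_lt with h | h
  · subst h; simpa using notMem_frontier_of_mem hΩ hp
  · exact notMem_frontier_of_lt_hitTime h ((ENNReal.ofReal_le_ofReal hr.2).trans_lt hs')

/-- The first hitting time is attained. -/
lemma collide_mem_frontier {p : R3 × R3} (h0 : 0 < hitTime Ω p) (h : hitTime Ω p ≠ ⊤) :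
    (collide Ω n p).1 ∈ frontier Ω := by
  by_contra hnot
  set T := (hitTime Ω p).toReal with hT
  have hTpos : 0 < T := ENNReal.toReal_pos h0.ne' h
  have hTe : ENNReal.ofReal T = hitTime Ω p := ENNReal.ofReal_toReal h
  have h1 : p.1 + T • p.2 ∈ (frontier Ω)ᶜ := hnot
  obtain ⟨ε, hε, hball⟩ := Metric.eventually_nhds_iff.1
    (eventually_line_mem isClosed_frontier.isOpen_compl h1)
  have : ENNReal.ofReal (T + ε) ≤ hitTime Ω p := by
    rw [le_hitTime_iff]
    intro t ht hf
    refine ENNReal.ofReal_le_ofReal ?_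
    by_contra! hlt
    have hTt : T ≤ t := by
      have := hitTime_le ht hf
      rw [← hTe] at this
      exact (ENNReal.ofReal_le_ofReal_iff ht.le).1 this
    exact hball (by rw [Real.dist_eq, abs_of_nonneg (by linarith)]; linarith) hf
  rw [← hTe] at this
  have := (ENNReal.ofReal_le_ofReal_iff hTpos.le).1 this
  linarith

/-- A trajectory coming from inside `Ω` meets the boundary with a nonnegative normal velocity. -/
lemma inner_normal_nonneg (hΩ : IsRegularDomain Ω n) {p : R3 × R3} (hp : p.1 ∈ Ω)
    (h : hitTime Ω p ≠ ⊤) : 0 ≤ inner ℝ p.2 (n (collide Ω n p).1) := by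
  have h0 := hitTime_pos hΩ.isOpen hp
  have hf := collide_mem_frontier (n := n) h0 h
  obtain ⟨U, φ, g, hyU, hc⟩ := hΩ.exists_chart hf
  have hφ0 := (hc.mem_frontier_iff _ hyU).1 hf
  rw [hc.normal_eq _ hyU hφ0, inner_smul_right, real_inner_comm]
  set T := (hitTime Ω p).toReal with hT
  have hTpos : 0 < T := ENNReal.toReal_pos h0.ne' h
  have hTe : ENNReal.ofReal T = hitTime Ω p := ENNReal.ofReal_toReal h
  refine mul_nonneg (by positivity) ?_
  by_contra! hneg
  have hd := hc.hasDerivAt (x := p.1) (v := p.2) (t := T) hyU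
  have hd' := hd.neg
  have hev := neg_of_hasDerivAt_pos hd' (neg_eq_zero.2 hφ0) (by
    change 0 < -inner ℝ (g (collide Ω n p).1) p.2
    linarith)
  have hev2 : ∀ᶠ s in 𝓝[<] T, p.1 + s • p.2 ∈ U :=
    nhdsWithin_le_nhds (eventually_line_mem hc.isOpen hyU)
  have hev3 : ∀ᶠ s in 𝓝[<] T, 0 < s := nhdsWithin_le_nhds (lt_mem_nhds hTpos)
  obtain ⟨s, h1, h2, h3, h4⟩ := (hev.and (hev2.and (hev3.and self_mem_nhdsWithin))).exists
  have hmem := mem_of_lt_hitTime' hΩ.isOpen hp h3.le (by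
    rw [← hTe]; exact (ENNReal.ofReal_lt_ofReal_iff hTpos).2 h4)
  have := (hc.mem_iff _ h2).1 hmem
  simp at h1
  linarith

/-- A velocity pointing strictly inward leads into `Ω`. -/
lemma eventually_mem_of_inward (hΩ : IsRegularDomain Ω n) {y w : R3} (hy : y ∈ frontier Ω)
    (hw : inner ℝ w (n y) < 0) : ∀ᶠ s in 𝓝[>] (0 : ℝ), y + s • w ∈ Ω := by
  obtain ⟨U, φ, g, hyU, hc⟩ := hΩ.exists_chart hy
  have hφ0 := (hc.mem_frontier_iff _ hyU).1 hy
  rw [hc.normal_eq _ hyU hφ0, inner_smul_right, real_inner_comm] at hw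
  have hg : inner ℝ (g y) w < 0 := by
    by_contra! h
    exact absurd hw (not_lt.2 (mul_nonneg (by positivity) h))
  have hyU' : y + (0 : ℝ) • w ∈ U := by simpa using hyU
  have hd := hc.hasDerivAt hyU'
  have hev := neg_of_hasDerivAt_neg hd (by simpa using hφ0) (by simpa using hg)
  have hev2 : ∀ᶠ s in 𝓝[>] (0 : ℝ), y + s • w ∈ U :=
    nhdsWithin_le_nhds (eventually_line_mem hc.isOpen hyU')
  filter_upwards [hev, hev2] with s h1 h2
  exact (hc.mem_iff _ h2).2 h1

/-- After a transversal collision the line stays in `Ω` until the next collision. -/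
lemma mem_of_inward (hΩ : IsRegularDomain Ω n) {p : R3 × R3} (hy : p.1 ∈ frontier Ω)
    (hw : inner ℝ p.2 (n p.1) < 0) {s : ℝ} (hs : 0 < s)
    (hs' : ENNReal.ofReal s < hitTime Ω p) : p.1 + s • p.2 ∈ Ω := by
  have hev := eventually_mem_of_inward hΩ hy hw
  have hev2 : ∀ᶠ r in 𝓝[>] (0 : ℝ), r < s := nhdsWithin_le_nhds (gt_mem_nhds hs)
  obtain ⟨r, h1, h2, h3⟩ := (hev.and (hev2.and self_mem_nhdsWithin)).exists
  exact mem_of_lt_hitTime hΩ.isOpen h3 ((ENNReal.ofReal_le_ofReal h2.le).trans_lt hs') h1 hs hs'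

/-! ### Steps with at most one collision -/

/-- Phase points in `Ω × ℝ³` whose trajectory has, on `[0, h]`, either no collision or exactly one
collision, which is transversal and takes place before time `h`. -/
def stepSet (Ω : Set R3) (n : R3 → R3) (h : ℝ) : Set (R3 × R3) :=
  {p | p.1 ∈ Ω ∧ (ENNReal.ofReal h < hitTime Ω p ∨
    (hitTime Ω p < ENNReal.ofReal h ∧ 0 < inner ℝ p.2 (n (collide Ω n p).1) ∧
      ENNReal.ofReal h < hitTime Ω p + hitTime Ω (collide Ω n p)))}

lemma measurableSet_stepSet (hΩ : IsRegularDomain Ω n) (h : ℝ) :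
    MeasurableSet (stepSet Ω n h) := by
  have hn := hΩ.contDiff_normal.continuous
  have h1 := measurable_hitTime Ω
  have h2 := measurable_collide (Ω := Ω) hn
  refine (hΩ.isOpen.measurableSet.preimage measurable_fst).inter ?_
  refine (measurableSet_lt measurable_const h1).union ?_
  refine (measurableSet_lt h1 measurable_const).inter ?_
  refine MeasurableSet.inter ?_ (measurableSet_lt measurable_const (h1.add (h1.comp h2)))
  exact measurableSet_lt measurable_const
    (measurable_snd.inner (𝕜 := ℝ) (hn.measurable.comp h2.fst))

/-- The elements of a one-collision step: `T` is the collision time, `(y, w)` the state just after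
the collision. -/
structure IsCollisionStep (Ω : Set R3) (n : R3 → R3) (h : ℝ) (p : R3 × R3) (T : ℝ) (y w : R3) :
    Prop where
  mem : p.1 ∈ Ω
  pos : 0 < T
  lt : T < h
  hitTime_eq : hitTime Ω p = ENNReal.ofReal T
  collide_eq : collide Ω n p = (y, w)
  position : y = p.1 + T • p.2
  velocity : w = specular n y p.2
  mem_frontier : y ∈ frontier Ω
  transversal : 0 < inner ℝ p.2 (n y)
  lt_next : ENNReal.ofReal (h - T) < hitTime Ω (y, w)

lemma exists_isCollisionStep (hΩ : IsRegularDomain Ω n) {h : ℝ} {p : R3 × R3} (hp : p.1 ∈ Ω)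
    (h1 : hitTime Ω p < ENNReal.ofReal h) (h2 : 0 < inner ℝ p.2 (n (collide Ω n p).1))
    (h3 : ENNReal.ofReal h < hitTime Ω p + hitTime Ω (collide Ω n p)) :
    IsCollisionStep Ω n h p (hitTime Ω p).toReal (collide Ω n p).1 (collide Ω n p).2 := by
  have h0 := hitTime_pos hΩ.isOpen hp
  have htop := h1.ne_top
  have hTe : ENNReal.ofReal (hitTime Ω p).toReal = hitTime Ω p := ENNReal.ofReal_toReal htop
  have hlt : (hitTime Ω p).toReal < h := by
    rw [← hTe] at h1
    exact (ENNReal.ofReal_lt_ofReal_iff_of_nonneg ENNReal.toReal_nonneg).1 h1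
  refine ⟨hp, ENNReal.toReal_pos h0.ne' htop, hlt, hTe.symm, rfl, rfl, rfl,
    collide_mem_frontier h0 htop, h2, ?_⟩
  have : ENNReal.ofReal h = hitTime Ω p + ENNReal.ofReal (h - (hitTime Ω p).toReal) := by
    rw [← hTe, ← ENNReal.ofReal_add ENNReal.toReal_nonneg (by rw [hTe]; linarith), hTe]
    congr 1; ring
  rw [this] at h3
  exact (ENNReal.add_lt_add_iff_left htop).1 h3

namespace IsCollisionStep

variable {h : ℝ} {p : R3 × R3} {T : ℝ} {y w : R3}

lemma collisionTime_one (hs : IsCollisionStep Ω n h p T y w) :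
    collisionTime Ω n 1 p = ENNReal.ofReal T := by
  rw [collisionTime_succ, collisionTime_zero, zero_add, Function.iterate_zero, id, hs.hitTime_eq]

lemma lt_collisionTime_two (hs : IsCollisionStep Ω n h p T y w) :
    ENNReal.ofReal h < collisionTime Ω n 2 p := by
  have : h = T + (h - T) := by ring
  rw [collisionTime_succ, hs.collisionTime_one, Function.iterate_one, hs.collide_eq, this,
    ENNReal.ofReal_add hs.pos.le (sub_pos.2 hs.lt).le]
  exact (ENNReal.add_lt_add_iff_left ENNReal.ofReal_ne_top).2 (by simpa using hs.lt_next)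

lemma definedAt (hs : IsCollisionStep Ω n h p T y w) : DefinedAt Ω n h p :=
  definedAt_iff.2 ⟨2, hs.lt_collisionTime_two⟩

lemma trajectory_eq (hs : IsCollisionStep Ω n h p T y w) :
    trajectory Ω n h p = (y + (h - T) • w, w) := by
  rw [_root_.trajectory_eq (k := 1) (by
    rw [hs.collisionTime_one]; exact ENNReal.ofReal_le_ofReal hs.lt.le) hs.lt_collisionTime_two,
    hs.collisionTime_one, ENNReal.toReal_ofReal hs.pos.le, Function.iterate_one, hs.collide_eq]
  rfl

lemma norm_normal (hΩ : IsRegularDomain Ω n) (hs : IsCollisionStep Ω n h p T y w) : ‖n y‖ = 1 :=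
  hΩ.norm_normal hs.mem_frontier

lemma inward (hΩ : IsRegularDomain Ω n) (hs : IsCollisionStep Ω n h p T y w) :
    inner ℝ w (n y) < 0 := by
  rw [hs.velocity, inner_specular (hs.norm_normal hΩ)]; linarith [hs.transversal]

lemma mem_after (hΩ : IsRegularDomain Ω n) (hs : IsCollisionStep Ω n h p T y w) {s : ℝ}
    (h0 : 0 < s) (hsT : s ≤ h - T) : y + s • w ∈ Ω :=
  mem_of_inward (p := (y, w)) hΩ hs.mem_frontier (hs.inward hΩ) h0
    ((ENNReal.ofReal_le_ofReal hsT).trans_lt hs.lt_next)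

lemma mem_before (hΩ : IsRegularDomain Ω n) (hs : IsCollisionStep Ω n h p T y w) {s : ℝ}
    (h0 : 0 ≤ s) (hsT : s < T) : p.1 + s • p.2 ∈ Ω :=
  mem_of_lt_hitTime' hΩ.isOpen hs.mem h0 (by
    rw [hs.hitTime_eq]; exact (ENNReal.ofReal_lt_ofReal_iff hs.pos).2 hsT)

/-- Time reversal of a one-collision step. -/
lemma reversed (hΩ : IsRegularDomain Ω n) (hs : IsCollisionStep Ω n h p T y w) :
    IsCollisionStep Ω n h (y + (h - T) • w, -w) (h - T) y (-p.2) := by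
  have hT := hs.pos
  have hTh := hs.lt
  have hpos : ∀ t : ℝ, y + (h - T) • w + t • -w = y + (h - T - t) • w := fun t => by
    rw [smul_neg, sub_smul _ t]; abel
  have hhit : hitTime Ω (y + (h - T) • w, -w) = ENNReal.ofReal (h - T) := by
    apply le_antisymm
    · refine hitTime_le (by linarith) ?_
      change y + (h - T) • w + (h - T) • -w ∈ _
      rw [hpos, sub_self, zero_smul, add_zero]
      exact hs.mem_frontier
    · rw [le_hitTime_iff]
      intro t ht hf
      refine ENNReal.ofReal_le_ofReal ?_
      by_contra! hlt
      change y + (h - T) • w + t • -w ∈ _ at hf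
      rw [hpos] at hf
      exact notMem_frontier_of_mem hΩ.isOpen (hs.mem_after hΩ (by linarith) (by linarith)) hf
  have hvel : -p.2 = specular n y (-w) := by
    rw [specular_neg, hs.velocity, specular_specular (hs.norm_normal hΩ)]
  have hback : ∀ t : ℝ, y + t • -p.2 = p.1 + (T - t) • p.2 := fun t => by
    rw [hs.position, smul_neg, sub_smul]; abel
  have hyeq : y = y + (h - T) • w + (h - T) • -w := by rw [hpos, sub_self, zero_smul, add_zero]
  refine ⟨hs.mem_after hΩ (by linarith) le_rfl, by linarith, by linarith, hhit, ?_, hyeq, hvel,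
    hs.mem_frontier, ?_, ?_⟩
  · have hyc : (collide Ω n (y + (h - T) • w, -w)).1 = y := by
      change y + (h - T) • w + (hitTime Ω (y + (h - T) • w, -w)).toReal • -w = y
      rw [hhit, ENNReal.toReal_ofReal (by linarith), ← hyeq]
    refine Prod.ext hyc ?_
    change specular n (collide Ω n (y + (h - T) • w, -w)).1 (-w) = -p.2
    rw [hyc, hvel]
  · change 0 < inner ℝ (-w) (n y)
    rw [inner_neg_left]; linarith [hs.inward hΩ]
  · rw [sub_sub_cancel]
    refine lt_hitTime_of_forall_mem hΩ.isOpen hT.le (fun t h1 h2 => ?_) ?_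
    · change y + t • -p.2 ∈ Ω
      rw [hback]; exact hs.mem_before hΩ (by linarith) (by linarith)
    · change y + T • -p.2 ∈ Ω
      rw [hback]; simpa using hs.mem

end IsCollisionStep

lemma IsCollisionStep.mem_stepSet {h : ℝ} {p : R3 × R3} {T : ℝ} {y w : R3}
    (hs : IsCollisionStep Ω n h p T y w) : p ∈ stepSet Ω n h := by
  refine ⟨hs.mem, Or.inr ⟨?_, ?_, ?_⟩⟩
  · rw [hs.hitTime_eq]
    exact (ENNReal.ofReal_lt_ofReal_iff (hs.pos.trans hs.lt)).2 hs.lt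
  · rw [hs.collide_eq]; exact hs.transversal
  · have := hs.lt_collisionTime_two
    rwa [collisionTime_succ', collisionTime_succ, collisionTime_zero, zero_add] at this

lemma mem_stepSet_cases (hΩ : IsRegularDomain Ω n) {h : ℝ} {p : R3 × R3}
    (hp : p ∈ stepSet Ω n h) :
    (p.1 ∈ Ω ∧ ENNReal.ofReal h < hitTime Ω p) ∨ ∃ T y w, IsCollisionStep Ω n h p T y w := by
  obtain ⟨h0, h1 | ⟨h1, h2, h3⟩⟩ := hp
  · exact Or.inl ⟨h0, h1⟩
  · exact Or.inr ⟨_, _, _, exists_isCollisionStep hΩ h0 h1 h2 h3⟩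

lemma definedAt_of_mem_stepSet (hΩ : IsRegularDomain Ω n) {h : ℝ} {p : R3 × R3}
    (hp : p ∈ stepSet Ω n h) : DefinedAt Ω n h p := by
  rcases mem_stepSet_cases hΩ hp with ⟨-, h1⟩ | ⟨T, y, w, hs⟩
  · exact definedAt_of_lt_hitTime h1
  · exact hs.definedAt

lemma trajectory_mem_of_mem_stepSet (hΩ : IsRegularDomain Ω n) {h : ℝ} (hh : 0 ≤ h) {p : R3 × R3}
    (hp : p ∈ stepSet Ω n h) : (trajectory Ω n h p).1 ∈ Ω := by
  rcases mem_stepSet_cases hΩ hp with ⟨h0, h1⟩ | ⟨T, y, w, hs⟩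
  · rw [trajectory_of_lt_hitTime h1]; exact mem_of_lt_hitTime' hΩ.isOpen h0 hh h1
  · rw [hs.trajectory_eq]; exact hs.mem_after hΩ (by linarith [hs.lt]) le_rfl

lemma norm_trajectory_of_mem_stepSet (hΩ : IsRegularDomain Ω n) {h : ℝ} {p : R3 × R3}
    (hp : p ∈ stepSet Ω n h) : ‖(trajectory Ω n h p).2‖ = ‖p.2‖ := by
  rcases mem_stepSet_cases hΩ hp with ⟨h0, h1⟩ | ⟨T, y, w, hs⟩
  · rw [trajectory_of_lt_hitTime h1]; rfl
  · rw [hs.trajectory_eq]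
    change ‖w‖ = _
    rw [hs.velocity, norm_specular (hs.norm_normal hΩ)]

lemma norm_trajectory_sub_le (hΩ : IsRegularDomain Ω n) {h : ℝ} (hh : 0 ≤ h) {p : R3 × R3}
    (hp : p ∈ stepSet Ω n h) : ‖(trajectory Ω n h p).1‖ ≤ ‖p.1‖ + h * ‖p.2‖ := by
  rcases mem_stepSet_cases hΩ hp with ⟨h0, h1⟩ | ⟨T, y, w, hs⟩
  · rw [trajectory_of_lt_hitTime h1]
    refine (norm_add_le _ _).trans ?_
    rw [norm_smul, Real.norm_of_nonneg hh]
  · rw [hs.trajectory_eq]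
    have hw : ‖w‖ = ‖p.2‖ := by rw [hs.velocity, norm_specular (hs.norm_normal hΩ)]
    have h1 := norm_add_le (p.1 + T • p.2) ((h - T) • w)
    have h2 := norm_add_le p.1 (T • p.2)
    rw [norm_smul, Real.norm_of_nonneg hs.pos.le] at h2
    rw [norm_smul, Real.norm_of_nonneg (sub_pos.2 hs.lt).le, hw] at h1
    change ‖y + (h - T) • w‖ ≤ _
    rw [hs.position]
    linarith

/-- Reversibility of the dynamics over one step. -/
lemma reverse_trajectory_of_mem_stepSet (hΩ : IsRegularDomain Ω n) {h : ℝ} (hh : 0 ≤ h)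
    {p : R3 × R3} (hp : p ∈ stepSet Ω n h) :
    reverse (trajectory Ω n h p) ∈ stepSet Ω n h ∧
      trajectory Ω n h (reverse (trajectory Ω n h p)) = reverse p := by
  rcases mem_stepSet_cases hΩ hp with ⟨h0, h1⟩ | ⟨T, y, w, hs⟩
  · have hback : ∀ t : ℝ, p.1 + h • p.2 + t • -p.2 = p.1 + (h - t) • p.2 := fun t => by
      rw [smul_neg, sub_smul]; abel
    have hlt : ENNReal.ofReal h < hitTime Ω (reverse (trajectory Ω n h p)) := by
      rw [trajectory_of_lt_hitTime h1]
      refine lt_hitTime_of_forall_mem hΩ.isOpen hh (fun t ht1 ht2 => ?_) ?_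
      · change p.1 + h • p.2 + t • -p.2 ∈ Ω
        rw [hback]
        exact mem_of_lt_hitTime' hΩ.isOpen h0 (by linarith)
          ((ENNReal.ofReal_le_ofReal (by linarith)).trans_lt h1)
      · change p.1 + h • p.2 + h • -p.2 ∈ Ω
        rw [hback]; simpa using h0
    refine ⟨⟨?_, Or.inl hlt⟩, ?_⟩
    · exact trajectory_mem_of_mem_stepSet hΩ hh hp
    · rw [trajectory_of_lt_hitTime hlt, trajectory_of_lt_hitTime h1]
      simp [freeFlight, reverse]
  · have hr := hs.reversed hΩ
    have : reverse (trajectory Ω n h p) = (y + (h - T) • w, -w) := by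
      rw [hs.trajectory_eq]; rfl
    rw [this]
    refine ⟨hr.mem_stepSet, ?_⟩
    rw [hr.trajectory_eq, sub_sub_cancel, hs.position]
    simp [reverse]

lemma injOn_trajectory_stepSet (hΩ : IsRegularDomain Ω n) {h : ℝ} (hh : 0 ≤ h) :
    InjOn (trajectory Ω n h) (stepSet Ω n h) := by
  intro p hp q hq hpq
  have h1 := (reverse_trajectory_of_mem_stepSet hΩ hh hp).2
  have h2 := (reverse_trajectory_of_mem_stepSet hΩ hh hq).2
  rw [hpq, h2] at h1
  rw [← reverse_reverse p, ← h1, reverse_reverse]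

end

section

variable {Ω : Set R3} {n : R3 → R3}

/-! ### Volume-preserving maps of phase space -/

/-- The Lebesgue measure of `ℝ³ × ℝ³` is defined as a product, which has to be unfolded here. -/
instance isAddHaarMeasure_volume_phase : (volume : Measure (R3 × R3)).IsAddHaarMeasure :=
  inferInstanceAs ((volume : Measure R3).prod (volume : Measure R3)).IsAddHaarMeasure

lemma abs_det_eq_one_of_measurePreserving {L : R3 × R3 →L[ℝ] R3 × R3}
    (hL : MeasurePreserving L volume volume) (hs : Function.Surjective L) : |L.det| = 1 := by
  have h1 := Measure.addHaar_image_continuousLinearMap volume L (L ⁻¹' Metric.ball 0 1)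
  rw [image_preimage_eq _ hs, hL.measure_preimage measurableSet_ball.nullMeasurableSet] at h1
  have h0 : volume (Metric.ball (0 : R3 × R3) 1) ≠ 0 :=
    (Metric.measure_ball_pos volume _ one_pos).ne'
  have htop : volume (Metric.ball (0 : R3 × R3) 1) ≠ ⊤ := measure_ball_lt_top.ne
  have h2 : ENNReal.ofReal |LinearMap.det (L : R3 × R3 →ₗ[ℝ] R3 × R3)| = 1 := by
    nth_rewrite 1 [← one_mul (volume (Metric.ball (0 : R3 × R3) 1))] at h1
    exact ((ENNReal.mul_left_inj h0 htop).1 h1).symm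
  rwa [ENNReal.ofReal_eq_one] at h2

lemma measurePreserving_freeFlight (s : ℝ) : MeasurePreserving (freeFlight s) volume volume := by
  have h1 : MeasurePreserving (fun p : R3 × R3 => (p.1, p.2 + s • p.1))
      (volume.prod volume) (volume.prod volume) :=
    (MeasurePreserving.id volume).skew_product (g := fun v x => x + s • v)
      (by unfold Function.uncurry; fun_prop)
      (ae_of_all _ fun v => (measurePreserving_add_right volume (s • v)).map_eq)
  exact (Measure.measurePreserving_swap.comp h1).comp Measure.measurePreserving_swap

lemma measurePreserving_reverse : MeasurePreserving reverse volume volume :=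
  (MeasurePreserving.id (volume : Measure R3)).prod (Measure.measurePreserving_neg volume)

lemma measurePreserving_reflect {e : R3} (he : ‖e‖ = 1) :
    MeasurePreserving (fun v : R3 => v - (2 * inner ℝ v e) • e) volume volume := by
  have h : (fun v : R3 => v - (2 * inner ℝ v e) • e) = ((ℝ ∙ e)ᗮ).reflection := by
    ext1 v
    rw [Submodule.reflection_orthogonal_apply, Submodule.reflection_singleton_apply, he,
      real_inner_comm]
    simp [two_smul, two_mul, add_smul]
  rw [h]
  exact LinearIsometryEquiv.measurePreserving _

/-- Free flight as a continuous linear map. -/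
def freeFlightL (s : ℝ) : R3 × R3 →L[ℝ] R3 × R3 :=
  (ContinuousLinearMap.fst ℝ R3 R3 + s • ContinuousLinearMap.snd ℝ R3 R3).prod
    (ContinuousLinearMap.snd ℝ R3 R3)

lemma coe_freeFlightL (s : ℝ) : ⇑(freeFlightL s) = freeFlight s := by
  ext1 p; simp [freeFlightL, freeFlight]

lemma surjective_freeFlight (s : ℝ) : Function.Surjective (freeFlight s) := fun p =>
  ⟨freeFlight (-s) p, by rw [freeFlight_freeFlight]; simp⟩

lemma hasFDerivAt_freeFlight (s : ℝ) (p : R3 × R3) :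
    HasFDerivAt (freeFlight s) (freeFlightL s) p := by
  rw [← coe_freeFlightL]; exact (freeFlightL s).hasFDerivAt

/-! ### Regularity of the first hitting time -/

lemma eventually_lt_hitTime (hΩ : IsOpen Ω) {p : R3 × R3} (hp : p.1 ∈ Ω) {s : ℝ} (hs : 0 ≤ s)
    (h : ENNReal.ofReal s < hitTime Ω p) :
    ∀ᶠ q in 𝓝 p, q.1 ∈ Ω ∧ ENNReal.ofReal s < hitTime Ω q := by
  have h1 : ∀ᶠ q in 𝓝 p, ∀ t ∈ Icc (0 : ℝ) s, q.1 + t • q.2 ∈ Ω := by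
    refine isCompact_Icc.eventually_forall_of_forall_eventually fun t ht => ?_
    have hc : Continuous fun z : (R3 × R3) × ℝ => z.1.1 + z.2 • z.1.2 := by fun_prop
    exact hc.continuousAt.eventually (hΩ.mem_nhds
      (mem_of_lt_hitTime' hΩ hp ht.1 ((ENNReal.ofReal_le_ofReal ht.2).trans_lt h)))
  filter_upwards [h1] with q hq
  refine ⟨by simpa using hq 0 ⟨le_rfl, hs⟩,
    lt_hitTime_of_forall_mem hΩ hs (fun t h1 h2 => hq t ⟨h1.le, h2⟩) (hq s ⟨hs, le_rfl⟩)⟩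

/-- Near a transversal point of the boundary, reached with velocity `v₀`, the time at which a line
meets the boundary is a differentiable function of the line. -/
lemma exists_local_hitTime {U : Set R3} {φ : R3 → ℝ} {g : R3 → R3}
    (hc : IsBoundaryChart Ω n U φ g) {y v₀ : R3} (hyU : y ∈ U) (hφ : φ y = 0)
    (hv : inner ℝ (g y) v₀ ≠ 0) :
    ∃ (ψ : R3 × R3 → ℝ) (ψ' : R3 × R3 →L[ℝ] ℝ), ψ (y, v₀) = 0 ∧ HasFDerivAt ψ ψ' (y, v₀) ∧
      (∀ᶠ q in 𝓝 (y, v₀), φ (q.1 + ψ q • q.2) = 0) ∧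
      ∀ᶠ u in 𝓝 ((y, v₀), (0 : ℝ)), φ (u.1.1 + u.2 • u.1.2) = 0 → ψ u.1 = u.2 := by
  set Θ : (R3 × R3) × ℝ → ℝ := fun u => φ (u.1.1 + u.2 • u.1.2) with hΘ
  set u₀ : (R3 × R3) × ℝ := ((y, v₀), 0) with hu₀
  have hΘ0 : Θ u₀ = 0 := by simp [hΘ, hu₀, hφ]
  have hyU' : u₀.1.1 + u₀.2 • u₀.1.2 ∈ U := by simpa [hu₀] using hyU
  have cdf : ContDiffAt ℝ 1 Θ u₀ := by
    have h1 : ContDiffAt ℝ 1 (fun u : (R3 × R3) × ℝ => u.1.1 + u.2 • u.1.2) u₀ := by fun_prop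
    exact (hc.contDiffAt _ hyU').comp u₀ h1
  have hinv : (fderiv ℝ Θ u₀ ∘L .inr ℝ (R3 × R3) ℝ).IsInvertible := by
    refine ⟨ContinuousLinearEquiv.unitsEquivAut ℝ (Units.mk0 _ hv), ?_⟩
    ext
    have h1 : HasDerivAt (fun s : ℝ => ((y, v₀), s)) ((0 : R3 × R3), (1 : ℝ)) 0 :=
      (hasDerivAt_const _ _).prodMk (hasDerivAt_id _)
    have h2 : HasDerivAt (fun s : ℝ => Θ ((y, v₀), s)) (fderiv ℝ Θ u₀ (0, 1)) 0 :=
      ((cdf.differentiableAt one_ne_zero).hasFDerivAt).comp_hasDerivAt 0 h1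
    have h3 := hc.hasDerivAt (x := y) (v := v₀) (t := 0) (by simpa using hyU)
    have h4 := h2.unique h3
    simp only [zero_smul, add_zero] at h4
    simp [h4]
  refine ⟨cdf.implicitFunction one_ne_zero hinv, _, cdf.implicitFunction_apply_self _ _,
    (cdf.hasStrictFDerivAt_implicitFunction one_ne_zero hinv).hasFDerivAt, ?_, ?_⟩
  · filter_upwards [cdf.eventually_apply_implicitFunction one_ne_zero hinv] with q hq
    rw [hΘ0] at hq; exact hq
  · filter_upwards [cdf.eventually_apply_eq_iff_implicitFunction one_ne_zero hinv] with u hu h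
    exact hu.1 (by rw [hΘ0]; exact h)

/-- The map `(x, v) ↦ (y - T w, w)` which replaces a line by its reflection at the boundary point
`y = x + T v`, the hitting time `T` being given as a function `ψ`. -/
def reflectLine (n : R3 → R3) (ψ : R3 × R3 → ℝ) (q : R3 × R3) : R3 × R3 :=
  (q.1 + ψ q • q.2 - ψ q • specular n (q.1 + ψ q • q.2) q.2, specular n (q.1 + ψ q • q.2) q.2)

/-- At a boundary point the derivative of `reflectLine` is block triangular, with the reflection
with respect to the tangent plane as both diagonal blocks; hence it preserves the volume.  The
off-diagonal block, which contains the curvature of the boundary, plays no role. -/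
lemma hasFDerivAt_reflectLine (hn : ContDiff ℝ 1 n) {U : Set R3} {φ : R3 → ℝ} {g : R3 → R3}
    (hc : IsBoundaryChart Ω n U φ g) {y v₀ : R3} (hyU : y ∈ U) (hφ : φ y = 0)
    (hv : inner ℝ (g y) v₀ ≠ 0) {ψ : R3 × R3 → ℝ} {ψ' : R3 × R3 →L[ℝ] ℝ} (hψ0 : ψ (y, v₀) = 0)
    (hψ : HasFDerivAt ψ ψ' (y, v₀))
    (hψφ : ∀ᶠ q in 𝓝 (y, v₀), φ (q.1 + ψ q • q.2) = 0) :
    ∃ D : R3 × R3 →L[ℝ] R3 × R3, HasFDerivAt (reflectLine n ψ) D (y, v₀) ∧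
      MeasurePreserving D volume volume ∧ Function.Surjective D := by
  have hgne := hc.ne_zero y hyU
  have hny : n y = ‖g y‖⁻¹ • g y := hc.normal_eq y hyU hφ
  have hn1 : ‖n y‖ = 1 := by
    rw [hny, norm_smul, norm_inv, norm_norm]
    exact inv_mul_cancel₀ (norm_ne_zero_iff.2 hgne)
  -- the hitting point and its derivative
  set z : R3 × R3 → R3 := fun q => q.1 + ψ q • q.2 with hz
  have hz0 : z (y, v₀) = y := by simp [hz, hψ0]
  set z' : R3 × R3 →L[ℝ] R3 := ContinuousLinearMap.fst ℝ R3 R3 + ψ'.smulRight v₀ with hz'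
  have hzd : HasFDerivAt z z' (y, v₀) := by
    have h1 := (hasFDerivAt_fst (𝕜 := ℝ) (p := (y, v₀))).add
      (hψ.smul (hasFDerivAt_snd (𝕜 := ℝ) (p := (y, v₀))))
    refine h1.congr_fderiv ?_
    ext d <;> simp [hz', hψ0]
  have hψ'eq : ∀ d, ψ' d = -(inner ℝ (g y) d.1 / inner ℝ (g y) v₀) := by
    intro d
    have h1 : HasFDerivAt (fun q => φ (z q)) ((innerSL ℝ (g y)).comp z') (y, v₀) := by
      have := hc.hasFDerivAt y hyU
      rw [← hz0] at this
      have h2 := this.comp (y, v₀) hzd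
      rw [hz0] at h2
      exact h2
    have h2 : HasFDerivAt (fun q => φ (z q)) (0 : R3 × R3 →L[ℝ] ℝ) (y, v₀) :=
      (hasFDerivAt_const (0 : ℝ) _).congr_of_eventuallyEq hψφ
    have h3 := congrArg (fun L : R3 × R3 →L[ℝ] ℝ => L d) (h1.unique h2)
    simp [hz'] at h3
    field_simp
    linarith
  -- the reflected velocity and its derivative
  set N' : R3 × R3 →L[ℝ] R3 := (fderiv ℝ n y).comp z' with hN'
  have hNd : HasFDerivAt (fun q => n (z q)) N' (y, v₀) := by
    have h1 : HasFDerivAt n (fderiv ℝ n y) (z (y, v₀)) := by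
      rw [hz0]; exact (hn.differentiable one_ne_zero y).hasFDerivAt
    exact h1.comp (y, v₀) hzd
  have hid : HasFDerivAt (fun q : R3 × R3 => q.2) (ContinuousLinearMap.snd ℝ R3 R3) (y, v₀) :=
    hasFDerivAt_snd
  have hin := (hid.inner ℝ hNd).const_mul (2 : ℝ)
  have hwd := hid.sub (hin.smul hNd)
  have htot := (hzd.sub (hψ.smul hwd)).prodMk hwd
  refine ⟨_, htot.congr_of_eventuallyEq (Eventually.of_forall fun q => rfl), ?_⟩
  set D := (z' - (ψ (y, v₀) • (_ : R3 × R3 →L[ℝ] R3) + ψ'.smulRight _)).prod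
    (_ : R3 × R3 →L[ℝ] R3) with hD
  set R : R3 → R3 := fun v => v - (2 * inner ℝ v (n y)) • n y with hR
  set Z : R3 → R3 := fun a => a - (inner ℝ (g y) a / inner ℝ (g y) v₀) • v₀ with hZ
  set K : R3 → R3 := fun a => -((2 * inner ℝ v₀ (fderiv ℝ n y (Z a))) • n y) -
    (2 * inner ℝ v₀ (n y)) • fderiv ℝ n y (Z a) with hK
  have hZ' : ∀ d, z' d = Z d.1 := fun d => by
    simp [hz', hZ, hψ'eq, sub_eq_add_neg]
  have hg : g y = ‖g y‖ • n y := by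
    rw [hny, smul_smul, mul_inv_cancel₀ (norm_ne_zero_iff.2 hgne), one_smul]
  have hDeq : ∀ d, D d = (R d.1, R d.2 + K d.1) := by
    intro d
    have hratio : inner ℝ (g y) d.1 / inner ℝ (g y) v₀ * (2 * inner ℝ v₀ (n y)) =
        2 * inner ℝ d.1 (n y) := by
      have hv' := hv
      rw [hg, inner_smul_left] at hv' ⊢
      rw [inner_smul_left, real_inner_comm d.1, real_inner_comm v₀]
      simp only [conj_trivial] at hv' ⊢
      have h1 := left_ne_zero_of_mul hv'
      have h2 := right_ne_zero_of_mul hv'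
      rw [real_inner_comm] at h2
      field_simp
    refine Prod.ext ?_ ?_
    · have h1 : (D d).1 = z' d - ψ' d • (v₀ - (2 * inner ℝ v₀ (n y)) • n y) := by
        simp [hD, hψ0, hz0]
      rw [h1, hZ', hψ'eq]
      change _ = d.1 - (2 * inner ℝ d.1 (n y)) • n y
      rw [← hratio]
      simp only [hZ]
      module
    · simp only [hD, ContinuousLinearMap.prod_apply, _root_.sub_apply,
        _root_.add_apply, _root_.smul_apply,
        ContinuousLinearMap.smulRight_apply, hN', ContinuousLinearMap.comp_apply, hZ',
        fderivInnerCLM_apply, hz0, ContinuousLinearMap.coe_snd', hR, hK]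
      simp only [smul_eq_mul, mul_add, add_smul]
      abel
  have hDf : ⇑D = fun d => (R d.1, R d.2 + K d.1) := funext hDeq
  have hRm : MeasurePreserving R volume volume := measurePreserving_reflect hn1
  have hRR : ∀ v, R (R v) = v := fun v => specular_specular (n := n) (y := y) hn1
  have hRc : Continuous R := by simp only [hR]; fun_prop
  have hKc : Continuous K := by simp only [hK, hZ]; fun_prop
  constructor
  · rw [hDf]
    exact hRm.skew_product (g := fun a c => R c + K a)
      (by unfold Function.uncurry; fun_prop)
      (ae_of_all _ fun a => ((measurePreserving_add_right volume (K a)).comp hRm).map_eq)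
  · intro d
    refine ⟨(R d.1, R (d.2 - K (R d.1))), ?_⟩
    rw [hDeq]
    simp [hRR]

end

section

variable {Ω : Set R3} {n : R3 → R3}

/-! ### One step preserves the volume -/

/-- Near a point with one transversal collision the trajectory map is a composition of free flight,
reflection of the line at the boundary, and free flight. -/
lemma IsCollisionStep.exists_hasFDerivWithinAt (hΩ : IsRegularDomain Ω n) {h : ℝ} {p : R3 × R3}
    {T : ℝ} {y w : R3} (hs : IsCollisionStep Ω n h p T y w) :
    ∃ D : R3 × R3 →L[ℝ] R3 × R3, |D.det| = 1 ∧
      HasFDerivWithinAt (trajectory Ω n h) D (stepSet Ω n h) p := by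
  obtain ⟨U, φ, g, hyU, hc⟩ := hΩ.exists_chart hs.mem_frontier
  have hφ0 := (hc.mem_frontier_iff _ hyU).1 hs.mem_frontier
  have hgv : inner ℝ (g y) p.2 ≠ 0 := by
    intro h0
    have := hs.transversal
    rw [hc.normal_eq _ hyU hφ0, inner_smul_right, real_inner_comm, h0, mul_zero] at this
    exact lt_irrefl _ this
  obtain ⟨ψ, ψ', hψ0, hψ, hψφ, hψu⟩ := exists_local_hitTime hc hyU hφ0 hgv
  obtain ⟨D, hD, hDm, hDs⟩ :=
    hasFDerivAt_reflectLine hΩ.contDiff_normal hc hyU hφ0 hgv hψ0 hψ hψφ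
  have hT := hs.pos
  have hTh := hs.lt
  -- shift the starting point to the boundary by free flight
  have hA : freeFlight T p = (y, p.2) := by rw [hs.position]; rfl
  have hAt : Tendsto (freeFlight T) (𝓝 p) (𝓝 (y, p.2)) := by
    rw [← hA]; exact (continuous_freeFlight T).continuousAt
  have hψt : Tendsto (fun q => ψ (freeFlight T q)) (𝓝 p) (𝓝 0) := by
    have := hψ.continuousAt.tendsto.comp hAt
    rwa [hψ0] at this
  have hpos : ∀ q : R3 × R3, ∀ s : ℝ, (freeFlight T q).1 + s • (freeFlight T q).2 =
      q.1 + (T + s) • q.2 := fun q s => by simp [freeFlight, add_smul, add_assoc]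
  -- the first hitting time is close to `T` near `p`
  have hupper : ∀ᶠ q in 𝓝 p, hitTime Ω q ≤ ENNReal.ofReal (T + ψ (freeFlight T q)) := by
    have h1 := hAt.eventually hψφ
    have h2 : ∀ᶠ q in 𝓝 p, 0 < T + ψ (freeFlight T q) := by
      have : Tendsto (fun q => T + ψ (freeFlight T q)) (𝓝 p) (𝓝 (T + 0)) := hψt.const_add T
      exact this.eventually (lt_mem_nhds (by linarith))
    have h3 : ∀ᶠ q in 𝓝 p, (freeFlight T q).1 + ψ (freeFlight T q) • (freeFlight T q).2 ∈ U := by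
      have : Tendsto (fun q => (freeFlight T q).1 + ψ (freeFlight T q) • (freeFlight T q).2)
          (𝓝 p) (𝓝 (y + (0 : ℝ) • p.2)) :=
        ((continuous_fst.tendsto (y, p.2)).comp hAt).add
          (hψt.smul ((continuous_snd.tendsto (y, p.2)).comp hAt))
      exact this.eventually (hc.isOpen.mem_nhds (by simpa using hyU))
    filter_upwards [h1, h2, h3] with q h1 h2 h3
    refine hitTime_le h2 ?_
    rw [← hpos]
    exact (hc.mem_frontier_iff _ h3).2 h1
  have htend : Tendsto (fun q => (hitTime Ω q).toReal) (𝓝 p) (𝓝 T) := by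
    refine tendsto_order.2 ⟨fun a ha => ?_, fun a ha => ?_⟩
    · have hm : max a 0 < T := max_lt ha hT
      have := eventually_lt_hitTime hΩ.isOpen hs.mem (le_max_right a 0) (by
        rw [hs.hitTime_eq]; exact (ENNReal.ofReal_lt_ofReal_iff hT).2 hm)
      filter_upwards [this, hupper] with q hq hq2
      have hne := ne_top_of_le_ne_top ENNReal.ofReal_ne_top hq2
      have := (ENNReal.ofReal_lt_iff_lt_toReal (le_max_right a 0) hne).1 hq.2
      exact (le_max_left a 0).trans_lt this
    · have : Tendsto (fun q => T + ψ (freeFlight T q)) (𝓝 p) (𝓝 (T + 0)) := hψt.const_add T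
      rw [add_zero] at this
      filter_upwards [hupper, this.eventually (gt_mem_nhds ha),
        this.eventually (lt_mem_nhds hT)] with q h1 h2 h3
      exact (ENNReal.toReal_le_of_le_ofReal h3.le h1).trans_lt h2
  have hψeq : ∀ᶠ q in 𝓝 p, ψ (freeFlight T q) = (hitTime Ω q).toReal - T := by
    have h1 : Tendsto (fun q => (freeFlight T q, (hitTime Ω q).toReal - T)) (𝓝 p)
        (𝓝 ((y, p.2), (0 : ℝ))) := by
      refine hAt.prodMk_nhds ?_
      have := htend.sub_const T
      rwa [sub_self] at this
    have h2 : ∀ᶠ q in 𝓝 p, q.1 + (hitTime Ω q).toReal • q.2 ∈ U := by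
      have : Tendsto (fun q : R3 × R3 => q.1 + (hitTime Ω q).toReal • q.2) (𝓝 p)
          (𝓝 (p.1 + T • p.2)) :=
        (continuous_fst.tendsto p).add (htend.smul (continuous_snd.tendsto p))
      exact this.eventually (hc.isOpen.mem_nhds (by rw [← hs.position]; exact hyU))
    have h3 : ∀ᶠ q in 𝓝 p, q.1 ∈ Ω :=
      continuous_fst.continuousAt.eventually (hΩ.isOpen.mem_nhds hs.mem)
    filter_upwards [h1.eventually hψu, h2, h3, hupper] with q h1 h2 h3 h4
    refine h1 ?_
    rw [hpos, add_sub_cancel]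
    exact (hc.mem_frontier_iff _ h2).1 (collide_mem_frontier (n := n) (hitTime_pos hΩ.isOpen h3)
      (ne_top_of_le_ne_top ENNReal.ofReal_ne_top h4))
  refine ⟨(freeFlightL (h - T)).comp (D.comp (freeFlightL T)), ?_, ?_⟩
  · refine abs_det_eq_one_of_measurePreserving ?_ ?_
    · rw [ContinuousLinearMap.coe_comp, ContinuousLinearMap.coe_comp, coe_freeFlightL,
        coe_freeFlightL]
      exact (measurePreserving_freeFlight _).comp (hDm.comp (measurePreserving_freeFlight _))
    · rw [ContinuousLinearMap.coe_comp, ContinuousLinearMap.coe_comp, coe_freeFlightL,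
        coe_freeFlightL]
      exact (surjective_freeFlight _).comp (hDs.comp (surjective_freeFlight _))
  · have hcomp : HasFDerivAt (fun q => freeFlight (h - T) (reflectLine n ψ (freeFlight T q)))
        ((freeFlightL (h - T)).comp (D.comp (freeFlightL T))) p := by
      rw [← hA] at hD
      exact (hasFDerivAt_freeFlight (h - T) _).comp p (hD.comp p (hasFDerivAt_freeFlight T p))
    have hlt : ∀ᶠ q in 𝓝 p, (hitTime Ω q).toReal < h := htend.eventually (gt_mem_nhds hTh)
    have heq : ∀ᶠ q in 𝓝[stepSet Ω n h] p,
        trajectory Ω n h q = freeFlight (h - T) (reflectLine n ψ (freeFlight T q)) := by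
      filter_upwards [nhdsWithin_le_nhds hψeq, nhdsWithin_le_nhds hlt,
        nhdsWithin_le_nhds hupper, self_mem_nhdsWithin] with q h1 h2 h4 h3
      rcases mem_stepSet_cases hΩ h3 with ⟨-, h5⟩ | ⟨T', y', w', hs'⟩
      · exfalso
        have hne := ne_top_of_le_ne_top ENNReal.ofReal_ne_top h4
        rw [← ENNReal.ofReal_toReal hne] at h5
        exact absurd h5 (not_lt.2 (ENNReal.ofReal_le_ofReal h2.le))
      · have hT' : (hitTime Ω q).toReal = T' := by
          rw [hs'.hitTime_eq, ENNReal.toReal_ofReal hs'.pos.le]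
        rw [hT'] at h1
        have hz : (freeFlight T q).1 + ψ (freeFlight T q) • (freeFlight T q).2 = y' := by
          rw [hpos, h1, hs'.position]; congr 2; ring
        have hw : specular n y' q.2 = w' := hs'.velocity.symm
        rw [hs'.trajectory_eq, reflectLine, hz, h1]
        change _ = (y' - (T' - T) • specular n y' q.2 + (h - T) • specular n y' q.2,
          specular n y' q.2)
        rw [hw]
        congr 1
        rw [sub_smul T', sub_smul h, sub_smul h]; abel
    exact hcomp.hasFDerivWithinAt.congr_of_eventuallyEq heq
      (heq.self_of_nhdsWithin hs.mem_stepSet)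

lemma exists_hasFDerivWithinAt_trajectory (hΩ : IsRegularDomain Ω n) {h : ℝ} (hh : 0 ≤ h)
    {p : R3 × R3} (hp : p ∈ stepSet Ω n h) :
    ∃ D : R3 × R3 →L[ℝ] R3 × R3, |D.det| = 1 ∧
      HasFDerivWithinAt (trajectory Ω n h) D (stepSet Ω n h) p := by
  rcases mem_stepSet_cases hΩ hp with ⟨h0, h1⟩ | ⟨T, y, w, hs⟩
  · refine ⟨freeFlightL h, ?_, ?_⟩
    · refine abs_det_eq_one_of_measurePreserving ?_ ?_ <;> rw [coe_freeFlightL]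
      · exact measurePreserving_freeFlight h
      · exact surjective_freeFlight h
    · refine ((hasFDerivAt_freeFlight h p).congr_of_eventuallyEq ?_).hasFDerivWithinAt
      filter_upwards [eventually_lt_hitTime hΩ.isOpen h0 hh h1] with q hq
      exact trajectory_of_lt_hitTime hq.2
  · exact hs.exists_hasFDerivWithinAt hΩ

/-- One step of the dynamics does not increase the volume of preimages. -/
lemma volume_stepSet_inter_preimage_le (hΩ : IsRegularDomain Ω n) {h : ℝ} (hh : 0 ≤ h)
    {A : Set (R3 × R3)} (hA : MeasurableSet A) :
    volume (stepSet Ω n h ∩ trajectory Ω n h ⁻¹' A) ≤ volume A := by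
  have hex := fun p (hp : p ∈ stepSet Ω n h) => exists_hasFDerivWithinAt_trajectory hΩ hh hp
  choose! D hD1 hD2 using hex
  have hm := measurableSet_stepSet hΩ h
  have hT := measurable_trajectory (Ω := Ω) hΩ.contDiff_normal.continuous h
  have key := lintegral_image_eq_lintegral_abs_det_fderiv_mul volume hm hD2
    (injOn_trajectory_stepSet hΩ hh) (A.indicator 1)
  have h1 : ∫⁻ p in stepSet Ω n h,
      ENNReal.ofReal |(D p).det| * A.indicator 1 (trajectory Ω n h p) =
      volume (stepSet Ω n h ∩ trajectory Ω n h ⁻¹' A) := by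
    rw [inter_comm, ← Measure.restrict_apply (hT hA), ← lintegral_indicator_one (hT hA)]
    refine setLIntegral_congr_fun hm fun p hp => ?_
    rw [hD1 p hp, ENNReal.ofReal_one, one_mul]
    rfl
  rw [← h1, ← key]
  refine (setLIntegral_le_lintegral _ _).trans ?_
  rw [lintegral_indicator_one hA]

end

section

variable {Ω : Set R3} {n : R3 → R3}

/-! ### Nearly grazing trajectories -/

/-- If `A` is disjoint from its translates by `(s e, r e)` with `s ≥ a`, and by `(0, r e)` with
`r ≥ b`, then about `1 / (a b)` disjoint translates of `A` fit into a bounded set `B`. -/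
lemma volume_le_of_disjoint_translates {A B : Set (R3 × R3)} (hA : MeasurableSet A) {a b : ℝ}
    {e : R3} (ha : 0 < a) (ha1 : a ≤ 1) (hb : 0 < b) (hb1 : b ≤ 1)
    (hAB : ∀ p ∈ A, ∀ s r : ℝ, 0 ≤ s → s ≤ 1 → 0 ≤ r → r ≤ 1 → p + (s • e, r • e) ∈ B)
    (hx : ∀ p ∈ A, ∀ s r : ℝ, a ≤ s → p + (s • e, r • e) ∉ A)
    (hv : ∀ p ∈ A, ∀ r : ℝ, b ≤ r → p + (0, r • e) ∉ A) :
    volume A ≤ ENNReal.ofReal (4 * a * b) * volume B := by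
  have hfl : ∀ c : ℝ, 0 < c → c ≤ 1 → 1 ≤ 2 * c * (⌊1 / c⌋₊ : ℝ) ∧
      ∀ i : ℕ, i < ⌊1 / c⌋₊ → i * c ≤ 1 := by
    intro c hc hc1
    have h1 : 1 ≤ 1 / c := by rw [le_div_iff₀ hc]; linarith
    have h2 : 1 ≤ ⌊1 / c⌋₊ := Nat.one_le_floor_iff _ |>.2 h1
    have h3 := Nat.lt_floor_add_one (1 / c)
    have h4 : (1 : ℝ) ≤ ⌊1 / c⌋₊ := by exact_mod_cast h2
    refine ⟨?_, fun i hi => ?_⟩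
    · rw [div_lt_iff₀ hc] at h3; nlinarith
    · have h5 : (i : ℝ) ≤ 1 / c :=
        (Nat.cast_le.2 hi.le).trans (Nat.floor_le (by positivity))
      rwa [le_div_iff₀ hc] at h5
  obtain ⟨hI, hI'⟩ := hfl a ha ha1
  obtain ⟨hJ, hJ'⟩ := hfl b hb hb1
  set I := ⌊1 / a⌋₊
  set J := ⌊1 / b⌋₊
  set τ : ℕ × ℕ → R3 × R3 := fun k => ((k.1 * a) • e, (k.2 * b) • e) with hτ
  set S : ℕ × ℕ → Set (R3 × R3) := fun k => (fun p => p + -τ k) ⁻¹' A with hS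
  have hSm : ∀ k, MeasurableSet (S k) := fun k => hA.preimage (measurable_add_const _)
  have hSv : ∀ k, volume (S k) = volume A := fun k => measure_preimage_add_right _ _ _
  have hdiff : ∀ (k l : ℕ × ℕ) (p : R3 × R3), p ∈ S k → p ∈ S l →
      (p + -τ k) + ((k.1 * a - l.1 * a) • e, (k.2 * b - l.2 * b) • e) ∈ A := by
    intro k l p hk hl
    have : (p + -τ k) + ((k.1 * a - l.1 * a) • e, (k.2 * b - l.2 * b) • e) = p + -τ l := by
      ext1 <;> simp [hτ, sub_smul] <;> abel
    rw [this]; exact hl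
  have hstep : ∀ {i j : ℕ} {c : ℝ}, 0 < c → i < j → c ≤ j * c - i * c := by
    intro i j c hc hij
    have : (i : ℝ) + 1 ≤ j := by exact_mod_cast hij
    nlinarith
  have hlt : ∀ (k l : ℕ × ℕ), l.1 < k.1 ∨ (l.1 = k.1 ∧ l.2 < k.2) → Disjoint (S k) (S l) := by
    intro k l hkl
    rw [Set.disjoint_left]
    intro p hk hl
    have h1 := hdiff k l p hk hl
    rcases hkl with h | ⟨h, h'⟩
    · exact hx _ hk _ _ (hstep ha h) h1
    · rw [h, sub_self, zero_smul] at h1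
      exact hv _ hk _ (hstep hb h') h1
  have hdisj : ((Finset.range I ×ˢ Finset.range J : Finset (ℕ × ℕ)) : Set (ℕ × ℕ)).PairwiseDisjoint
      S := by
    intro k _ l _ hkl
    rcases lt_trichotomy l.1 k.1 with h | h | h
    · exact hlt k l (Or.inl h)
    · rcases lt_trichotomy l.2 k.2 with h' | h' | h'
      · exact hlt k l (Or.inr ⟨h, h'⟩)
      · exact absurd (Prod.ext h.symm h'.symm) hkl
      · exact (hlt l k (Or.inr ⟨h.symm, h'⟩)).symm
    · exact (hlt l k (Or.inl h)).symm
  have hsum := measure_biUnion_finset (μ := volume) hdisj fun k _ => hSm k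
  have hsub : (⋃ k ∈ (Finset.range I ×ˢ Finset.range J : Finset (ℕ × ℕ)), S k) ⊆ B := by
    refine iUnion₂_subset fun k hk p hp => ?_
    rw [Finset.mem_product, Finset.mem_range, Finset.mem_range] at hk
    have := hAB _ hp (k.1 * a) (k.2 * b) (by positivity) (hI' _ hk.1) (by positivity) (hJ' _ hk.2)
    have hk' : p + -τ k + τ k ∈ B := this
    rwa [neg_add_cancel_right] at hk'
  have hcard : (I * J : ℕ) * volume A ≤ volume B := by
    refine le_trans (le_of_eq ?_) (measure_mono hsub)
    rw [hsum, Finset.sum_congr rfl fun k _ => hSv k, Finset.sum_const, Finset.card_product,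
      Finset.card_range, Finset.card_range, nsmul_eq_mul]
  have hone : (1 : ℝ≥0∞) ≤ ENNReal.ofReal (4 * a * b) * (I * J : ℕ) := by
    rw [← ENNReal.ofReal_natCast, ← ENNReal.ofReal_mul (by positivity), ENNReal.one_le_ofReal]
    push_cast
    calc (1 : ℝ) = 1 * 1 := by ring
      _ ≤ (2 * a * I) * (2 * b * J) := mul_le_mul hI hJ zero_le_one (by positivity)
      _ = _ := by ring
  calc volume A = 1 * volume A := (one_mul _).symm
    _ ≤ ENNReal.ofReal (4 * a * b) * (I * J : ℕ) * volume A := by gcongr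
    _ = ENNReal.ofReal (4 * a * b) * ((I * J : ℕ) * volume A) := mul_assoc _ _ _
    _ ≤ _ := by gcongr

/-- In a boundary chart, the phase points at a distance of order `δ` from the boundary whose
velocity is tangential up to `ε` form a set of volume of order `δ ε`. -/
lemma IsBoundaryChart.exists_volume_slab_le {U : Set R3} {φ : R3 → ℝ} {g : R3 → R3}
    (hc : IsBoundaryChart Ω n U φ g) {y₀ : R3} (hy₀ : y₀ ∈ U) (R : ℝ) :
    ∃ r G c C : ℝ, 0 < r ∧ 0 < G ∧ 0 < c ∧ 0 ≤ C ∧ Metric.closedBall y₀ r ⊆ U ∧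
      (∀ z ∈ Metric.closedBall y₀ r, ‖g z‖ ≤ G) ∧
      ∀ δ ε : ℝ, 0 < δ → δ ≤ c → 0 < ε → ε ≤ c →
        volume {p : R3 × R3 | p.1 ∈ Metric.closedBall y₀ r ∧ ‖p.2‖ ≤ R ∧ |φ p.1| ≤ δ ∧
          |inner ℝ (g p.1) p.2| ≤ ε} ≤ ENNReal.ofReal (C * δ * ε) := by
  have hg0 : 0 < ‖g y₀‖ := norm_pos_iff.2 (hc.ne_zero y₀ hy₀)
  set e : R3 := ‖g y₀‖⁻¹ • g y₀ with he
  have hgc : ContinuousAt g y₀ := hc.continuousOn.continuousAt (hc.isOpen.mem_nhds hy₀)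
  have hge : inner ℝ (g y₀) e = ‖g y₀‖ := by
    rw [he, inner_smul_right, real_inner_self_eq_norm_sq]; field_simp
  have he1 : ‖e‖ = 1 := by rw [he, norm_smul, norm_inv, norm_norm]; exact inv_mul_cancel₀ hg0.ne'
  have hev : ∀ᶠ z in 𝓝 y₀, z ∈ U ∧ ‖g z‖ < 2 * ‖g y₀‖ ∧ ‖g y₀‖ / 2 < inner ℝ (g z) e := by
    have hU : ∀ᶠ z in 𝓝 y₀, z ∈ U := hc.isOpen.mem_nhds hy₀
    refine hU.and (Filter.Eventually.and ?_ ?_)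
    · exact hgc.norm.eventually (gt_mem_nhds (by linarith))
    · have : ContinuousAt (fun z => inner ℝ (g z) e) y₀ := hgc.inner continuousAt_const
      exact this.eventually (lt_mem_nhds (by
        change ‖g y₀‖ / 2 < inner ℝ (g y₀) e
        rw [hge]; linarith))
  obtain ⟨r, hr, hball⟩ := Metric.nhds_basis_closedBall.eventually_iff.1 hev
  set c := ‖g y₀‖ / 2 with hcdef
  have hcpos : 0 < c := by positivity
  set V := (volume (Metric.closedBall y₀ (r + 1) ×ˢ Metric.closedBall (0 : R3) (R + 1))) with hV
  have hVtop : V ≠ ⊤ :=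
    ((Metric.isBounded_closedBall.prod Metric.isBounded_closedBall).measure_lt_top).ne
  have hUsub : Metric.closedBall y₀ r ⊆ U := fun z hz => (hball hz).1
  refine ⟨r, 2 * ‖g y₀‖, c / 3, 36 / c ^ 2 * V.toReal, hr, by positivity, by positivity,
    by positivity, hUsub, fun z hz => (hball hz).2.1.le, ?_⟩
  intro δ ε hδ hδc hε hεc
  have hφc : ContinuousOn φ (Metric.closedBall y₀ r) := fun z hz =>
    (hc.contDiffAt z (hUsub hz)).continuousAt.continuousWithinAt
  set A := {p : R3 × R3 | p.1 ∈ Metric.closedBall y₀ r ∧ ‖p.2‖ ≤ R ∧ |φ p.1| ≤ δ ∧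
          |inner ℝ (g p.1) p.2| ≤ ε} with hA
  have hAm : MeasurableSet A := by
    have h0 : IsClosed (Metric.closedBall y₀ r ×ˢ Metric.closedBall (0 : R3) R) :=
      Metric.isClosed_closedBall.prod Metric.isClosed_closedBall
    have h1 : ContinuousOn (fun p : R3 × R3 => (|φ p.1|, |inner ℝ (g p.1) p.2|))
        (Metric.closedBall y₀ r ×ˢ Metric.closedBall (0 : R3) R) := by
      have hm : MapsTo Prod.fst (Metric.closedBall y₀ r ×ˢ Metric.closedBall (0 : R3) R)
          (Metric.closedBall y₀ r) := fun p hp => hp.1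
      refine ContinuousOn.prodMk ?_ ?_
      · exact (hφc.comp continuousOn_fst hm).abs
      · exact (((hc.continuousOn.mono hUsub).comp continuousOn_fst hm).inner continuousOn_snd).abs
    have h2 := h1.preimage_isClosed_of_isClosed h0 (isClosed_Iic.prod isClosed_Iic :
      IsClosed (Iic δ ×ˢ Iic ε))
    convert! h2.measurableSet using 1
    ext p
    simp [hA, and_assoc]
  have key := volume_le_of_disjoint_translates (A := A)
    (B := Metric.closedBall y₀ (r + 1) ×ˢ Metric.closedBall (0 : R3) (R + 1))
    (a := 3 * δ / c) (b := 3 * ε / c) (e := e) hAm (by positivity)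
    (by rw [div_le_one hcpos]; linarith) (by positivity) (by rw [div_le_one hcpos]; linarith)
    ?_ ?_ ?_
  · refine key.trans (le_of_eq ?_)
    have : 36 / c ^ 2 * V.toReal * δ * ε = 4 * (3 * δ / c) * (3 * ε / c) * V.toReal := by
      field_simp; ring
    rw [this, ENNReal.ofReal_mul (q := V.toReal) (by positivity), ENNReal.ofReal_toReal hVtop]
  · rintro p ⟨h1, h2, -, -⟩ s t hs0 hs1 ht0 ht1
    constructor
    · change p.1 + s • e ∈ _
      rw [Metric.mem_closedBall, dist_eq_norm] at h1 ⊢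
      calc ‖p.1 + s • e - y₀‖ = ‖(p.1 - y₀) + s • e‖ := by congr 1; abel
        _ ≤ ‖p.1 - y₀‖ + ‖s • e‖ := norm_add_le _ _
        _ ≤ r + 1 := by rw [norm_smul, he1, Real.norm_of_nonneg hs0]; linarith
    · change p.2 + t • e ∈ _
      rw [mem_closedBall_zero_iff]
      calc ‖p.2 + t • e‖ ≤ ‖p.2‖ + ‖t • e‖ := norm_add_le _ _
        _ ≤ R + 1 := by rw [norm_smul, he1, Real.norm_of_nonneg ht0]; linarith
  · rintro p ⟨h1, -, h3, -⟩ s t hs ⟨h5, -, h7, -⟩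
    change p.1 + s • e ∈ _ at h5
    change |φ (p.1 + s • e)| ≤ δ at h7
    have hspos : 0 < s := lt_of_lt_of_le (by positivity) hs
    have hseg : ∀ u ∈ Icc 0 s, p.1 + u • e ∈ Metric.closedBall y₀ r := by
      intro u hu
      have hconv := (convex_closedBall y₀ r).add_smul_mem h1 h5 (t := u / s)
        ⟨div_nonneg hu.1 hspos.le, (div_le_one hspos).2 hu.2⟩
      rwa [smul_smul, div_mul_cancel₀ _ hspos.ne'] at hconv
    have hder : ∀ u ∈ Icc 0 s, HasDerivAt (fun u : ℝ => φ (p.1 + u • e))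
        (inner ℝ (g (p.1 + u • e)) e) u := fun u hu => hc.hasDerivAt (hUsub (hseg u hu))
    obtain ⟨u, hu, hslope⟩ := exists_hasDerivAt_eq_slope (fun u : ℝ => φ (p.1 + u • e)) _ hspos
      (fun u hu => (hder u hu).continuousAt.continuousWithinAt)
      (fun u hu => hder u (Ioo_subset_Icc_self hu))
    have hcl := (hball (hseg u (Ioo_subset_Icc_self hu))).2.2
    rw [hslope, lt_div_iff₀ (by linarith)] at hcl
    simp only [sub_zero, zero_smul, add_zero] at hcl
    rw [div_le_iff₀ hcpos] at hs
    have := abs_le.1 h3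
    have := abs_le.1 h7
    nlinarith
  · rintro p ⟨h1, -, -, h4⟩ t ht ⟨-, -, -, h8⟩
    change |inner ℝ (g (p.1 + 0)) (p.2 + t • e)| ≤ ε at h8
    rw [add_zero, inner_add_right, inner_smul_right] at h8
    have hcl := (hball h1).2.2
    have htpos : 0 < t := lt_of_lt_of_le (by positivity) ht
    rw [div_le_iff₀ hcpos] at ht
    have := abs_le.1 h4
    have := abs_le.1 h8
    nlinarith

/-- In a boundary chart with `‖g‖ ≤ G` and oscillation of `g` at most `κ` on small balls, a first
step which is not admissible starts close to the boundary, with an almost tangential velocity. -/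
lemma IsBoundaryChart.near_grazing (hΩ : IsRegularDomain Ω n) {U : Set R3} {φ : R3 → ℝ}
    {g : R3 → R3} (hc : IsBoundaryChart Ω n U φ g) {y₀ : R3} {r G R κ h : ℝ}
    (hG : ∀ z ∈ Metric.closedBall y₀ r, ‖g z‖ ≤ G) (hrU : Metric.closedBall y₀ r ⊆ U)
    (hR : 0 ≤ R) (hh : 0 < h) (hhr : h * R ≤ r / 2)
    (hκ : ∀ z ∈ Metric.closedBall y₀ r, ∀ z' ∈ Metric.closedBall y₀ r,
      ‖z - z'‖ ≤ h * R → ‖g z - g z'‖ ≤ κ)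
    {p : R3 × R3} (hp : p.1 ∈ Ω) (hpR : ‖p.2‖ ≤ R)
    (hy : (collide Ω n p).1 ∈ Metric.closedBall y₀ (r / 2)) (hlt : hitTime Ω p < ENNReal.ofReal h)
    (hns : p ∉ stepSet Ω n h) :
    p.1 ∈ Metric.closedBall y₀ r ∧ |φ p.1| ≤ G * (h * R) ∧
      |inner ℝ (g p.1) p.2| ≤ 2 * (κ * R) := by
  have h0 := hitTime_pos hΩ.isOpen hp
  set T := (hitTime Ω p).toReal with hT
  have hTpos : 0 < T := ENNReal.toReal_pos h0.ne' hlt.ne_top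
  have hTe : ENNReal.ofReal T = hitTime Ω p := ENNReal.ofReal_toReal hlt.ne_top
  have hTh : T < h := by
    rw [← hTe] at hlt; exact (ENNReal.ofReal_lt_ofReal_iff hh).1 hlt
  set y := (collide Ω n p).1 with hydef
  have hyeq : y = p.1 + T • p.2 := rfl
  have hyfr : y ∈ frontier Ω := collide_mem_frontier h0 hlt.ne_top
  have hnonneg : 0 ≤ inner ℝ p.2 (n y) := inner_normal_nonneg hΩ hp hlt.ne_top
  rw [Metric.mem_closedBall, dist_eq_norm] at hy
  have hline : ∀ (u : R3) (s : ℝ), ‖u‖ ≤ R → |s| ≤ h →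
      y + s • u ∈ Metric.closedBall y₀ r ∧ ‖s • u‖ ≤ h * R := by
    intro u s hu hs
    have h1 : ‖s • u‖ ≤ h * R := by
      rw [norm_smul, Real.norm_eq_abs]; exact mul_le_mul hs hu (norm_nonneg _) hh.le
    refine ⟨?_, h1⟩
    rw [Metric.mem_closedBall, dist_eq_norm]
    calc ‖y + s • u - y₀‖ = ‖(y - y₀) + s • u‖ := by congr 1; abel
      _ ≤ ‖y - y₀‖ + ‖s • u‖ := norm_add_le _ _
      _ ≤ r := by linarith
  have hyball : y ∈ Metric.closedBall y₀ r := by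
    simpa using (hline 0 0 (by simpa) (by simpa using hh.le)).1
  have hyU := hrU hyball
  have hφy : φ y = 0 := (hc.mem_frontier_iff y hyU).1 hyfr
  have hxy : ∀ s, p.1 + s • p.2 = y + (s - T) • p.2 := fun s => by rw [hyeq, sub_smul]; abel
  have hx : p.1 ∈ Metric.closedBall y₀ r ∧ ‖(0 - T) • p.2‖ ≤ h * R := by
    have := hline p.2 (0 - T) hpR (by rw [zero_sub, abs_neg, abs_of_pos hTpos]; exact hTh.le)
    rwa [← hxy, zero_smul, add_zero] at this
  refine ⟨hx.1, ?_, ?_⟩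
  · -- mean value theorem between the starting point and the collision
    have hin : ∀ s ∈ Icc 0 T, p.1 + s • p.2 ∈ Metric.closedBall y₀ r := fun s hs => by
      rw [hxy]
      exact (hline p.2 _ hpR (by rw [abs_le]; constructor <;> linarith [hs.1, hs.2])).1
    obtain ⟨s, hs, hslope⟩ := exists_hasDerivAt_eq_slope (fun s : ℝ => φ (p.1 + s • p.2)) _ hTpos
      (fun s hs => (hc.hasDerivAt (hrU (hin s hs))).continuousAt.continuousWithinAt)
      (fun s hs => hc.hasDerivAt (hrU (hin s (Ioo_subset_Icc_self hs))))
    rw [← hyeq, hφy, zero_smul, add_zero, eq_div_iff (by linarith)] at hslope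
    have hb : |inner ℝ (g (p.1 + s • p.2)) p.2| ≤ G * R :=
      (abs_real_inner_le_norm _ _).trans (mul_le_mul (hG _ (hin s (Ioo_subset_Icc_self hs))) hpR
        (norm_nonneg _) ((norm_nonneg _).trans (hG _ hyball)))
    have : |φ p.1| = |inner ℝ (g (p.1 + s • p.2)) p.2| * T := by
      have h5 : -φ p.1 = inner ℝ (g (p.1 + s • p.2)) p.2 * T := by linarith
      rw [← abs_neg, h5, abs_mul, abs_of_pos hTpos]
    rw [this]
    have hGR : 0 ≤ G * R := (abs_nonneg _).trans hb
    nlinarith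
  · have hκnn : 0 ≤ κ := (norm_nonneg _).trans (hκ y hyball y hyball (by simp; positivity))
    have hgy : g y = ‖g y‖ • n y := by
      rw [hc.normal_eq y hyU hφy, smul_smul,
        mul_inv_cancel₀ (norm_ne_zero_iff.2 (hc.ne_zero y hyU)), one_smul]
    have hosc : ∀ z ∈ Metric.closedBall y₀ r, ∀ u : R3, ‖u‖ ≤ R → ‖z - y‖ ≤ h * R →
        |inner ℝ (g z) u - inner ℝ (g y) u| ≤ κ * R := by
      intro z hz u hu hzy
      rw [← inner_sub_left]
      exact (abs_real_inner_le_norm _ _).trans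
        (mul_le_mul (hκ z hz y hyball hzy) hu (norm_nonneg _) hκnn)
    have hxosc := hosc p.1 hx.1 p.2 hpR (by
      have h1 : p.1 - y = (0 - T) • p.2 := by rw [hyeq, zero_sub, neg_smul]; abel
      rw [h1]; exact hx.2)
    -- it remains to bound the normal component of the incoming velocity at the collision
    suffices hkey : |inner ℝ (g y) p.2| ≤ κ * R by
      have h1 := abs_le.1 hxosc
      have h2 := abs_le.1 hkey
      rw [abs_le]; constructor <;> linarith
    by_cases hgr : inner ℝ p.2 (n y) ≤ 0
    · have h1 : inner ℝ p.2 (n y) = 0 := le_antisymm hgr hnonneg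
      rw [hgy, inner_smul_left, real_inner_comm, h1, mul_zero, abs_zero]
      positivity
    · push Not at hgr
      have hsecond : hitTime Ω p + hitTime Ω (collide Ω n p) ≤ ENNReal.ofReal h := by
        by_contra! hcon
        exact hns ⟨hp, Or.inr ⟨hlt, hgr, hcon⟩⟩
      set w := (collide Ω n p).2 with hw
      have hweq : w = specular n y p.2 := rfl
      have hn1 := hΩ.norm_normal hyfr
      have hwR : ‖w‖ ≤ R := by rw [hweq, norm_specular hn1]; exact hpR
      have hlt2 : hitTime Ω (collide Ω n p) < ENNReal.ofReal h := by
        have hne : hitTime Ω (collide Ω n p) ≠ ⊤ := by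
          intro htop; rw [htop, add_top] at hsecond
          exact ENNReal.ofReal_ne_top (top_le_iff.1 hsecond)
        refine lt_of_lt_of_le ?_ hsecond
        rw [add_comm]
        exact ENNReal.lt_add_right hne h0.ne'
      obtain ⟨s, hs, hsf, hsh⟩ := hitTime_lt_iff.1 hlt2
      have hsh' : s < h := (ENNReal.ofReal_lt_ofReal_iff hh).1 hsh
      have hin : ∀ t ∈ Icc 0 s, y + t • w ∈ Metric.closedBall y₀ r ∧ ‖t • w‖ ≤ h * R :=
        fun t ht => hline w t hwR (by rw [abs_of_nonneg ht.1]; linarith [ht.2])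
      have hφs : φ (y + s • w) = 0 :=
        (hc.mem_frontier_iff _ (hrU (hin s ⟨hs.le, le_rfl⟩).1)).1 hsf
      obtain ⟨t, ht, hslope⟩ := exists_hasDerivAt_eq_zero (f := fun t : ℝ => φ (y + t • w)) hs
        (fun t ht => (hc.hasDerivAt (hrU (hin t ht).1)).continuousAt.continuousWithinAt)
        (by simp [hφs, hφy])
        (fun t ht => hc.hasDerivAt (hrU (hin t (Ioo_subset_Icc_self ht)).1))
      have htin := hin t (Ioo_subset_Icc_self ht)
      have h1 := hosc _ htin.1 w hwR (by rw [add_sub_cancel_left]; exact htin.2)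
      rw [hslope, zero_sub, abs_neg] at h1
      have h2 : inner ℝ (g y) w = -inner ℝ (g y) p.2 := by
        rw [hgy, inner_smul_left, inner_smul_left, real_inner_comm, hweq, inner_specular hn1,
          real_inner_comm (n y)]
        simp
      rwa [h2, abs_neg] at h1

end

section

variable {Ω : Set R3} {n : R3 → R3}

/-! ### Non-admissible steps have small volume -/

/-- Phase points of `Ω × ℝ³` of speed at most `R` whose first collision takes place before time `h`
and inside `S`, and which are not admissible for a step of length `h`. -/
def badSet (Ω : Set R3) (n : R3 → R3) (R h : ℝ) (S : Set R3) : Set (R3 × R3) :=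
  {p | p.1 ∈ Ω ∧ ‖p.2‖ ≤ R ∧ (collide Ω n p).1 ∈ S ∧ hitTime Ω p < ENNReal.ofReal h ∧
    p ∉ stepSet Ω n h}

/-- Locally near the boundary, non-admissible steps of length `h` have volume `o(h)`. -/
lemma exists_volume_badSet_closedBall_le (hΩ : IsRegularDomain Ω n) {y₀ : R3}
    (hy₀ : y₀ ∈ frontier Ω) {R : ℝ} (hR : 0 < R) :
    ∃ r > 0, ∀ η > 0, ∃ h₀ > 0, ∀ h : ℝ, 0 < h → h < h₀ →
      volume (badSet Ω n R h (Metric.closedBall y₀ r)) ≤ ENNReal.ofReal (η * h) := by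
  obtain ⟨U, φ, g, hyU, hc⟩ := hΩ.exists_chart hy₀
  obtain ⟨r, G, c, C, hr, hG, hcpos, hC, hrU, hgG, hvol⟩ := hc.exists_volume_slab_le hyU R
  refine ⟨r / 2, by positivity, fun η hη => ?_⟩
  -- `ε` is the admissible normal component, `κ` the corresponding oscillation of the gradient
  obtain ⟨ε, hε, hεc, hεη⟩ : ∃ ε > 0, ε ≤ c ∧ C * (G * R) * ε ≤ η := by
    refine ⟨min c (η / (C * (G * R) + 1)), by positivity, min_le_left _ _, ?_⟩
    calc C * (G * R) * min c (η / (C * (G * R) + 1))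
        ≤ C * (G * R) * (η / (C * (G * R) + 1)) := by gcongr; exact min_le_right _ _
      _ ≤ (C * (G * R) + 1) * (η / (C * (G * R) + 1)) :=
          mul_le_mul_of_nonneg_right (by linarith) (by positivity)
      _ = η := by field_simp
  set κ := ε / (2 * R) with hκ
  have huc : UniformContinuousOn g (Metric.closedBall y₀ r) :=
    (isCompact_closedBall y₀ r).uniformContinuousOn_of_continuous (hc.continuousOn.mono hrU)
  obtain ⟨δ, hδ, hδg⟩ := Metric.uniformContinuousOn_iff_le.1 huc κ (by positivity)
  refine ⟨min (δ / R) (min (r / 2 / R) (c / (G * R))), by positivity, fun h hh hlt => ?_⟩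
  rw [lt_min_iff, lt_min_iff] at hlt
  have h1 := (lt_div_iff₀ hR).1 hlt.1
  have h2 := (lt_div_iff₀ hR).1 hlt.2.1
  have h3 := (lt_div_iff₀ (by positivity)).1 hlt.2.2
  calc volume (badSet Ω n R h (Metric.closedBall y₀ (r / 2)))
      ≤ _ := measure_mono ?_
    _ ≤ ENNReal.ofReal (C * (G * (h * R)) * ε) :=
        hvol (G * (h * R)) ε (by positivity) (by nlinarith) hε hεc
    _ ≤ ENNReal.ofReal (η * h) := by
        refine ENNReal.ofReal_le_ofReal ?_
        calc C * (G * (h * R)) * ε = C * (G * R) * ε * h := by ring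
          _ ≤ η * h := by gcongr
  rintro p ⟨hp, hpR, hpy, hplt, hpn⟩
  obtain ⟨ha, hb, hd⟩ := hc.near_grazing hΩ (κ := κ) hgG hrU hR.le hh h2.le
    (fun z hz z' hz' hzz => by
      rw [← dist_eq_norm] at hzz ⊢
      exact hδg z hz z' hz' (hzz.trans h1.le)) hp hpR hpy hplt hpn
  refine ⟨ha, hpR, hb, hd.trans (le_of_eq ?_)⟩
  rw [hκ]; field_simp

lemma exists_volume_badSet_le (hΩ : IsRegularDomain Ω n) {R : ℝ} (hR : 0 < R) {K : Set R3}
    (hK : IsCompact K) (hKΩ : K ⊆ frontier Ω) :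
    ∀ η > 0, ∃ h₀ > 0, ∀ h : ℝ, 0 < h → h < h₀ →
      volume (badSet Ω n R h K) ≤ ENNReal.ofReal (η * h) := by
  refine hK.induction_on (p := fun K => ∀ η > 0, ∃ h₀ > 0, ∀ h : ℝ, 0 < h → h < h₀ →
      volume (badSet Ω n R h K) ≤ ENNReal.ofReal (η * h)) ?_ ?_ ?_ ?_
  · intro η hη
    refine ⟨1, one_pos, fun h _ _ => ?_⟩
    simp [badSet]
  · intro s t hst ht η hη
    obtain ⟨h₀, hh₀, H⟩ := ht η hη
    have hsub : ∀ h, badSet Ω n R h s ⊆ badSet Ω n R h t := fun h p hp =>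
      ⟨hp.1, hp.2.1, hst hp.2.2.1, hp.2.2.2⟩
    exact ⟨h₀, hh₀, fun h h1 h2 => (measure_mono (hsub h)).trans (H h h1 h2)⟩
  · intro s t hs ht η hη
    obtain ⟨h₁, hh₁, H₁⟩ := hs (η / 2) (by positivity)
    obtain ⟨h₂, hh₂, H₂⟩ := ht (η / 2) (by positivity)
    refine ⟨min h₁ h₂, by positivity, fun h h1 h2 => ?_⟩
    rw [lt_min_iff] at h2
    calc volume (badSet Ω n R h (s ∪ t))
        ≤ volume (badSet Ω n R h s ∪ badSet Ω n R h t) := measure_mono (by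
          rintro p ⟨a, b, c | c, d⟩
          · exact Or.inl ⟨a, b, c, d⟩
          · exact Or.inr ⟨a, b, c, d⟩)
      _ ≤ ENNReal.ofReal (η / 2 * h) + ENNReal.ofReal (η / 2 * h) :=
          (measure_union_le _ _).trans (add_le_add (H₁ h h1 h2.1) (H₂ h h1 h2.2))
      _ = ENNReal.ofReal (η * h) := by
          rw [← ENNReal.ofReal_add (by positivity) (by positivity)]; congr 1; ring
  · intro y hy
    obtain ⟨r, hr, H⟩ := exists_volume_badSet_closedBall_le hΩ (hKΩ hy) hR
    exact ⟨Metric.closedBall y r, nhdsWithin_le_nhds (Metric.closedBall_mem_nhds y hr), H⟩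

/-- The phase points whose first collision takes place exactly at time `h` form a null set: free
flight maps it into the level sets of the hitting time for smaller values, only countably many of
which can have positive measure. -/
lemma volume_hitTime_eq (hΩ : IsOpen Ω) {h : ℝ} (hh : 0 < h) :
    volume {p : R3 × R3 | p.1 ∈ Ω ∧ hitTime Ω p = ENNReal.ofReal h} = 0 := by
  have hm : MeasurableSet {p : R3 × R3 | p.1 ∈ Ω} := hΩ.measurableSet.preimage measurable_fst
  have hlev : ∀ c : ℝ≥0∞, MeasurableSet {p : R3 × R3 | hitTime Ω p = c} := fun c =>
    measurable_hitTime Ω (measurableSet_singleton c)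
  by_contra hne
  have hcount := Measure.countable_meas_level_set_pos
    (μ := (volume : Measure (R3 × R3)).restrict {p | p.1 ∈ Ω}) (measurable_hitTime Ω)
  have hsub : ENNReal.ofReal '' Ioc 0 h ⊆ {t : ℝ≥0∞ |
      0 < (volume : Measure (R3 × R3)).restrict {p | p.1 ∈ Ω} {p | hitTime Ω p = t}} := by
    rintro _ ⟨t, ht, rfl⟩
    rw [mem_ofPred_eq, Measure.restrict_apply (hlev _)]
    refine (pos_iff_ne_zero.2 hne).trans_le ?_
    have hpres := (measurePreserving_freeFlight (h - t)).measure_preimage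
      (((hlev (ENNReal.ofReal t)).inter hm).nullMeasurableSet)
    rw [← hpres]
    refine measure_mono ?_
    rintro p ⟨hp, hpt⟩
    have hlt : ENNReal.ofReal (h - t) < hitTime Ω p := by
      rw [hpt]; exact (ENNReal.ofReal_lt_ofReal_iff hh).2 (by linarith [ht.1])
    have h1 := hitTime_freeFlight (by linarith [ht.2]) hlt
    refine ⟨?_, mem_of_lt_hitTime' hΩ hp (by linarith [ht.2]) hlt⟩
    have h2 : ENNReal.ofReal (h - t) + ENNReal.ofReal t = hitTime Ω p := by
      rw [hpt, ← ENNReal.ofReal_add (by linarith [ht.2]) ht.1.le]; congr 1; ring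
    rw [← h2] at h1
    exact (ENNReal.add_right_inj ENNReal.ofReal_ne_top).1 h1
  have hc2 := hcount.mono hsub
  have hinj : InjOn ENNReal.ofReal (Ioc 0 h) := fun s hs t ht hst =>
    (ENNReal.ofReal_eq_ofReal_iff hs.1.le ht.1.le).1 hst
  have hc3 : (Ioc 0 h).Countable := countable_of_injective_of_countable_image hinj hc2
  rw [← Cardinal.le_aleph0_iff_set_countable, Cardinal.mk_Ioc_real hh] at hc3
  exact absurd hc3 (not_le.2 Cardinal.aleph0_lt_continuum)

/-- In a bounded region of phase space the non-admissible points for a step of length `h` have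
volume `o(h)`. -/
lemma exists_volume_diff_stepSet_le (hΩ : IsRegularDomain Ω n) {R : ℝ} (hR : 0 < R) :
    ∀ η > 0, ∃ h₀ > 0, ∀ h : ℝ, 0 < h → h < h₀ →
      volume {p : R3 × R3 | p.1 ∈ Ω ∧ ‖p.1‖ ≤ R ∧ ‖p.2‖ ≤ R ∧ p ∉ stepSet Ω n h} ≤
        ENNReal.ofReal (η * h) := by
  intro η hη
  obtain ⟨h₀, hh₀, H⟩ := exists_volume_badSet_le hΩ hR
    (K := frontier Ω ∩ Metric.closedBall 0 (2 * R))
    ((isCompact_closedBall _ _).inter_left isClosed_frontier) inter_subset_left η hη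
  refine ⟨min h₀ 1, by positivity, fun h h1 h2 => ?_⟩
  rw [lt_min_iff] at h2
  have hsub : {p : R3 × R3 | p.1 ∈ Ω ∧ ‖p.1‖ ≤ R ∧ ‖p.2‖ ≤ R ∧ p ∉ stepSet Ω n h} ⊆
      {p : R3 × R3 | p.1 ∈ Ω ∧ hitTime Ω p = ENNReal.ofReal h} ∪
        badSet Ω n R h (frontier Ω ∩ Metric.closedBall 0 (2 * R)) := by
    rintro p ⟨hp, hx, hv, hns⟩
    rcases lt_trichotomy (hitTime Ω p) (ENNReal.ofReal h) with hlt | heq | hgt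
    · refine Or.inr ⟨hp, hv, ⟨?_, ?_⟩, hlt, hns⟩
      · exact collide_mem_frontier (hitTime_pos hΩ.isOpen hp) hlt.ne_top
      · rw [mem_closedBall_zero_iff]
        have hT : (hitTime Ω p).toReal ≤ 1 :=
          (ENNReal.toReal_le_of_le_ofReal h1.le hlt.le).trans h2.2.le
        calc ‖p.1 + (hitTime Ω p).toReal • p.2‖
            ≤ ‖p.1‖ + (hitTime Ω p).toReal * ‖p.2‖ := by
              refine (norm_add_le _ _).trans ?_
              rw [norm_smul, Real.norm_of_nonneg ENNReal.toReal_nonneg]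
          _ ≤ R + 1 * R := by gcongr
          _ = 2 * R := by ring
    · exact Or.inl ⟨hp, heq⟩
    · exact absurd ⟨hp, Or.inl hgt⟩ hns
  calc _ ≤ _ := measure_mono hsub
    _ ≤ _ := measure_union_le _ _
    _ ≤ ENNReal.ofReal (η * h) := by
      rw [volume_hitTime_eq hΩ.isOpen h1, zero_add]; exact H h h1 h2.1

/-! ### Successive admissible steps -/

/-- Phase points for which `N` successive steps of length `h` are admissible. -/
def chainSet (Ω : Set R3) (n : R3 → R3) (h : ℝ) (N : ℕ) : Set (R3 × R3) :=
  {p | p.1 ∈ Ω ∧ ∀ i < N, (trajectory Ω n h)^[i] p ∈ stepSet Ω n h}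

lemma chainSet_succ (hΩ : IsRegularDomain Ω n) {h : ℝ} (hh : 0 ≤ h) (N : ℕ) :
    chainSet Ω n h (N + 1) = stepSet Ω n h ∩ trajectory Ω n h ⁻¹' chainSet Ω n h N := by
  ext p
  constructor
  · rintro ⟨hp, H⟩
    have h0 : p ∈ stepSet Ω n h := by simpa using H 0 (by omega)
    refine ⟨h0, trajectory_mem_of_mem_stepSet hΩ hh h0, fun i hi => ?_⟩
    have := H (i + 1) (by omega)
    rwa [Function.iterate_succ_apply] at this
  · rintro ⟨h0, h1, H⟩
    refine ⟨h0.1, fun i hi => ?_⟩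
    rcases i with _ | i
    · simpa using h0
    · rw [Function.iterate_succ_apply]; exact H i (by omega)

lemma measurableSet_chainSet (hΩ : IsRegularDomain Ω n) {h : ℝ} (hh : 0 ≤ h) (N : ℕ) :
    MeasurableSet (chainSet Ω n h N) := by
  induction N with
  | zero =>
    have : chainSet Ω n h 0 = Prod.fst ⁻¹' Ω := by ext p; simp [chainSet]
    rw [this]; exact hΩ.isOpen.measurableSet.preimage measurable_fst
  | succ N ih =>
    rw [chainSet_succ hΩ hh]
    exact (measurableSet_stepSet hΩ h).inter
      (measurable_trajectory hΩ.contDiff_normal.continuous h ih)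

lemma volume_chainSet_inter_preimage_le (hΩ : IsRegularDomain Ω n) {h : ℝ} (hh : 0 ≤ h) (N : ℕ)
    {A : Set (R3 × R3)} (hA : MeasurableSet A) :
    volume (chainSet Ω n h N ∩ (trajectory Ω n h)^[N] ⁻¹' A) ≤ volume A := by
  induction N with
  | zero => exact measure_mono fun p hp => hp.2
  | succ N ih =>
    have hm := measurable_trajectory (Ω := Ω) hΩ.contDiff_normal.continuous h
    rw [chainSet_succ hΩ hh, Function.iterate_succ, preimage_comp, inter_assoc,
      ← preimage_inter]
    refine (volume_stepSet_inter_preimage_le hΩ hh ?_).trans ih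
    exact (measurableSet_chainSet hΩ hh N).inter (hm.iterate N hA)

lemma trajectory_of_mem_chainSet (hΩ : IsRegularDomain Ω n) {h : ℝ} (hh : 0 ≤ h) {N : ℕ} :
    ∀ {p : R3 × R3}, p ∈ chainSet Ω n h N → DefinedAt Ω n (N * h) p ∧
      trajectory Ω n (N * h) p = (trajectory Ω n h)^[N] p ∧ (trajectory Ω n (N * h) p).1 ∈ Ω ∧
      ‖(trajectory Ω n (N * h) p).2‖ = ‖p.2‖ ∧
      ‖(trajectory Ω n (N * h) p).1‖ ≤ ‖p.1‖ + N * h * ‖p.2‖ := by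
  induction N with
  | zero =>
    intro p hp
    have h0 : ENNReal.ofReal 0 < hitTime Ω p := by simpa using hitTime_pos hΩ.isOpen hp.1
    have h1 : trajectory Ω n 0 p = p := by rw [trajectory_of_lt_hitTime h0, freeFlight_zero]
    rw [Nat.cast_zero, zero_mul, h1]
    exact ⟨definedAt_of_lt_hitTime h0, rfl, hp.1, rfl, by simp⟩
  | succ N ih =>
    intro p hp
    rw [chainSet_succ hΩ hh] at hp
    obtain ⟨h0, h1⟩ := hp
    obtain ⟨a, b, c, d, e⟩ := ih h1
    have hadd := trajectory_add (s := h) (r := N * h) hh (by positivity)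
      (definedAt_of_mem_stepSet hΩ h0) a
    have hN : ((N + 1 : ℕ) : ℝ) * h = h + N * h := by push_cast; ring
    rw [hN]
    have hnorm := norm_trajectory_of_mem_stepSet hΩ h0
    have hle := norm_trajectory_sub_le hΩ hh h0
    refine ⟨hadd.1, ?_, ?_, ?_, ?_⟩
    · rw [hadd.2, b, Function.iterate_succ_apply]
    · rw [hadd.2]; exact c
    · rw [hadd.2, d, hnorm]
    · rw [hadd.2]; rw [hnorm] at e; linarith

lemma reverse_of_mem_chainSet (hΩ : IsRegularDomain Ω n) {h : ℝ} (hh : 0 ≤ h) {N : ℕ} :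
    ∀ {p : R3 × R3}, p ∈ chainSet Ω n h N →
      ∀ i ≤ N, reverse ((trajectory Ω n h)^[i] p) ∈ chainSet Ω n h i ∧
        (trajectory Ω n h)^[i] (reverse ((trajectory Ω n h)^[i] p)) = reverse p := by
  intro p hp i
  induction i with
  | zero => intro _; exact ⟨⟨hp.1, by simp⟩, by simp⟩
  | succ i ih =>
    intro hi
    obtain ⟨h1, h2⟩ := ih (by omega)
    obtain ⟨h3, h4⟩ := reverse_trajectory_of_mem_stepSet hΩ hh (hp.2 i (by omega))
    rw [← Function.iterate_succ_apply' (trajectory Ω n h) i p] at h3 h4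
    refine ⟨?_, ?_⟩
    · rw [chainSet_succ hΩ hh]
      exact ⟨h3, by rw [mem_preimage, h4]; exact h1⟩
    · rw [Function.iterate_succ_apply, h4, h2]

end

section

variable {Ω : Set R3} {n : R3 → R3}

/-! ### Almost every trajectory is defined for all times -/

/-- Phase points of `Ω × ℝ³` with position and velocity bounded by `R`. -/
def boundedPhase (Ω : Set R3) (R : ℝ) : Set (R3 × R3) := {p | p.1 ∈ Ω ∧ ‖p.1‖ ≤ R ∧ ‖p.2‖ ≤ R}

/-- If the time `t` is divided into sufficiently many steps, then most of the trajectories starting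
in a bounded set have only admissible steps: each step loses a volume `o(1 / N)`, and the volume is
preserved as long as the steps are admissible. -/
lemma exists_volume_diff_chainSet_le (hΩ : IsRegularDomain Ω n) {t R : ℝ} (ht : 0 < t)
    (hR : 0 < R) {η : ℝ} (hη : 0 < η) :
    ∃ N : ℕ, 0 < N ∧ volume (boundedPhase Ω R \ chainSet Ω n (t / N) N) ≤ ENNReal.ofReal η := by
  have hR' : 0 < R + t * R := by positivity
  obtain ⟨h₀, hh₀, H⟩ := exists_volume_diff_stepSet_le hΩ hR' (η / t) (by positivity)
  obtain ⟨N, hN⟩ := exists_nat_gt (t / h₀)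
  have hNpos : (0 : ℝ) < N := lt_trans (by positivity) hN
  have hN0 : 0 < N := by exact_mod_cast hNpos
  refine ⟨N, hN0, ?_⟩
  set h := t / N with hh
  have hpos : 0 < h := by positivity
  have hlt : h < h₀ := by rw [hh, div_lt_iff₀ hNpos]; rwa [div_lt_iff₀ hh₀, mul_comm] at hN
  set B := {p : R3 × R3 | p.1 ∈ Ω ∧ ‖p.1‖ ≤ R + t * R ∧ ‖p.2‖ ≤ R + t * R ∧
    p ∉ stepSet Ω n h} with hB
  have hBm : MeasurableSet B := by
    refine (hΩ.isOpen.measurableSet.preimage measurable_fst).inter ?_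
    refine (measurableSet_le measurable_fst.norm measurable_const).inter ?_
    exact (measurableSet_le measurable_snd.norm measurable_const).inter
      (measurableSet_stepSet hΩ h).compl
  have hsub : boundedPhase Ω R \ chainSet Ω n h N ⊆
      ⋃ i ∈ Finset.range N, chainSet Ω n h i ∩ (trajectory Ω n h)^[i] ⁻¹' B := by
    classical
    rintro p ⟨⟨hp, hx, hv⟩, hnot⟩
    have hex : ∃ i, i < N ∧ (trajectory Ω n h)^[i] p ∉ stepSet Ω n h := by
      by_contra! hcon
      exact hnot ⟨hp, hcon⟩
    obtain ⟨hi, hi'⟩ := Nat.find_spec hex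
    set i := Nat.find hex with hidef
    have hchain : p ∈ chainSet Ω n h i := ⟨hp, fun j hj => by
      have := Nat.find_min hex hj
      by_contra hcon
      exact this ⟨hj.trans hi, hcon⟩⟩
    rw [mem_iUnion₂]
    refine ⟨i, Finset.mem_range.2 hi, hchain, ?_⟩
    obtain ⟨-, b, c, d, e⟩ := trajectory_of_mem_chainSet hΩ hpos.le hchain
    rw [b] at c d e
    have hih : i * h ≤ t := by
      have h1 : (i : ℝ) ≤ N := by exact_mod_cast hi.le
      calc i * h ≤ N * h := by gcongr
        _ = t := by rw [hh]; field_simp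
    refine ⟨c, e.trans ?_, ?_, hi'⟩
    · gcongr
    · rw [d]; nlinarith
  calc volume (boundedPhase Ω R \ chainSet Ω n h N)
      ≤ _ := measure_mono hsub
    _ ≤ ∑ i ∈ Finset.range N, volume (chainSet Ω n h i ∩ (trajectory Ω n h)^[i] ⁻¹' B) :=
        measure_biUnion_finset_le _ _
    _ ≤ ∑ i ∈ Finset.range N, ENNReal.ofReal (η / t * h) := by
        refine Finset.sum_le_sum fun i _ => ?_
        exact (volume_chainSet_inter_preimage_le hΩ hpos.le i hBm).trans (H h hpos hlt)
    _ = ENNReal.ofReal η := by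
        rw [Finset.sum_const, Finset.card_range, nsmul_eq_mul, ← ENNReal.ofReal_natCast,
          ← ENNReal.ofReal_mul hNpos.le]
        congr 1; rw [hh]; field_simp

lemma phaseMeasure_apply {A : Set (R3 × R3)} (hA : MeasurableSet A) :
    phaseMeasure Ω A = volume (A ∩ {p | p.1 ∈ Ω}) := by
  rw [phaseMeasure, Measure.restrict_apply hA]
  congr 2; ext p; simp

lemma measurableSet_phase (hΩ : IsOpen Ω) : MeasurableSet {p : R3 × R3 | p.1 ∈ Ω} :=
  hΩ.measurableSet.preimage measurable_fst

lemma ae_phaseMeasure_mem (hΩ : IsOpen Ω) : ∀ᵐ p ∂(phaseMeasure Ω), p.1 ∈ Ω := by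
  filter_upwards [ae_restrict_mem (hΩ.measurableSet.prod MeasurableSet.univ)] with p hp
  exact hp.1

lemma ae_phaseMeasure_iff (hΩ : IsOpen Ω) {P : R3 × R3 → Prop} :
    (∀ᵐ p ∂(phaseMeasure Ω), P p) ↔ volume {p : R3 × R3 | p.1 ∈ Ω ∧ ¬ P p} = 0 := by
  rw [phaseMeasure, ae_restrict_iff' (hΩ.measurableSet.prod MeasurableSet.univ), ae_iff]
  simp

lemma volume_phase_eq_zero {S : Set (R3 × R3)}
    (h : ∀ R > 0, ∀ η > 0, volume (boundedPhase Ω R ∩ S) ≤ ENNReal.ofReal η) :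
    volume {p : R3 × R3 | p.1 ∈ Ω ∧ p ∈ S} = 0 := by
  have hsub : {p : R3 × R3 | p.1 ∈ Ω ∧ p ∈ S} ⊆ ⋃ k : ℕ, boundedPhase Ω (k + 1) ∩ S := by
    rintro p ⟨hp, hS⟩
    obtain ⟨k, hk⟩ := exists_nat_ge (max ‖p.1‖ ‖p.2‖)
    refine mem_iUnion.2 ⟨k, ⟨hp, ?_, ?_⟩, hS⟩
    · linarith [le_max_left ‖p.1‖ ‖p.2‖]
    · linarith [le_max_right ‖p.1‖ ‖p.2‖]
  refine measure_mono_null hsub (measure_iUnion_null fun k => ?_)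
  refine le_antisymm (ENNReal.le_of_forall_pos_le_add fun ε hε _ => ?_) zero_le
  rw [zero_add]
  simpa using h (k + 1) (by positivity) ε (by exact_mod_cast hε)

lemma ae_exists_mem_chainSet (hΩ : IsRegularDomain Ω n) {t : ℝ} (ht : 0 < t) :
    ∀ᵐ p ∂(phaseMeasure Ω), ∃ N : ℕ, 0 < N ∧ p ∈ chainSet Ω n (t / N) N := by
  rw [ae_phaseMeasure_iff hΩ.isOpen]
  refine volume_phase_eq_zero (S := {p | ¬ ∃ N : ℕ, 0 < N ∧ p ∈ chainSet Ω n (t / N) N})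
    fun R hR η hη => ?_
  obtain ⟨N, hN, h⟩ := exists_volume_diff_chainSet_le hΩ ht hR hη
  refine (measure_mono ?_).trans h
  rintro p ⟨hp, hS⟩
  exact ⟨hp, fun hcon => hS ⟨N, hN, hcon⟩⟩

lemma trajectory_zero (hΩ : IsOpen Ω) {p : R3 × R3} (hp : p.1 ∈ Ω) : trajectory Ω n 0 p = p := by
  rw [trajectory_of_lt_hitTime (by simpa using hitTime_pos hΩ hp), freeFlight_zero]

/-- The properties of the trajectory at a fixed time which hold for almost every starting point. -/
lemma ae_trajectory (hΩ : IsRegularDomain Ω n) {t : ℝ} (ht : 0 ≤ t) :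
    ∀ᵐ p ∂(phaseMeasure Ω), DefinedAt Ω n t p ∧ (trajectory Ω n t p).1 ∈ Ω ∧
      ‖(trajectory Ω n t p).2‖ = ‖p.2‖ ∧ ‖(trajectory Ω n t p).1‖ ≤ ‖p.1‖ + t * ‖p.2‖ ∧
      trajectory Ω n t (reverse (trajectory Ω n t p)) = reverse p := by
  rcases ht.eq_or_lt with rfl | ht
  · filter_upwards [ae_phaseMeasure_mem hΩ.isOpen] with p hp
    have h1 := trajectory_zero (n := n) hΩ.isOpen hp
    have h2 : trajectory Ω n 0 (reverse p) = reverse p := trajectory_zero hΩ.isOpen hp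
    rw [h1]
    exact ⟨definedAt_of_lt_hitTime (by simpa using hitTime_pos hΩ.isOpen hp), hp, rfl,
      by simp, h2⟩
  · filter_upwards [ae_exists_mem_chainSet hΩ ht] with p hp
    obtain ⟨N, hN, hp⟩ := hp
    have hN' : (0 : ℝ) < N := by exact_mod_cast hN
    have hh : 0 ≤ t / N := by positivity
    obtain ⟨a, b, c, d, e⟩ := trajectory_of_mem_chainSet hΩ hh hp
    have hNt : N * (t / N) = t := by field_simp
    obtain ⟨h1, h2⟩ := reverse_of_mem_chainSet hΩ hh hp N le_rfl
    have h3 := (trajectory_of_mem_chainSet hΩ hh h1).2.1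
    rw [← b, hNt] at h1 h2 h3
    rw [hNt] at a b c d e
    exact ⟨a, c, d, e, by rw [h3, b, ← b, h2]⟩

/-- Almost every trajectory is defined for all times. -/
lemma ae_definedAt (hΩ : IsRegularDomain Ω n) :
    ∀ᵐ p ∂(phaseMeasure Ω), ∀ t, DefinedAt Ω n t p := by
  have h : ∀ᵐ p ∂(phaseMeasure Ω), ∀ k : ℕ, DefinedAt Ω n k p :=
    ae_all_iff.2 fun k => (ae_trajectory hΩ k.cast_nonneg).mono fun p hp => hp.1
  filter_upwards [h] with p hp t
  obtain ⟨k, hk⟩ := exists_nat_ge t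
  exact (hp k).mono hk

lemma phaseMeasure_preimage_trajectory_le (hΩ : IsRegularDomain Ω n) {t : ℝ} (ht : 0 ≤ t)
    {A : Set (R3 × R3)} (hA : MeasurableSet A) :
    phaseMeasure Ω (trajectory Ω n t ⁻¹' A) ≤ phaseMeasure Ω A := by
  have hm := measurable_trajectory (Ω := Ω) hΩ.contDiff_normal.continuous t
  rw [phaseMeasure_apply (hm hA), phaseMeasure_apply hA]
  rcases ht.eq_or_lt with rfl | ht
  · refine measure_mono ?_
    rintro p ⟨h1, h2⟩
    rw [mem_preimage, trajectory_zero hΩ.isOpen h2] at h1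
    exact ⟨h1, h2⟩
  set S := trajectory Ω n t ⁻¹' A with hS
  have hunion : S ∩ {p | p.1 ∈ Ω} = ⋃ k : ℕ, boundedPhase Ω (k + 1) ∩ S := by
    ext p
    constructor
    · rintro ⟨hS, hp⟩
      obtain ⟨k, hk⟩ := exists_nat_ge (max ‖p.1‖ ‖p.2‖)
      refine mem_iUnion.2 ⟨k, ⟨hp, ?_, ?_⟩, hS⟩
      · linarith [le_max_left ‖p.1‖ ‖p.2‖]
      · linarith [le_max_right ‖p.1‖ ‖p.2‖]
    · intro h
      obtain ⟨k, ⟨h1, -⟩, h2⟩ := mem_iUnion.1 h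
      exact ⟨h2, h1⟩
  have hmono : Monotone fun k : ℕ => boundedPhase Ω (k + 1) ∩ S := by
    intro i j hij p ⟨⟨h1, h2, h3⟩, h4⟩
    have : (i : ℝ) ≤ j := by exact_mod_cast hij
    exact ⟨⟨h1, by linarith, by linarith⟩, h4⟩
  rw [hunion, hmono.measure_iUnion]
  refine iSup_le fun k => ENNReal.le_of_forall_pos_le_add fun ε hε _ => ?_
  obtain ⟨N, hN, h⟩ := exists_volume_diff_chainSet_le hΩ ht (R := k + 1) (by positivity)
    (η := ε) (by exact_mod_cast hε)
  have hN' : (0 : ℝ) < N := by exact_mod_cast hN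
  have hh : 0 ≤ t / N := by positivity
  have hNt : N * (t / N) = t := by field_simp
  have hsub : boundedPhase Ω (k + 1) ∩ S ⊆
      (chainSet Ω n (t / N) N ∩ (trajectory Ω n (t / N))^[N] ⁻¹' (A ∩ {p | p.1 ∈ Ω})) ∪
        (boundedPhase Ω (k + 1) \ chainSet Ω n (t / N) N) := by
    rintro p ⟨h1, h2⟩
    by_cases hp : p ∈ chainSet Ω n (t / N) N
    · left
      obtain ⟨-, b, c, -, -⟩ := trajectory_of_mem_chainSet hΩ hh hp
      rw [hNt] at b c
      refine ⟨hp, ?_⟩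
      rw [mem_preimage, ← b]
      exact ⟨h2, c⟩
    · exact Or.inr ⟨h1, hp⟩
  calc volume (boundedPhase Ω (k + 1) ∩ S) ≤ _ := measure_mono hsub
    _ ≤ _ := measure_union_le _ _
    _ ≤ volume (A ∩ {p | p.1 ∈ Ω}) + ε := by
      refine add_le_add (volume_chainSet_inter_preimage_le hΩ hh N
        (hA.inter (measurableSet_phase hΩ.isOpen))) (h.trans (le_of_eq ?_))
      simp

/-! ### The flow and its inverse preserve the phase measure -/

/-- The backward trajectories: reversal of the velocities conjugates them to the forward ones. -/
def backTrajectory (Ω : Set R3) (n : R3 → R3) (t : ℝ) (p : R3 × R3) : R3 × R3 :=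
  reverse (trajectory Ω n t (reverse p))

lemma measurePreserving_reverse_phase (hΩ : IsOpen Ω) :
    MeasurePreserving reverse (phaseMeasure Ω) (phaseMeasure Ω) := by
  have := measurePreserving_reverse.restrict_preimage
    (hΩ.measurableSet.prod (MeasurableSet.univ (α := R3)))
  exact this

lemma measurable_backTrajectory_uncurry (hn : Continuous n) :
    Measurable (fun q : ℝ × R3 × R3 => backTrajectory Ω n q.1 q.2) := by
  have key : ∀ F : ℝ × R3 × R3 → R3 × R3, Measurable F →
      Measurable fun q : ℝ × R3 × R3 => reverse (F (q.1, reverse q.2)) := fun F hF =>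
    continuous_reverse.measurable.comp (hF.comp
      (measurable_fst.prodMk (continuous_reverse.measurable.comp measurable_snd)))
  exact key _ (measurable_trajectory_uncurry hn)

lemma measurable_backTrajectory (hn : Continuous n) (t : ℝ) :
    Measurable (backTrajectory Ω n t) :=
  continuous_reverse.measurable.comp
    ((measurable_trajectory hn t).comp continuous_reverse.measurable)

lemma ae_back_trajectory (hΩ : IsRegularDomain Ω n) {t : ℝ} (ht : 0 ≤ t) :
    ∀ᵐ p ∂(phaseMeasure Ω), backTrajectory Ω n t (trajectory Ω n t p) = p := by
  filter_upwards [ae_trajectory hΩ ht] with p hp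
  rw [backTrajectory, hp.2.2.2.2, reverse_reverse]

lemma ae_trajectory_back (hΩ : IsRegularDomain Ω n) {t : ℝ} (ht : 0 ≤ t) :
    ∀ᵐ p ∂(phaseMeasure Ω), trajectory Ω n t (backTrajectory Ω n t p) = p := by
  filter_upwards [(measurePreserving_reverse_phase hΩ.isOpen).quasiMeasurePreserving.ae
    (ae_trajectory hΩ ht)] with p hp
  rw [backTrajectory, hp.2.2.2.2, reverse_reverse]

/-- Both the flow and its inverse do not increase the measure of preimages; hence they preserve
the measure. -/
theorem measurePreserving_trajectory_and_back (hΩ : IsRegularDomain Ω n) {t : ℝ} (ht : 0 ≤ t) :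
    MeasurePreserving (trajectory Ω n t) (phaseMeasure Ω) (phaseMeasure Ω) ∧
      MeasurePreserving (backTrajectory Ω n t) (phaseMeasure Ω) (phaseMeasure Ω) := by
  have hn := hΩ.contDiff_normal.continuous
  have hm := measurable_trajectory (Ω := Ω) hn t
  have hbm := measurable_backTrajectory (Ω := Ω) hn t
  have hr := measurePreserving_reverse_phase hΩ.isOpen
  have hle : ∀ A, MeasurableSet A →
      phaseMeasure Ω (trajectory Ω n t ⁻¹' A) ≤ phaseMeasure Ω A := fun A hA =>
    phaseMeasure_preimage_trajectory_le hΩ ht hA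
  have hle' : ∀ A, MeasurableSet A →
      phaseMeasure Ω (backTrajectory Ω n t ⁻¹' A) ≤ phaseMeasure Ω A := by
    intro A hA
    have h1 : backTrajectory Ω n t ⁻¹' A =
        reverse ⁻¹' (trajectory Ω n t ⁻¹' (reverse ⁻¹' A)) := rfl
    have hA' := hr.measurable hA
    rw [h1, hr.measure_preimage (hm hA').nullMeasurableSet]
    refine (hle _ hA').trans (le_of_eq ?_)
    exact hr.measure_preimage hA.nullMeasurableSet
  have hback : ∀ A, MeasurableSet A → phaseMeasure Ω (backTrajectory Ω n t ⁻¹' A) =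
      phaseMeasure Ω A := by
    intro A hA
    refine le_antisymm (hle' A hA) ?_
    calc phaseMeasure Ω A
        = phaseMeasure Ω (trajectory Ω n t ⁻¹' (backTrajectory Ω n t ⁻¹' A)) := by
          refine measure_congr ?_
          filter_upwards [ae_back_trajectory hΩ ht] with p hp
          change (p ∈ A) = (backTrajectory Ω n t (trajectory Ω n t p) ∈ A)
          rw [hp]
      _ ≤ _ := hle _ (hbm hA)
  have hforw : ∀ A, MeasurableSet A → phaseMeasure Ω (trajectory Ω n t ⁻¹' A) =
      phaseMeasure Ω A := by
    intro A hA
    refine le_antisymm (hle A hA) ?_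
    calc phaseMeasure Ω A
        = phaseMeasure Ω (backTrajectory Ω n t ⁻¹' (trajectory Ω n t ⁻¹' A)) := by
          refine measure_congr ?_
          filter_upwards [ae_trajectory_back hΩ ht] with p hp
          change (p ∈ A) = (trajectory Ω n t (backTrajectory Ω n t p) ∈ A)
          rw [hp]
      _ ≤ _ := hle' _ (hm hA)
  refine ⟨⟨hm, ?_⟩, ⟨hbm, ?_⟩⟩ <;> ext A hA
  · rw [Measure.map_apply hm hA, hforw A hA]
  · rw [Measure.map_apply hbm hA, hback A hA]

theorem measurePreserving_trajectory (hΩ : IsRegularDomain Ω n) {t : ℝ} (ht : 0 ≤ t) :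
    MeasurePreserving (trajectory Ω n t) (phaseMeasure Ω) (phaseMeasure Ω) :=
  (measurePreserving_trajectory_and_back hΩ ht).1

theorem measurePreserving_backTrajectory (hΩ : IsRegularDomain Ω n) {t : ℝ} (ht : 0 ≤ t) :
    MeasurePreserving (backTrajectory Ω n t) (phaseMeasure Ω) (phaseMeasure Ω) :=
  (measurePreserving_trajectory_and_back hΩ ht).2

/-! ### Continuity of the trajectories in time -/

lemma collide_iterate_mem_frontier (hΩ : IsOpen Ω) {p : R3 × R3} (hp : p.1 ∈ Ω) (k : ℕ)
    (hk : collisionTime Ω n (k + 1) p ≠ ⊤) : ((collide Ω n)^[k + 1] p).1 ∈ frontier Ω := by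
  induction k with
  | zero =>
    rw [collisionTime_succ, collisionTime_zero, zero_add] at hk
    exact collide_mem_frontier (hitTime_pos hΩ hp) hk
  | succ k ih =>
    rw [collisionTime_succ, ENNReal.add_ne_top] at hk
    rw [Function.iterate_succ_apply']
    rcases eq_or_ne (hitTime Ω ((collide Ω n)^[k + 1] p)) 0 with h0 | h0
    · rw [collide, h0, ENNReal.toReal_zero, zero_smul, add_zero]; exact ih hk.1
    · exact collide_mem_frontier (pos_iff_ne_zero.2 h0) hk.2

/-- A trajectory is continuous at every time at which it is inside `Ω`. -/
lemma continuousAt_trajectory (hΩ : IsOpen Ω) {p : R3 × R3} (hp : p.1 ∈ Ω) {t : ℝ} (ht : 0 ≤ t)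
    (hd : DefinedAt Ω n t p) (hmem : (trajectory Ω n t p).1 ∈ Ω) :
    ContinuousAt (fun s => trajectory Ω n s p) t := by
  obtain ⟨k, h1, h2⟩ := hd
  have hctop : collisionTime Ω n k p ≠ ⊤ := ne_top_of_le_ne_top ENNReal.ofReal_ne_top h1
  have hev1 : ∀ᶠ s in 𝓝 t, collisionTime Ω n k p ≤ ENNReal.ofReal s := by
    rcases k with _ | k
    · simp
    · rcases h1.eq_or_lt with heq | hlt
      · exfalso
        have h3 : trajectory Ω n t p = (collide Ω n)^[k + 1] p := by
          rw [trajectory_eq h1 h2, heq, ENNReal.toReal_ofReal ht, sub_self, freeFlight_zero]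
        rw [h3] at hmem
        exact notMem_frontier_of_mem hΩ hmem (collide_iterate_mem_frontier hΩ hp k hctop)
      · exact (ENNReal.continuous_ofReal.continuousAt.eventually (lt_mem_nhds hlt)).mono
          fun s hs => le_of_lt hs
  have hev2 : ∀ᶠ s in 𝓝 t, ENNReal.ofReal s < collisionTime Ω n (k + 1) p :=
    ENNReal.continuous_ofReal.continuousAt.eventually (gt_mem_nhds h2)
  have hcont : ContinuousAt (fun s : ℝ => freeFlight (s - (collisionTime Ω n k p).toReal)
      ((collide Ω n)^[k] p)) t := by
    unfold freeFlight; fun_prop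
  refine hcont.congr ?_
  filter_upwards [hev1, hev2] with s hs1 hs2
  exact (trajectory_eq hs1 hs2).symm

end

section

/-! ### Collision kernels -/

instance isFiniteMeasure_surfaceS2 : IsFiniteMeasure surfaceS2 :=
  inferInstanceAs (IsFiniteMeasure (volume : Measure R3).toSphere)

instance sFinite_volume_R3 : SFinite (volume : Measure R3) := inferInstance

instance sFinite_volume_prod_surfaceS2 : SFinite ((volume : Measure R3).prod surfaceS2) :=
  inferInstance

lemma norm_coe_S2 (σ : S2) : ‖(σ : R3)‖ = 1 := norm_eq_of_mem_sphere σ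

/-- Reflection of the relative velocity in a collision with parameter `σ`. -/
def reflectVel (w : R3) (σ : S2) : R3 := w - (2 * inner ℝ w (σ : R3)) • (σ : R3)

/-- A measurable version of a collision kernel.  Of the dependence on `|w|` and `|w · σ|` only the
invariance under `w ↦ -w` and under reflection along `σ` is retained, but everywhere. -/
structure IsSymmetricKernel (β : R3 → S2 → ℝ) : Prop where
  measurable : Measurable (Function.uncurry β)
  integrable : Integrable (Function.uncurry β) ((volume : Measure R3).prod surfaceS2)
  nonneg : ∀ w σ, 0 ≤ β w σ
  neg : ∀ w σ, β (-w) σ = β w σ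
  reflect : ∀ w σ, β (reflectVel w σ) σ = β w σ

lemma reflectVel_reflectVel (w : R3) (σ : S2) : reflectVel (reflectVel w σ) σ = w :=
  specular_specular (n := fun _ => (σ : R3)) (y := 0) (norm_coe_S2 σ)

lemma reflectVel_neg (w : R3) (σ : S2) : reflectVel (-w) σ = -reflectVel w σ :=
  specular_neg (n := fun _ => (σ : R3)) 0 w

lemma measurePreserving_reflectVel :
    MeasurePreserving (fun p : R3 × S2 => (reflectVel p.1 p.2, p.2))
      ((volume : Measure R3).prod surfaceS2) ((volume : Measure R3).prod surfaceS2) := by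
  have hm : Measurable (Function.uncurry fun (σ : S2) (w : R3) => reflectVel w σ) := by
    have : Continuous (Function.uncurry fun (σ : S2) (w : R3) => reflectVel w σ) := by
      unfold reflectVel Function.uncurry; fun_prop
    exact this.measurable
  have h := (MeasurePreserving.id surfaceS2).skew_product (μc := (volume : Measure R3))
    (μd := volume) hm (ae_of_all _ fun σ => (measurePreserving_reflect (norm_coe_S2 σ)).map_eq)
  exact (Measure.measurePreserving_swap.comp h).comp Measure.measurePreserving_swap

lemma measurePreserving_negVel : MeasurePreserving (fun p : R3 × S2 => (-p.1, p.2))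
      ((volume : Measure R3).prod surfaceS2) ((volume : Measure R3).prod surfaceS2) :=
  (Measure.measurePreserving_neg (volume : Measure R3)).prod (MeasurePreserving.id surfaceS2)

/-- The average of a measurable version of `b` over the group generated by `w ↦ -w` and the
reflections has all the symmetries everywhere. -/
lemma IsCollisionKernel.exists_symmetric {b : R3 → S2 → ℝ} (hb : IsCollisionKernel b) :
    ∃ β, IsSymmetricKernel β ∧
      ∀ᵐ p : R3 × S2 ∂((volume : Measure R3).prod surfaceS2), b p.1 p.2 = β p.1 p.2 := by
  set M := (volume : Measure R3).prod surfaceS2 with hM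
  obtain ⟨q, hq⟩ := hb.symmetric
  have hae := hb.integrable.1.aemeasurable
  set c : R3 × S2 → ℝ := fun p => max (hae.mk _ p) 0 with hc
  have hcm : Measurable c := hae.measurable_mk.max measurable_const
  have hcb : ∀ᵐ p ∂M, b p.1 p.2 = c p := by
    filter_upwards [hae.ae_eq_mk, hb.nonneg] with p h1 h2
    rw [hc]; dsimp only
    rw [← h1, max_eq_left h2]
  have hcq : ∀ᵐ p : R3 × S2 ∂M, c p = q ‖p.1‖ |inner ℝ p.1 (p.2 : R3)| := by
    filter_upwards [hcb, hq] with p h1 h2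
    rw [← h1, h2]
  have hci : Integrable c M := hb.integrable.congr hcb
  set G1 : R3 × S2 → R3 × S2 := fun p => (-p.1, p.2) with hG1
  set G2 : R3 × S2 → R3 × S2 := fun p => (reflectVel p.1 p.2, p.2) with hG2
  have hm1 : MeasurePreserving G1 M M := measurePreserving_negVel
  have hm2 : MeasurePreserving G2 M M := measurePreserving_reflectVel
  have hG12 : ∀ p, G2 (G1 p) = G1 (G2 p) := fun p => by simp [hG1, hG2, reflectVel_neg]
  have hG11 : ∀ p, G1 (G1 p) = p := fun p => by simp [hG1]
  have hG22 : ∀ p, G2 (G2 p) = p := fun p => by simp [hG2, reflectVel_reflectVel]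
  set q' : R3 × S2 → ℝ := fun p => q ‖p.1‖ |inner ℝ p.1 (p.2 : R3)| with hq'
  have hq1 : ∀ p, q' (G1 p) = q' p := fun p => by simp [hq', hG1]
  have hq2 : ∀ p, q' (G2 p) = q' p := fun p => by
    have h1 : ‖reflectVel p.1 p.2‖ = ‖p.1‖ :=
      norm_specular (n := fun _ => (p.2 : R3)) (y := 0) (norm_coe_S2 p.2)
    have h2 : inner ℝ (reflectVel p.1 p.2) (p.2 : R3) = -inner ℝ p.1 (p.2 : R3) :=
      inner_specular (n := fun _ => (p.2 : R3)) (y := 0) (norm_coe_S2 p.2)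
    simp only [hq', hG2, h1, h2, abs_neg]
  set B : R3 × S2 → ℝ := fun p => (c p + c (G1 p) + c (G2 p) + c (G1 (G2 p))) / 4 with hB
  have hB1 : ∀ p, B (G1 p) = B p := fun p => by
    simp only [hB, hG12, hG11]; ring
  have hB2 : ∀ p, B (G2 p) = B p := fun p => by
    simp only [hB, ← hG12, hG22]; ring
  have i1 := hm1.integrable_comp_of_integrable hci
  have i2 := hm2.integrable_comp_of_integrable hci
  have i3 := hm2.integrable_comp_of_integrable i1
  refine ⟨fun w σ => B (w, σ), ⟨?_, ?_, ?_, ?_, ?_⟩, ?_⟩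
  · exact (((hcm.add (hcm.comp hm1.measurable)).add (hcm.comp hm2.measurable)).add
      ((hcm.comp hm1.measurable).comp hm2.measurable)).div_const 4
  · exact (((hci.add i1).add i2).add i3).div_const 4
  · intro w σ
    have hc0 : ∀ p, 0 ≤ c p := fun p => le_max_right _ _
    have h1 := hc0 (w, σ)
    have h2 := hc0 (G1 (w, σ))
    have h3 := hc0 (G2 (w, σ))
    have h4 := hc0 (G1 (G2 (w, σ)))
    simp only [hB]; linarith
  · intro w σ; exact hB1 (w, σ)
  · intro w σ; exact hB2 (w, σ)
  · have a1 := hm1.quasiMeasurePreserving.ae hcq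
    have a2 := hm2.quasiMeasurePreserving.ae hcq
    have a3 := hm2.quasiMeasurePreserving.ae a1
    filter_upwards [hcb, hcq, a1, a2, a3] with p h0 h1 h2 h3 h4
    have h2' : c (G1 p) = q' (G1 p) := h2
    have h3' : c (G2 p) = q' (G2 p) := h3
    have h4' : c (G1 (G2 p)) = q' (G1 (G2 p)) := h4
    have h1' : c p = q' p := h1
    change b p.1 p.2 = B p
    simp only [hB]
    rw [h2', h3', h4', h0, h1', hq1, hq1, hq2]; ring

/-! ### The collision map -/

/-- The pre- and post-collisional velocities, `(v, v_*, σ) ↦ (v', v_*', σ)`. -/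
def collisionMap (z : R3 × R3 × S2) : R3 × R3 × S2 :=
  (velPrime z.1 z.2.1 z.2.2, velStarPrime z.1 z.2.1 z.2.2, z.2.2)

/-- The measure `dv dv_* dσ`. -/
def collisionMeasure : Measure (R3 × R3 × S2) :=
  (volume : Measure R3).prod ((volume : Measure R3).prod surfaceS2)

instance sFinite_collisionMeasure : SFinite collisionMeasure :=
  inferInstanceAs (SFinite ((volume : Measure R3).prod ((volume : Measure R3).prod surfaceS2)))

lemma inner_sub_prime (v vs : R3) (σ : S2) :
    inner ℝ (velPrime v vs σ - velStarPrime v vs σ) (σ : R3) = -inner ℝ (v - vs) (σ : R3) := by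
  rw [velPrime, velStarPrime, inner_sub_left, inner_sub_left, inner_add_left, inner_smul_left,
    real_inner_self_eq_norm_sq, norm_coe_S2, inner_sub_left]
  simp

lemma velPrime_prime (v vs : R3) (σ : S2) :
    velPrime (velPrime v vs σ) (velStarPrime v vs σ) σ = v := by
  rw [velPrime, inner_sub_prime, velPrime]; simp

lemma velStarPrime_prime (v vs : R3) (σ : S2) :
    velStarPrime (velPrime v vs σ) (velStarPrime v vs σ) σ = vs := by
  rw [velStarPrime, inner_sub_prime, velStarPrime]; simp

lemma velPrime_swap (v vs : R3) (σ : S2) : velPrime vs v σ = velStarPrime v vs σ := by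
  rw [velPrime, velStarPrime, ← neg_sub v vs, inner_neg_left]; simp

lemma velStarPrime_swap (v vs : R3) (σ : S2) : velStarPrime vs v σ = velPrime v vs σ := by
  rw [velPrime, velStarPrime, ← neg_sub v vs, inner_neg_left]; simp [sub_eq_add_neg]

lemma velPrime_sub_velStarPrime (v vs : R3) (σ : S2) :
    velPrime v vs σ - velStarPrime v vs σ = reflectVel (v - vs) σ := by
  rw [velPrime, velStarPrime, reflectVel]; module

/-- Conservation of kinetic energy in a collision. -/
lemma norm_sq_prime_add (v vs : R3) (σ : S2) :
    ‖velPrime v vs σ‖ ^ 2 + ‖velStarPrime v vs σ‖ ^ 2 = ‖v‖ ^ 2 + ‖vs‖ ^ 2 := by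
  rw [velPrime, velStarPrime, norm_sub_sq_real, norm_add_sq_real, norm_smul, norm_coe_S2,
    inner_smul_right, inner_smul_right, mul_one, Real.norm_eq_abs, sq_abs, inner_sub_left]
  ring

lemma measurePreserving_of_involutive {L : R3 × R3 →ₗ[ℝ] R3 × R3} (hL : L ∘ₗ L = LinearMap.id) :
    MeasurePreserving L volume volume := by
  have hdet : LinearMap.det L * LinearMap.det L = 1 := by
    rw [← LinearMap.det_comp, hL, LinearMap.det_id]
  have habs : |(LinearMap.det L)⁻¹| = 1 := by
    rcases mul_self_eq_one_iff.1 hdet with h | h <;> simp [h]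
  refine ⟨(LinearMap.continuous_of_finiteDimensional L).measurable, ?_⟩
  rw [Measure.map_linearMap_addHaar_eq_smul_addHaar _ (left_ne_zero_of_mul_eq_one hdet), habs]
  simp

lemma continuous_collisionMap : Continuous collisionMap := by
  unfold collisionMap velPrime velStarPrime; fun_prop

lemma measurePreserving_collisionMap :
    MeasurePreserving collisionMap collisionMeasure collisionMeasure := by
  -- for fixed `σ` the map is a linear involution of `ℝ³ × ℝ³`
  set C : S2 → R3 × R3 → R3 × R3 := fun σ u => (velPrime u.1 u.2 σ, velStarPrime u.1 u.2 σ)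
  have hC : ∀ σ, MeasurePreserving (C σ) volume volume := by
    intro σ
    set L : R3 × R3 →ₗ[ℝ] R3 × R3 :=
      { toFun := C σ
        map_add' := fun x y => by
          ext1 <;> simp only [C, velPrime, velStarPrime, Prod.fst_add, Prod.snd_add,
            inner_sub_left, inner_add_left] <;> module
        map_smul' := fun c x => by
          ext1 <;> simp only [C, velPrime, velStarPrime, Prod.smul_fst, Prod.smul_snd,
            inner_sub_left, inner_smul_left, conj_trivial, RingHom.id_apply] <;> module }
    exact measurePreserving_of_involutive (L := L) (LinearMap.ext fun u => by
      change C σ (C σ u) = u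
      simp [C, velPrime_prime, velStarPrime_prime])
  have hm : Measurable (Function.uncurry C) := by
    have : Continuous (Function.uncurry C) := by
      unfold Function.uncurry; simp only [C]; unfold velPrime velStarPrime; fun_prop
    exact this.measurable
  have hskew : MeasurePreserving (fun z : S2 × R3 × R3 => (z.1, C z.1 z.2))
      (surfaceS2.prod (volume.prod volume)) (surfaceS2.prod (volume.prod volume)) :=
    (MeasurePreserving.id surfaceS2).skew_product hm (ae_of_all _ fun σ => (hC σ).map_eq)
  have he : MeasurePreserving (fun z : S2 × R3 × R3 => (z.2.1, z.2.2, z.1))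
      (surfaceS2.prod (volume.prod volume)) collisionMeasure :=
    (measurePreserving_prodAssoc (volume : Measure R3) (volume : Measure R3) surfaceS2).comp
      (Measure.measurePreserving_swap (μ := surfaceS2)
        (ν := (volume : Measure R3).prod (volume : Measure R3)))
  have he' : MeasurePreserving (fun z : R3 × R3 × S2 => (z.2.2, z.1, z.2.1))
      collisionMeasure (surfaceS2.prod (volume.prod volume)) :=
    (Measure.measurePreserving_swap (μ := (volume : Measure R3).prod (volume : Measure R3))
        (ν := surfaceS2)).comp
      ((measurePreserving_prodAssoc (volume : Measure R3) (volume : Measure R3)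
        surfaceS2).symm MeasurableEquiv.prodAssoc)
  exact (he.comp hskew).comp he'

lemma measurePreserving_collisionSwap :
    MeasurePreserving (fun z : R3 × R3 × S2 => (z.2.1, z.1, z.2.2))
      collisionMeasure collisionMeasure := by
  have h1 := (Measure.measurePreserving_swap (μ := (volume : Measure R3))
    (ν := (volume : Measure R3))).prod (MeasurePreserving.id surfaceS2)
  have ha := measurePreserving_prodAssoc (volume : Measure R3) (volume : Measure R3) surfaceS2
  exact (ha.comp h1).comp (ha.symm MeasurableEquiv.prodAssoc)

/-- Almost everywhere statements about `v` hold for the velocities `v_*`, `v'` and `v_*'` as well. -/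
lemma ae_ae_collision {P : R3 → Prop} (h : ∀ᵐ v ∂(volume : Measure R3), P v) :
    ∀ᵐ v ∂(volume : Measure R3), P v ∧
      ∀ᵐ p : R3 × S2 ∂((volume : Measure R3).prod surfaceS2),
        P p.1 ∧ P (velPrime v p.1 p.2) ∧ P (velStarPrime v p.1 p.2) := by
  have h1 : ∀ᵐ z ∂collisionMeasure, P z.1 := Measure.quasiMeasurePreserving_fst.ae h
  have h2 : ∀ᵐ z ∂collisionMeasure, P z.2.1 :=
    measurePreserving_collisionSwap.quasiMeasurePreserving.ae h1
  have h3 : ∀ᵐ z ∂collisionMeasure, P (velPrime z.1 z.2.1 z.2.2) :=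
    measurePreserving_collisionMap.quasiMeasurePreserving.ae h1
  have h4 : ∀ᵐ z ∂collisionMeasure, P (velStarPrime z.1 z.2.1 z.2.2) :=
    measurePreserving_collisionMap.quasiMeasurePreserving.ae h2
  have h5 : ∀ᵐ z ∂collisionMeasure, P z.2.1 ∧ P (velPrime z.1 z.2.1 z.2.2) ∧
      P (velStarPrime z.1 z.2.1 z.2.2) := h2.and (h3.and h4)
  exact h.and (Measure.ae_ae_of_ae_prod h5)

/-- Almost everywhere statements about `v` that depend on a parameter hold for `v_*`, `v'` and `v_*'`
as well. -/
lemma ae_ae_collision_prod {α : Type*} [MeasurableSpace α] {μ : Measure α} [SFinite μ]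
    {P : α × R3 → Prop} (h : ∀ᵐ q ∂μ.prod (volume : Measure R3), P q) :
    ∀ᵐ q ∂μ.prod (volume : Measure R3), P q ∧
      ∀ᵐ p : R3 × S2 ∂((volume : Measure R3).prod surfaceS2),
        P (q.1, p.1) ∧ P (q.1, velPrime q.2 p.1 p.2) ∧ P (q.1, velStarPrime q.2 p.1 p.2) := by
  have hassoc := (measurePreserving_prodAssoc μ (volume : Measure R3)
    ((volume : Measure R3).prod surfaceS2))
  have hassoc' := hassoc.symm MeasurableEquiv.prodAssoc
  have h1 : ∀ᵐ z ∂μ.prod collisionMeasure, P (z.1, z.2.1) :=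
    hassoc'.quasiMeasurePreserving.ae (Measure.quasiMeasurePreserving_fst.ae h)
  have h2 : ∀ᵐ z ∂μ.prod collisionMeasure, P (z.1, z.2.2.1) :=
    ((MeasurePreserving.id μ).prod measurePreserving_collisionSwap).quasiMeasurePreserving.ae h1
  have hC := ((MeasurePreserving.id μ).prod measurePreserving_collisionMap).quasiMeasurePreserving
  have h3 : ∀ᵐ z ∂μ.prod collisionMeasure, P (z.1, velPrime z.2.1 z.2.2.1 z.2.2.2) := hC.ae h1
  have h4 : ∀ᵐ z ∂μ.prod collisionMeasure, P (z.1, velStarPrime z.2.1 z.2.2.1 z.2.2.2) :=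
    hC.ae h2
  exact h.and (Measure.ae_ae_of_ae_prod (hassoc.quasiMeasurePreserving.ae (h2.and (h3.and h4))))

/-! ### Gain and loss terms -/

/-- `∫∫ β(v - v_*, σ) X(v, v_*, σ) dv_* dσ`. -/
def collisionOp (β : R3 → S2 → ℝ) (X : R3 × R3 × S2 → ℝ≥0∞) (v : R3) : ℝ≥0∞ :=
  ∫⁻ p : R3 × S2, ENNReal.ofReal (β (v - p.1) p.2) * X (v, p)
    ∂((volume : Measure R3).prod surfaceS2)

/-- The norm of the kernel in `L¹(ℝ³ × S²)`. -/
def kernelNorm (β : R3 → S2 → ℝ) : ℝ≥0∞ :=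
  ∫⁻ p : R3 × S2, ENNReal.ofReal (β p.1 p.2) ∂((volume : Measure R3).prod surfaceS2)

variable {β : R3 → S2 → ℝ}

lemma IsSymmetricKernel.kernelNorm_lt_top (hβ : IsSymmetricKernel β) : kernelNorm β < ⊤ :=
  hβ.integrable.lintegral_lt_top

lemma measurePreserving_relativeVel (v : R3) :
    MeasurePreserving (fun p : R3 × S2 => (v - p.1, p.2))
      ((volume : Measure R3).prod surfaceS2) ((volume : Measure R3).prod surfaceS2) :=
  ((volume : Measure R3).measurePreserving_sub_left v).prod (MeasurePreserving.id surfaceS2)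

lemma IsSymmetricKernel.lintegral_relative (hβ : IsSymmetricKernel β) (v : R3) :
    ∫⁻ p : R3 × S2, ENNReal.ofReal (β (v - p.1) p.2) ∂((volume : Measure R3).prod surfaceS2) =
      kernelNorm β :=
  (measurePreserving_relativeVel v).lintegral_comp hβ.measurable.ennreal_ofReal

lemma collisionOp_le (hβ : IsSymmetricKernel β) {X : R3 × R3 × S2 → ℝ≥0∞} {v : R3} {c : ℝ≥0∞}
    (h : ∀ᵐ p ∂((volume : Measure R3).prod surfaceS2), X (v, p) ≤ c) :
    collisionOp β X v ≤ kernelNorm β * c := by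
  have hm : Measurable fun p : R3 × S2 => ENNReal.ofReal (β (v - p.1) p.2) :=
    (hβ.measurable.comp (measurePreserving_relativeVel v).measurable).ennreal_ofReal
  rw [← hβ.lintegral_relative v, ← lintegral_mul_const _ hm]
  refine lintegral_mono_ae ?_
  filter_upwards [h] with p hp
  gcongr

lemma collisionOp_mono {X Y : R3 × R3 × S2 → ℝ≥0∞} {v : R3}
    (h : ∀ᵐ p ∂((volume : Measure R3).prod surfaceS2), X (v, p) ≤ Y (v, p)) :
    collisionOp β X v ≤ collisionOp β Y v := by
  refine lintegral_mono_ae ?_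
  filter_upwards [h] with p hp
  gcongr

lemma measurable_relative (hβ : IsSymmetricKernel β) :
    Measurable fun z : R3 × R3 × S2 => ENNReal.ofReal (β (z.1 - z.2.1) z.2.2) := by
  have : Measurable fun z : R3 × R3 × S2 => (z.1 - z.2.1, z.2.2) :=
    (measurable_fst.sub measurable_snd.fst).prodMk measurable_snd.snd
  exact (hβ.measurable.comp this).ennreal_ofReal

lemma lintegral_mul_collisionOp (hβ : IsSymmetricKernel β) {m : R3 → ℝ≥0∞} (hm : Measurable m)
    {X : R3 × R3 × S2 → ℝ≥0∞} (hX : Measurable X) :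
    ∫⁻ v, m v * collisionOp β X v =
      ∫⁻ z, m z.1 * (ENNReal.ofReal (β (z.1 - z.2.1) z.2.2) * X z) ∂collisionMeasure := by
  have hmeas : Measurable fun z : R3 × R3 × S2 =>
      ENNReal.ofReal (β (z.1 - z.2.1) z.2.2) * X z := (measurable_relative hβ).mul hX
  have hF : Measurable fun z : R3 × R3 × S2 =>
      m z.1 * (ENNReal.ofReal (β (z.1 - z.2.1) z.2.2) * X z) := (hm.comp measurable_fst).mul hmeas
  rw [collisionMeasure, lintegral_prod _ hF.aemeasurable]
  refine lintegral_congr fun v => ?_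
  have hv : Measurable fun p : R3 × S2 => ENNReal.ofReal (β (v - p.1) p.2) * X (v, p) :=
    hmeas.comp measurable_prodMk_left
  exact (lintegral_const_mul _ hv).symm

/-- The weak form of the collision operator: a function `m` with `m' + m_*' = m + m_*` does not
distinguish between a symmetric `X` evaluated before and after the collision. -/
lemma lintegral_mul_collisionOp_comp (hβ : IsSymmetricKernel β) {m : R3 → ℝ≥0∞}
    (hm : Measurable m)
    (hinv : ∀ v vs σ, m (velPrime v vs σ) + m (velStarPrime v vs σ) = m v + m vs)
    {X : R3 × R3 × S2 → ℝ≥0∞} (hX : Measurable X)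
    (hsymm : ∀ v vs σ, X (vs, v, σ) = X (v, vs, σ)) :
    ∫⁻ v, m v * collisionOp β (fun z => X (collisionMap z)) v =
      ∫⁻ v, m v * collisionOp β X v := by
  have hC := continuous_collisionMap.measurable
  have hXC : Measurable fun z => X (collisionMap z) := hX.comp hC
  rw [lintegral_mul_collisionOp hβ hm hXC, lintegral_mul_collisionOp hβ hm hX]
  set W : R3 × R3 × S2 → ℝ≥0∞ := fun z => ENNReal.ofReal (β (z.1 - z.2.1) z.2.2) * X z with hW
  have hWm : Measurable W := (measurable_relative hβ).mul hX
  have hWs : ∀ v vs σ, W (vs, v, σ) = W (v, vs, σ) := fun v vs σ => by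
    simp only [hW, hsymm]
    rw [← neg_sub v vs, hβ.neg]
  have hmp : Measurable fun z : R3 × R3 × S2 => m (velPrime z.1 z.2.1 z.2.2) :=
    hm.comp hC.fst
  have hpW : Measurable fun z : R3 × R3 × S2 => m (velPrime z.1 z.2.1 z.2.2) * W z := hmp.mul hWm
  have hmW : Measurable fun z : R3 × R3 × S2 => m z.1 * W z := (hm.comp measurable_fst).mul hWm
  -- change of variables to the pre-collisional velocities
  have h1 : ∫⁻ z, m z.1 * (ENNReal.ofReal (β (z.1 - z.2.1) z.2.2) * X (collisionMap z))
      ∂collisionMeasure = ∫⁻ z, m (velPrime z.1 z.2.1 z.2.2) * W z ∂collisionMeasure := by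
    rw [← measurePreserving_collisionMap.lintegral_comp hpW]
    refine lintegral_congr fun z => ?_
    simp only [hW, collisionMap, velPrime_prime, velPrime_sub_velStarPrime, hβ.reflect]
  have h2 : ∫⁻ z, m (velPrime z.1 z.2.1 z.2.2) * W z ∂collisionMeasure =
      ∫⁻ z, m (velStarPrime z.1 z.2.1 z.2.2) * W z ∂collisionMeasure := by
    rw [← measurePreserving_collisionSwap.lintegral_comp hpW]
    refine lintegral_congr fun z => ?_
    dsimp only
    rw [velPrime_swap, hWs z.1 z.2.1 z.2.2]
  have h3 : ∫⁻ z, m z.1 * W z ∂collisionMeasure = ∫⁻ z, m z.2.1 * W z ∂collisionMeasure := by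
    rw [← measurePreserving_collisionSwap.lintegral_comp hmW]
    refine lintegral_congr fun z => ?_
    dsimp only
    rw [hWs z.1 z.2.1 z.2.2]
  rw [h1]
  have key : 2 * ∫⁻ z, m (velPrime z.1 z.2.1 z.2.2) * W z ∂collisionMeasure =
      2 * ∫⁻ z, m z.1 * W z ∂collisionMeasure := by
    rw [two_mul, two_mul]
    nth_rewrite 2 [h2]
    nth_rewrite 2 [h3]
    rw [← lintegral_add_left hpW,
      ← lintegral_add_left hmW]
    refine lintegral_congr fun z => ?_
    rw [← add_mul, ← add_mul, hinv]
  exact (ENNReal.mul_right_inj two_ne_zero ENNReal.ofNat_ne_top).1 key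

end

section

variable {β : R3 → S2 → ℝ}

/-! ### Gain, loss and pair operators -/

/-- The loss integrand `F F_* (1 - F') (1 - F_*')`.  Distribution functions take values in
`[0, 1] ⊆ ℝ≥0∞`, where the truncated subtraction is the true one. -/
def lossIntegrand (F : R3 → ℝ≥0∞) (z : R3 × R3 × S2) : ℝ≥0∞ :=
  F z.1 * F z.2.1 * (1 - F (velPrime z.1 z.2.1 z.2.2)) * (1 - F (velStarPrime z.1 z.2.1 z.2.2))

/-- The pair product `F F_*`. -/
def pairIntegrand (F : R3 → ℝ≥0∞) (z : R3 × R3 × S2) : ℝ≥0∞ := F z.1 * F z.2.1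

/-- The loss term of the collision integral of a function on phase space. -/
def lossOp (β : R3 → S2 → ℝ) (F : R3 × R3 → ℝ≥0∞) (p : R3 × R3) : ℝ≥0∞ :=
  collisionOp β (lossIntegrand fun w => F (p.1, w)) p.2

/-- The gain term of the collision integral of a function on phase space. -/
def gainOp (β : R3 → S2 → ℝ) (F : R3 × R3 → ℝ≥0∞) (p : R3 × R3) : ℝ≥0∞ :=
  collisionOp β (fun z => lossIntegrand (fun w => F (p.1, w)) (collisionMap z)) p.2

/-- The gain term without the exclusion factors: `∫∫ β F' F_*' dv_* dσ`. -/
def pairOp (β : R3 → S2 → ℝ) (F : R3 × R3 → ℝ≥0∞) (p : R3 × R3) : ℝ≥0∞ :=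
  collisionOp β (fun z => pairIntegrand (fun w => F (p.1, w)) (collisionMap z)) p.2

lemma lossIntegrand_le_pair (F : R3 → ℝ≥0∞) (z : R3 × R3 × S2) :
    lossIntegrand F z ≤ pairIntegrand F z := by
  rw [lossIntegrand, pairIntegrand, mul_assoc]
  exact mul_le_of_le_one_right' (mul_le_one' tsub_le_self tsub_le_self)

lemma pairIntegrand_le {F : R3 → ℝ≥0∞} (hF : ∀ w, F w ≤ 1) (z : R3 × R3 × S2) :
    pairIntegrand F z ≤ F z.1 :=
  mul_le_of_le_one_right' (hF _)

lemma gainOp_le_pairOp (F : R3 × R3 → ℝ≥0∞) (p : R3 × R3) : gainOp β F p ≤ pairOp β F p :=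
  collisionOp_mono (ae_of_all _ fun _ => lossIntegrand_le_pair _ _)

lemma pairOp_le (hβ : IsSymmetricKernel β) {F : R3 × R3 → ℝ≥0∞} (hF : ∀ p, F p ≤ 1)
    (p : R3 × R3) : pairOp β F p ≤ kernelNorm β := by
  refine (collisionOp_le hβ (c := 1) (ae_of_all _ fun z => ?_)).trans_eq (mul_one _)
  exact (pairIntegrand_le (fun w => hF _) _).trans (hF _)

lemma gainOp_le (hβ : IsSymmetricKernel β) {F : R3 × R3 → ℝ≥0∞} (hF : ∀ p, F p ≤ 1)
    (p : R3 × R3) : gainOp β F p ≤ kernelNorm β :=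
  (gainOp_le_pairOp F p).trans (pairOp_le hβ hF p)

lemma lossOp_le_mul (hβ : IsSymmetricKernel β) {F : R3 × R3 → ℝ≥0∞} (hF : ∀ p, F p ≤ 1)
    (p : R3 × R3) : lossOp β F p ≤ kernelNorm β * F p :=
  collisionOp_le hβ (ae_of_all _ fun _ =>
    (lossIntegrand_le_pair _ _).trans (pairIntegrand_le (fun _ => hF _) _))

lemma lossOp_le (hβ : IsSymmetricKernel β) {F : R3 × R3 → ℝ≥0∞} (hF : ∀ p, F p ≤ 1)
    (p : R3 × R3) : lossOp β F p ≤ kernelNorm β :=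
  (lossOp_le_mul hβ hF p).trans (mul_le_of_le_one_right' (hF p))

/-- The pair operator is Lipschitz, and one-sidedly monotone, on functions with values in
`[0, 1]`. -/
lemma pairOp_le_add (hβ : IsSymmetricKernel β) {F G : R3 × R3 → ℝ≥0∞} (hF : ∀ p, F p ≤ 1)
    (hG : ∀ p, G p ≤ 1) {ε : ℝ≥0∞} {x : R3}
    (h : ∀ᵐ w ∂(volume : Measure R3), F (x, w) ≤ G (x, w) + ε) :
    ∀ᵐ v ∂(volume : Measure R3), pairOp β F (x, v) ≤ pairOp β G (x, v) +
      2 * kernelNorm β * ε := by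
  filter_upwards [ae_ae_collision h] with v hv
  have hm : Measurable fun p : R3 × S2 => ENNReal.ofReal (β (v - p.1) p.2) :=
    (hβ.measurable.comp (measurePreserving_relativeVel v).measurable).ennreal_ofReal
  have h2 : 2 * kernelNorm β * ε = ∫⁻ p : R3 × S2, ENNReal.ofReal (β (v - p.1) p.2) * (2 * ε)
      ∂((volume : Measure R3).prod surfaceS2) := by
    rw [lintegral_mul_const _ hm, hβ.lintegral_relative]; ring
  rw [h2, pairOp, pairOp, collisionOp, collisionOp, ← lintegral_add_right _ (hm.mul_const _)]
  refine lintegral_mono_ae ?_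
  filter_upwards [hv.2] with p hp
  rw [← mul_add]
  gcongr
  simp only [pairIntegrand, collisionMap]
  calc F (x, velPrime v p.1 p.2) * F (x, velStarPrime v p.1 p.2)
      ≤ F (x, velPrime v p.1 p.2) * (G (x, velStarPrime v p.1 p.2) + ε) := by
        gcongr; exact hp.2.2
    _ ≤ F (x, velPrime v p.1 p.2) * G (x, velStarPrime v p.1 p.2) + ε := by
        rw [mul_add]; gcongr; exact mul_le_of_le_one_left' (hF _)
    _ ≤ (G (x, velPrime v p.1 p.2) + ε) * G (x, velStarPrime v p.1 p.2) + ε := by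
        gcongr; exact hp.2.1
    _ ≤ G (x, velPrime v p.1 p.2) * G (x, velStarPrime v p.1 p.2) + ε + ε := by
        rw [add_mul]; gcongr; exact mul_le_of_le_one_right' (hG _)
    _ = _ := by rw [two_mul, add_assoc]

/-! ### Measurability -/

lemma measurable_collisionOp {α : Type*} [MeasurableSpace α] (hβ : IsSymmetricKernel β)
    {X : α → R3 × R3 × S2 → ℝ≥0∞} (hX : Measurable (Function.uncurry X)) :
    Measurable fun q : α × R3 => collisionOp β (X q.1) q.2 := by
  have h : Measurable fun z : (α × R3) × R3 × S2 =>
      ENNReal.ofReal (β (z.1.2 - z.2.1) z.2.2) * X z.1.1 (z.1.2, z.2) := by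
    have h1 : Measurable fun z : (α × R3) × R3 × S2 => (z.1.2, z.2) :=
      measurable_fst.snd.prodMk measurable_snd
    have h2 : Measurable fun z : (α × R3) × R3 × S2 => (z.1.1, (z.1.2, z.2)) :=
      measurable_fst.fst.prodMk h1
    exact ((measurable_relative hβ).comp h1).mul (hX.comp h2)
  exact h.lintegral_prod_right'

lemma measurable_lossIntegrand {α : Type*} [MeasurableSpace α] {F : α → R3 → ℝ≥0∞}
    (hF : Measurable (Function.uncurry F)) :
    Measurable (Function.uncurry fun a z => lossIntegrand (F a) z) := by
  have hC := continuous_collisionMap.measurable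
  have h1 : Measurable fun q : α × R3 × R3 × S2 => F q.1 q.2.1 :=
    hF.comp (measurable_fst.prodMk measurable_snd.fst)
  have h2 : Measurable fun q : α × R3 × R3 × S2 => F q.1 q.2.2.1 :=
    hF.comp (measurable_fst.prodMk measurable_snd.snd.fst)
  have h3 : Measurable fun q : α × R3 × R3 × S2 => F q.1 (velPrime q.2.1 q.2.2.1 q.2.2.2) :=
    hF.comp (measurable_fst.prodMk (hC.comp measurable_snd).fst)
  have h4 : Measurable fun q : α × R3 × R3 × S2 => F q.1 (velStarPrime q.2.1 q.2.2.1 q.2.2.2) :=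
    hF.comp (measurable_fst.prodMk (hC.comp measurable_snd).snd.fst)
  exact ((h1.mul h2).mul (h3.const_sub 1)).mul (h4.const_sub 1)

lemma measurable_pairIntegrand {α : Type*} [MeasurableSpace α] {F : α → R3 → ℝ≥0∞}
    (hF : Measurable (Function.uncurry F)) :
    Measurable (Function.uncurry fun a z => pairIntegrand (F a) z) := by
  have h1 : Measurable fun q : α × R3 × R3 × S2 => F q.1 q.2.1 :=
    hF.comp (measurable_fst.prodMk measurable_snd.fst)
  have h2 : Measurable fun q : α × R3 × R3 × S2 => F q.1 q.2.2.1 :=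
    hF.comp (measurable_fst.prodMk measurable_snd.snd.fst)
  exact h1.mul h2

section
variable {F : ℝ → R3 × R3 → ℝ≥0∞}

lemma measurable_slice (hF : Measurable (Function.uncurry F)) :
    Measurable (Function.uncurry fun (a : ℝ × R3) (w : R3) => F a.1 (a.2, w)) :=
  hF.comp (measurable_fst.fst.prodMk (measurable_fst.snd.prodMk measurable_snd))

lemma measurable_assoc {α : Type*} [MeasurableSpace α] {H : ℝ → R3 × R3 → α}
    (h : Measurable fun q : (ℝ × R3) × R3 => H q.1.1 (q.1.2, q.2)) :
    Measurable (Function.uncurry H) :=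
  h.comp ((measurable_fst.prodMk measurable_snd.fst).prodMk measurable_snd.snd)

lemma measurable_lossOp (hβ : IsSymmetricKernel β) (hF : Measurable (Function.uncurry F)) :
    Measurable (Function.uncurry fun t p => lossOp β (F t) p) :=
  measurable_assoc (measurable_collisionOp hβ (measurable_lossIntegrand (measurable_slice hF)))

lemma measurable_gainOp (hβ : IsSymmetricKernel β) (hF : Measurable (Function.uncurry F)) :
    Measurable (Function.uncurry fun t p => gainOp β (F t) p) :=
  measurable_assoc (measurable_collisionOp hβ
    (X := fun (a : ℝ × R3) z => lossIntegrand (fun w => F a.1 (a.2, w)) (collisionMap z))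
    ((measurable_lossIntegrand (measurable_slice hF)).comp
      (measurable_fst.prodMk (continuous_collisionMap.measurable.comp measurable_snd))))

lemma measurable_pairOp (hβ : IsSymmetricKernel β) (hF : Measurable (Function.uncurry F)) :
    Measurable (Function.uncurry fun t p => pairOp β (F t) p) :=
  measurable_assoc (measurable_collisionOp hβ
    (X := fun (a : ℝ × R3) z => pairIntegrand (fun w => F a.1 (a.2, w)) (collisionMap z))
    ((measurable_pairIntegrand (measurable_slice hF)).comp
      (measurable_fst.prodMk (continuous_collisionMap.measurable.comp measurable_snd))))

end

/-! ### Collision invariants -/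

/-- A measurable collision invariant with values in `[0, ∞)` which depends only on the speed, so that
it is preserved by specular reflection as well. -/
structure IsCollisionInvariant (m : R3 → ℝ≥0∞) : Prop where
  measurable : Measurable m
  add_eq : ∀ v vs σ, m (velPrime v vs σ) + m (velStarPrime v vs σ) = m v + m vs
  ne_top : ∀ v, m v ≠ ⊤
  norm_eq : ∀ v w, ‖v‖ = ‖w‖ → m v = m w

lemma isCollisionInvariant_one : IsCollisionInvariant 1 :=
  ⟨measurable_one, fun _ _ _ => rfl, fun _ => ENNReal.one_ne_top, fun _ _ _ => rfl⟩

lemma isCollisionInvariant_energy : IsCollisionInvariant fun v => ENNReal.ofReal (‖v‖ ^ 2) where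
  measurable := by fun_prop
  add_eq v vs σ := by
    rw [← ENNReal.ofReal_add (by positivity) (by positivity), norm_sq_prime_add,
      ENNReal.ofReal_add (by positivity) (by positivity)]
  ne_top _ := ENNReal.ofReal_ne_top
  norm_eq v w h := by rw [h]

lemma lossIntegrand_symm (F : R3 → ℝ≥0∞) (v vs : R3) (σ : S2) :
    lossIntegrand F (vs, v, σ) = lossIntegrand F (v, vs, σ) := by
  rw [lossIntegrand, lossIntegrand]
  dsimp only
  rw [velPrime_swap v vs, velStarPrime_swap v vs]; ring

lemma pairIntegrand_symm (F : R3 → ℝ≥0∞) (v vs : R3) (σ : S2) :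
    pairIntegrand F (vs, v, σ) = pairIntegrand F (v, vs, σ) := mul_comm _ _

lemma phaseMeasure_eq_prod (Ω : Set R3) :
    phaseMeasure Ω = (volume.restrict Ω).prod (volume : Measure R3) := by
  rw [phaseMeasure, Measure.volume_eq_prod, ← Measure.prod_restrict, Measure.restrict_univ]

section
variable {m : R3 → ℝ≥0∞} {F : R3 × R3 → ℝ≥0∞} {Ω : Set R3}

lemma measurable_const_time (hF : Measurable F) :
    Measurable (Function.uncurry fun (_ : ℝ) p => F p) := hF.comp measurable_snd

lemma IsCollisionInvariant.measurable_mul (hm : IsCollisionInvariant m) {H : R3 × R3 → ℝ≥0∞}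
    (hH : Measurable H) : Measurable fun p : R3 × R3 => m p.2 * H p :=
  (hm.measurable.comp measurable_snd).mul hH

lemma lintegral_phase {H : R3 × R3 → ℝ≥0∞} (hH : Measurable H) :
    ∫⁻ p, H p ∂phaseMeasure Ω = ∫⁻ x in Ω, ∫⁻ v, H (x, v) := by
  rw [phaseMeasure_eq_prod, lintegral_prod _ hH.aemeasurable]

/-- Gain and loss have the same integral against a collision invariant: the weak form of
`∫ m Q(f) dv = 0`. -/
lemma lintegral_mul_gainOp (hβ : IsSymmetricKernel β) (hm : IsCollisionInvariant m)
    (hF : Measurable F) :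
    ∫⁻ p, m p.2 * gainOp β F p ∂phaseMeasure Ω = ∫⁻ p, m p.2 * lossOp β F p ∂phaseMeasure Ω := by
  have h1 : Measurable (gainOp β F) :=
    (measurable_gainOp hβ (measurable_const_time hF)).comp (measurable_prodMk_left (x := 0))
  have h2 : Measurable (lossOp β F) :=
    (measurable_lossOp hβ (measurable_const_time hF)).comp (measurable_prodMk_left (x := 0))
  rw [lintegral_phase (hm.measurable_mul h1), lintegral_phase (hm.measurable_mul h2)]
  refine lintegral_congr fun x => ?_
  have hX : Measurable (lossIntegrand fun w => F (x, w)) :=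
    (measurable_lossIntegrand (F := fun (_ : ℝ) w => F (x, w))
      ((hF.comp measurable_prodMk_left).comp measurable_snd)).comp (measurable_prodMk_left (x := 0))
  exact lintegral_mul_collisionOp_comp hβ hm.measurable hm.add_eq hX (lossIntegrand_symm _)

lemma lintegral_mul_lossOp_le (hβ : IsSymmetricKernel β) (hm : IsCollisionInvariant m)
    (hF : Measurable F) (hF1 : ∀ p, F p ≤ 1) :
    ∫⁻ p, m p.2 * lossOp β F p ∂phaseMeasure Ω ≤
      kernelNorm β * ∫⁻ p, m p.2 * F p ∂phaseMeasure Ω := by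
  rw [← lintegral_const_mul _ (hm.measurable_mul hF)]
  refine lintegral_mono fun p => ?_
  calc m p.2 * lossOp β F p ≤ m p.2 * (kernelNorm β * F p) := by
        gcongr; exact lossOp_le_mul hβ hF1 p
    _ = _ := by ring

/-- The pair operator obeys the same bound as the loss term, since its integral against `m` is that
of `m F F_*` before the collision. -/
lemma lintegral_mul_pairOp_le (hβ : IsSymmetricKernel β) (hm : IsCollisionInvariant m)
    (hF : Measurable F) (hF1 : ∀ p, F p ≤ 1) :
    ∫⁻ p, m p.2 * pairOp β F p ∂phaseMeasure Ω ≤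
      kernelNorm β * ∫⁻ p, m p.2 * F p ∂phaseMeasure Ω := by
  have h1 : Measurable (pairOp β F) :=
    (measurable_pairOp hβ (measurable_const_time hF)).comp (measurable_prodMk_left (x := 0))
  rw [← lintegral_const_mul _ (hm.measurable_mul hF), lintegral_phase (hm.measurable_mul h1),
    lintegral_phase ((hm.measurable_mul hF).const_mul _)]
  refine lintegral_mono fun x => ?_
  have hX : Measurable (pairIntegrand fun w => F (x, w)) :=
    (measurable_pairIntegrand (F := fun (_ : ℝ) w => F (x, w))
      ((hF.comp measurable_prodMk_left).comp measurable_snd)).comp (measurable_prodMk_left (x := 0))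
  refine (lintegral_mul_collisionOp_comp hβ hm.measurable hm.add_eq hX
    (pairIntegrand_symm _)).trans_le (lintegral_mono fun v => ?_)
  calc m v * collisionOp β (pairIntegrand fun w => F (x, w)) v
      ≤ m v * (kernelNorm β * F (x, v)) := by
        gcongr
        exact collisionOp_le hβ (ae_of_all _ fun _ => pairIntegrand_le (fun w => hF1 _) _)
    _ = _ := by dsimp only; ring

end

/-! ### The collision integral as gain minus loss -/

lemma toReal_lossIntegrand {F : R3 → ℝ≥0∞} (hF : ∀ w, F w ≤ 1) (z : R3 × R3 × S2) :
    (lossIntegrand F z).toReal = (F z.1).toReal * (F z.2.1).toReal *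
      (1 - (F (velPrime z.1 z.2.1 z.2.2)).toReal) *
      (1 - (F (velStarPrime z.1 z.2.1 z.2.2)).toReal) := by
  simp only [lossIntegrand, ENNReal.toReal_mul]
  rw [ENNReal.toReal_sub_of_le (hF _) ENNReal.one_ne_top,
    ENNReal.toReal_sub_of_le (hF _) ENNReal.one_ne_top, ENNReal.toReal_one]

/-- Translation of `collisionOp` into Bochner integrals. -/
lemma collisionOp_toReal (hβ : IsSymmetricKernel β) {X : R3 × R3 × S2 → ℝ≥0∞}
    (hX : Measurable X) (hX1 : ∀ z, X z ≤ 1) (v : R3) :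
    Integrable (fun p : R3 × S2 => β (v - p.1) p.2 * (X (v, p)).toReal)
      ((volume : Measure R3).prod surfaceS2) ∧
    ∫ p : R3 × S2, β (v - p.1) p.2 * (X (v, p)).toReal ∂((volume : Measure R3).prod surfaceS2) =
      (collisionOp β X v).toReal := by
  have hm : Measurable fun p : R3 × S2 => ENNReal.ofReal (β (v - p.1) p.2) * X (v, p) :=
    ((measurable_relative hβ).mul hX).comp measurable_prodMk_left
  have hfin : collisionOp β X v ≠ ⊤ := by
    refine ne_top_of_le_ne_top hβ.kernelNorm_lt_top.ne
      ((collisionOp_le hβ (c := 1) (ae_of_all _ fun _ => hX1 _)).trans_eq (mul_one _))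
  have he : ∀ p : R3 × S2, (ENNReal.ofReal (β (v - p.1) p.2) * X (v, p)).toReal =
      β (v - p.1) p.2 * (X (v, p)).toReal := fun p => by
    rw [ENNReal.toReal_mul, ENNReal.toReal_ofReal (hβ.nonneg _ _)]
  have hi := integrable_toReal_of_lintegral_ne_top hm.aemeasurable hfin
  refine ⟨hi.congr (ae_of_all _ he), ?_⟩
  rw [← integral_congr_ae (ae_of_all _ he), integral_toReal hm.aemeasurable]
  · rfl
  · refine ae_of_all _ fun p => ENNReal.mul_lt_top ENNReal.ofReal_lt_top
      ((hX1 _).trans_lt ENNReal.one_lt_top)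

/-- The collision integral of `g` depends only on the almost everywhere class of `g`, and is the
difference of the gain and loss terms. -/
lemma collisionIntegral_eq (hβ : IsSymmetricKernel β) {b : R3 → S2 → ℝ}
    (hb : ∀ᵐ p : R3 × S2 ∂((volume : Measure R3).prod surfaceS2), b p.1 p.2 = β p.1 p.2)
    {F : R3 × R3 → ℝ≥0∞} (hF : Measurable F) (hF1 : ∀ p, F p ≤ 1) {x v : R3} {g : R3 → ℝ}
    (hv : g v = (F (x, v)).toReal ∧ ∀ᵐ p : R3 × S2 ∂((volume : Measure R3).prod surfaceS2),
      g p.1 = (F (x, p.1)).toReal ∧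
      g (velPrime v p.1 p.2) = (F (x, velPrime v p.1 p.2)).toReal ∧
      g (velStarPrime v p.1 p.2) = (F (x, velStarPrime v p.1 p.2)).toReal) :
    collisionIntegral b g v =
      (gainOp β F (x, v)).toReal - (lossOp β F (x, v)).toReal := by
  set G : R3 → ℝ≥0∞ := fun w => F (x, w)
  have hG1 : ∀ w, G w ≤ 1 := fun w => hF1 _
  have hX : Measurable (lossIntegrand G) :=
    (measurable_lossIntegrand (F := fun (_ : ℝ) w => F (x, w))
      ((hF.comp measurable_prodMk_left).comp measurable_snd)).comp (measurable_prodMk_left (x := 0))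
  have hX1 : ∀ z, lossIntegrand G z ≤ 1 := fun z =>
    (lossIntegrand_le_pair G z).trans ((pairIntegrand_le hG1 z).trans (hG1 _))
  obtain ⟨i1, e1⟩ := collisionOp_toReal hβ hX hX1 v
  obtain ⟨i2, e2⟩ := collisionOp_toReal hβ (hX.comp continuous_collisionMap.measurable)
    (fun z => hX1 _) v
  have hgain : gainOp β F (x, v) = collisionOp β (lossIntegrand G ∘ collisionMap) v := rfl
  have hloss : lossOp β F (x, v) = collisionOp β (lossIntegrand G) v := rfl
  rw [hgain, hloss, ← e1, ← e2, ← integral_sub i2 i1, collisionIntegral]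
  have hb' := (measurePreserving_relativeVel v).quasiMeasurePreserving.ae hb
  refine integral_congr_ae ?_
  filter_upwards [hb', hv.2] with p hbp hp
  simp only [Function.comp]
  rw [toReal_lossIntegrand hG1, toReal_lossIntegrand hG1]
  simp only [collisionMap, velPrime_prime, velStarPrime_prime]
  rw [hbp, hv.1, hp.1, hp.2.1, hp.2.2]
  ring

end

section

/-! ### Weak derivatives along a line -/

/-- A smooth step from `0` to `1` on `[s, s + 1 / (j + 1)]`. -/
def smoothStep (s : ℝ) (j : ℕ) (r : ℝ) : ℝ := Real.smoothTransition ((j + 1) * (r - s))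

/-- A smooth approximation of the indicator function of `(s, t]`, supported in
`[s, t + 1 / (j + 1)]`. -/
def smoothWindow (s t : ℝ) (j : ℕ) (r : ℝ) : ℝ := smoothStep s j r - smoothStep t j r

lemma smoothStep_eq_zero {s r : ℝ} (j : ℕ) (h : r ≤ s) : smoothStep s j r = 0 :=
  Real.smoothTransition.zero_of_nonpos
    (mul_nonpos_of_nonneg_of_nonpos (by positivity) (by linarith))

lemma smoothStep_eq_one {s r : ℝ} (j : ℕ) (h : s + 1 / (j + 1) ≤ r) : smoothStep s j r = 1 := by
  refine Real.smoothTransition.one_of_one_le ?_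
  have h1 : (0 : ℝ) < j + 1 := by positivity
  have h2 : 1 / ((j : ℝ) + 1) ≤ r - s := by linarith
  rwa [div_le_iff₀' h1] at h2

lemma contDiff_smoothStep (s : ℝ) (j : ℕ) : ContDiff ℝ ∞ (smoothStep s j) :=
  Real.smoothTransition.contDiff.comp (by fun_prop)

lemma contDiff_smoothWindow (s t : ℝ) (j : ℕ) : ContDiff ℝ ∞ (smoothWindow s t j) :=
  (contDiff_smoothStep s j).sub (contDiff_smoothStep t j)

lemma smoothWindow_eq_zero {s t c : ℝ} (hst : s ≤ t) {j : ℕ} (hc : t + 1 / (j + 1) ≤ c) {r : ℝ}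
    (hr : r ∉ Icc s c) : smoothWindow s t j r = 0 := by
  rw [mem_Icc, not_and_or, not_le, not_le] at hr
  rcases hr with h | h
  · rw [smoothWindow, smoothStep_eq_zero j h.le, smoothStep_eq_zero j (h.le.trans hst), sub_zero]
  · rw [smoothWindow, smoothStep_eq_one j (by linarith), smoothStep_eq_one j (by linarith),
      sub_self]

lemma abs_smoothWindow_le (s t : ℝ) (j : ℕ) (r : ℝ) : |smoothWindow s t j r| ≤ 1 := by
  have h1 := Real.smoothTransition.nonneg ((j + 1) * (r - s))
  have h2 := Real.smoothTransition.nonneg ((j + 1) * (r - t))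
  have h3 := Real.smoothTransition.le_one ((j + 1) * (r - s))
  have h4 := Real.smoothTransition.le_one ((j + 1) * (r - t))
  rw [smoothWindow, smoothStep, smoothStep, abs_le]
  constructor <;> linarith

lemma tendsto_smoothStep (s r : ℝ) :
    Tendsto (fun j => smoothStep s j r) atTop (𝓝 (if s < r then 1 else 0)) := by
  split_ifs with h
  · refine tendsto_const_nhds.congr' ?_
    have h0 : ∀ᶠ j : ℕ in atTop, 1 / ((j : ℝ) + 1) < r - s :=
      tendsto_one_div_add_atTop_nhds_zero_nat.eventually_lt_const (by linarith)
    filter_upwards [h0] with j hj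
    rw [smoothStep_eq_one j (by linarith)]
  · exact tendsto_const_nhds.congr fun j => (smoothStep_eq_zero j (not_lt.1 h)).symm

lemma hasDerivAt_smoothStep (s : ℝ) (j : ℕ) (r : ℝ) :
    HasDerivAt (smoothStep s j)
      ((j + 1) * deriv Real.smoothTransition ((j + 1) * (r - s))) r := by
  have h1 : HasDerivAt (fun r : ℝ => ((j : ℝ) + 1) * (r - s)) (j + 1) r := by
    simpa using ((hasDerivAt_id r).sub_const s).const_mul ((j : ℝ) + 1)
  have h2 : HasDerivAt Real.smoothTransition _ (((j : ℝ) + 1) * (r - s)) :=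
    (((Real.smoothTransition.contDiff (n := 1)).differentiable (by simp)) _).hasDerivAt
  have h3 := h2.comp r h1
  rwa [mul_comm] at h3

lemma deriv_smoothTransition_eq_zero {x : ℝ} (hx : x ∉ Icc (0 : ℝ) 1) :
    deriv Real.smoothTransition x = 0 := by
  rw [mem_Icc, not_and_or, not_le, not_le] at hx
  rcases hx with h | h
  · have : Real.smoothTransition =ᶠ[𝓝 x] fun _ => 0 := by
      filter_upwards [gt_mem_nhds h] with y hy using Real.smoothTransition.zero_of_nonpos hy.le
    rw [this.deriv_eq, deriv_const]
  · have : Real.smoothTransition =ᶠ[𝓝 x] fun _ => 1 := by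
      filter_upwards [lt_mem_nhds h] with y hy using Real.smoothTransition.one_of_one_le hy.le
    rw [this.deriv_eq, deriv_const]

lemma continuous_deriv_smoothTransition : Continuous (deriv Real.smoothTransition) :=
  (Real.smoothTransition.contDiff (n := 1)).continuous_deriv le_rfl

lemma hasCompactSupport_deriv_smoothTransition :
    HasCompactSupport (deriv Real.smoothTransition) :=
  HasCompactSupport.intro isCompact_Icc fun _ => deriv_smoothTransition_eq_zero

lemma integrable_deriv_smoothTransition : Integrable (deriv Real.smoothTransition) :=
  continuous_deriv_smoothTransition.integrable_of_hasCompactSupport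
    hasCompactSupport_deriv_smoothTransition

lemma integral_deriv_smoothTransition : ∫ x, deriv Real.smoothTransition x = 1 := by
  have hd : ∀ x, HasDerivAt Real.smoothTransition (deriv Real.smoothTransition x) x := fun x =>
    (((Real.smoothTransition.contDiff (n := 1)).differentiable (by simp)) _).hasDerivAt
  have h0 : Tendsto Real.smoothTransition atBot (𝓝 0) := by
    refine tendsto_const_nhds.congr' ?_
    filter_upwards [eventually_le_atBot 0] with x hx
    rw [Real.smoothTransition.zero_of_nonpos hx]
  have h1 : Tendsto Real.smoothTransition atTop (𝓝 1) := by
    refine tendsto_const_nhds.congr' ?_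
    filter_upwards [eventually_ge_atTop 1] with x hx
    rw [Real.smoothTransition.one_of_one_le hx]
  rw [integral_of_hasDerivAt_of_tendsto hd integrable_deriv_smoothTransition h0 h1, sub_zero]

lemma deriv_smoothStep (s : ℝ) (j : ℕ) (r : ℝ) : deriv (smoothStep s j) r =
    (j + 1) * deriv Real.smoothTransition ((j + 1) * (r - s)) :=
  (hasDerivAt_smoothStep s j r).deriv

lemma deriv_smoothStep_eq_zero {s r : ℝ} {j : ℕ} (hr : r ∉ Icc s (s + 1 / (j + 1))) :
    deriv (smoothStep s j) r = 0 := by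
  have h1 : (0 : ℝ) < j + 1 := by positivity
  rw [deriv_smoothStep, deriv_smoothTransition_eq_zero, mul_zero]
  contrapose! hr
  have h2 := (mul_nonneg_iff_of_pos_left h1).1 hr.1
  have h3 : r - s ≤ 1 / ((j : ℝ) + 1) := by rw [le_div_iff₀' h1]; exact hr.2
  exact ⟨by linarith, by linarith⟩

lemma tendsto_integral_mul_deriv_smoothStep {G : ℝ → ℝ} (hG : Continuous G) {M : ℝ}
    (hM : ∀ r, |G r| ≤ M) (s : ℝ) :
    Tendsto (fun j => ∫ r, G r * deriv (smoothStep s j) r) atTop (𝓝 (G s)) := by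
  have h1 : ∀ j : ℕ, ∫ r, G r * deriv (smoothStep s j) r =
      ∫ x, G (s + x / (j + 1)) * deriv Real.smoothTransition x := fun j => by
    have hj : (0 : ℝ) < j + 1 := by positivity
    set Φ : ℝ → ℝ := fun x => G (s + x / (j + 1)) * deriv Real.smoothTransition x
    have h2 : ∀ r, G r * deriv (smoothStep s j) r = (j + 1) * Φ ((j + 1) * (r - s)) := fun r => by
      have : s + (j + 1) * (r - s) / ((j : ℝ) + 1) = r := by field_simp; ring
      simp only [Φ, deriv_smoothStep, this]; ring
    simp_rw [h2]
    rw [integral_const_mul, integral_sub_right_eq_self (fun r => Φ ((j + 1) * r)) s,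
      Measure.integral_comp_mul_left, abs_inv, abs_of_pos hj, smul_eq_mul,
      mul_inv_cancel_left₀ hj.ne']
  simp_rw [h1]
  have h3 : G s = ∫ x, G s * deriv Real.smoothTransition x := by
    rw [integral_const_mul, integral_deriv_smoothTransition, mul_one]
  rw [h3]
  refine tendsto_integral_of_dominated_convergence (fun x => M * |deriv Real.smoothTransition x|)
    (fun j => ?_) (integrable_deriv_smoothTransition.abs.const_mul M)
    (fun j => ae_of_all _ fun x => ?_) (ae_of_all _ fun x => ?_)
  · have : Continuous fun x => G (s + x / (j + 1)) * deriv Real.smoothTransition x :=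
      (hG.comp (by fun_prop)).mul continuous_deriv_smoothTransition
    exact this.aestronglyMeasurable
  · rw [Real.norm_eq_abs, abs_mul]; gcongr; exact hM _
  · refine Tendsto.mul_const _ ((hG.tendsto s).comp ?_)
    have := (tendsto_one_div_add_atTop_nhds_zero_nat (𝕜 := ℝ)).const_mul x
    simpa [div_eq_mul_inv] using this.const_add s

/-- If the weak derivative of `k` on `(s, c)`, tested against the smooth windows, is `h`, and `k`
has a continuous version `g`, then `g` is a primitive of `h`. -/
lemma sub_eq_integral_of_smoothWindow {k h g : ℝ → ℝ} {s t c C : ℝ} (hst : s < t) (htc : t < c)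
    (hh : Measurable h) (hC : ∀ r, |h r| ≤ C) (hg : ContinuousOn g (Icc s c))
    (hkg : ∀ᵐ r, r ∈ Icc s c → k r = g r)
    (hw : ∀ j : ℕ, t + 1 / (j + 1) ≤ c →
      ∫ r, (k r * deriv (smoothWindow s t j) r + h r * smoothWindow s t j r) = 0) :
    g t - g s = ∫ r in s..t, h r := by
  have hsc : s ≤ c := (hst.trans htc).le
  set G : ℝ → ℝ := IccExtend hsc ((Icc s c).domRestrict g) with hGdef
  have hGc : Continuous G := hg.domRestrict.Icc_extend'
  have hGg : ∀ r ∈ Icc s c, G r = g r := fun r hr => by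
    rw [hGdef, IccExtend_of_mem hsc _ hr]; rfl
  obtain ⟨M, hM⟩ : ∃ M, ∀ r, |G r| ≤ M := by
    obtain ⟨M, hM⟩ := isCompact_Icc.exists_bound_of_continuousOn hg
    refine ⟨M, fun r => ?_⟩
    exact hM _ (projIcc s c hsc r).2
  have hev : ∀ᶠ j : ℕ in atTop, t + 1 / ((j : ℝ) + 1) ≤ c := by
    have h0 : ∀ᶠ j : ℕ in atTop, 1 / ((j : ℝ) + 1) < c - t :=
      tendsto_one_div_add_atTop_nhds_zero_nat.eventually_lt_const (by linarith)
    filter_upwards [h0] with j hj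
    linarith
  have hint : ∀ u (j : ℕ), Integrable fun r => G r * deriv (smoothStep u j) r := fun u j => by
    have hc : Continuous (deriv (smoothStep u j)) :=
      (contDiff_smoothStep u j).continuous_deriv (by simp)
    refine (hGc.mul hc).integrable_of_hasCompactSupport (HasCompactSupport.intro
      (K := Icc u (u + 1 / (j + 1))) isCompact_Icc fun r hr => ?_)
    change G r * deriv (smoothStep u j) r = 0
    rw [deriv_smoothStep_eq_zero hr, mul_zero]
  have hdw : ∀ (j : ℕ) r, deriv (smoothWindow s t j) r =
      deriv (smoothStep s j) r - deriv (smoothStep t j) r := fun j r =>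
    deriv_sub (hasDerivAt_smoothStep s j r).differentiableAt
      (hasDerivAt_smoothStep t j r).differentiableAt
  have hint2 : ∀ j : ℕ, t + 1 / (j + 1) ≤ c →
      Integrable fun r => h r * smoothWindow s t j r := fun j hj => by
    have : Integrable (smoothWindow s t j) :=
      (contDiff_smoothWindow s t j).continuous.integrable_of_hasCompactSupport
        (HasCompactSupport.intro isCompact_Icc fun r hr => smoothWindow_eq_zero hst.le hj hr)
    exact this.bdd_mul hh.aestronglyMeasurable (ae_of_all _ hC)
  have hid : ∀ j : ℕ, t + 1 / (j + 1) ≤ c →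
      (∫ r, G r * deriv (smoothStep t j) r) - ∫ r, G r * deriv (smoothStep s j) r =
        ∫ r, h r * smoothWindow s t j r := fun j hj => by
    have h1 : ∫ r, (k r * deriv (smoothWindow s t j) r + h r * smoothWindow s t j r) =
        ∫ r, ((G r * deriv (smoothStep s j) r - G r * deriv (smoothStep t j) r) +
          h r * smoothWindow s t j r) := by
      refine integral_congr_ae ?_
      filter_upwards [hkg] with r hr
      by_cases hrc : r ∈ Icc s c
      · rw [hr hrc, hGg r hrc, hdw]; ring
      · have e1 : deriv (smoothStep s j) r = 0 := deriv_smoothStep_eq_zero fun h' =>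
          hrc ⟨h'.1, by linarith [h'.2]⟩
        have e2 : deriv (smoothStep t j) r = 0 := deriv_smoothStep_eq_zero fun h' =>
          hrc ⟨hst.le.trans h'.1, by linarith [h'.2]⟩
        rw [hdw, e1, e2]; ring
    have hi3 : Integrable fun r => G r * deriv (smoothStep s j) r - G r * deriv (smoothStep t j) r :=
      (hint s j).sub (hint t j)
    rw [hw j hj, integral_add hi3 (hint2 j hj),
      integral_sub (hint s j) (hint t j)] at h1
    linarith
  have hlim1 := (tendsto_integral_mul_deriv_smoothStep hGc hM t).sub
    (tendsto_integral_mul_deriv_smoothStep hGc hM s)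
  have hlim2 : Tendsto (fun j => ∫ r, h r * smoothWindow s t j r) atTop
      (𝓝 (∫ r, (Ioc s t).indicator h r)) := by
    refine tendsto_integral_filter_of_dominated_convergence
      ((Icc s c).indicator fun _ => C) (Eventually.of_forall fun j => ?_) ?_ ?_
      (ae_of_all _ fun r => ?_)
    · exact (hh.mul (contDiff_smoothWindow s t j).continuous.measurable).aestronglyMeasurable
    · filter_upwards [hev] with j hj
      refine ae_of_all _ fun r => ?_
      by_cases hrc : r ∈ Icc s c
      · rw [indicator_of_mem hrc, Real.norm_eq_abs, abs_mul]
        calc |h r| * |smoothWindow s t j r| ≤ C * 1 := by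
              gcongr
              · exact (abs_nonneg _).trans (hC r)
              · exact hC r
              · exact abs_smoothWindow_le ..
          _ = C := mul_one C
      · rw [indicator_of_notMem hrc, smoothWindow_eq_zero hst.le hj hrc]; simp
    · exact (integrable_indicator_iff measurableSet_Icc).2
        (integrableOn_const isCompact_Icc.measure_lt_top.ne)
    · have := ((tendsto_smoothStep s r).sub (tendsto_smoothStep t r)).const_mul (h r)
      convert! this using 2
      by_cases h1 : s < r
      · by_cases h2 : t < r
        · rw [indicator_of_notMem fun h' => absurd h2 (not_lt.2 h'.2)]; simp [h1, h2]
        · rw [indicator_of_mem (mem_Ioc.2 ⟨h1, not_lt.1 h2⟩)]; simp [h1, h2]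
      · have h2 : ¬ t < r := fun h' => h1 (hst.trans h')
        rw [indicator_of_notMem fun h' => h1 h'.1]; simp [h1, h2]
  rw [integral_indicator measurableSet_Ioc, ← intervalIntegral.integral_of_le hst.le] at hlim2
  rw [hGg t ⟨hst.le, htc.le⟩, hGg s ⟨le_rfl, hsc⟩] at hlim1
  exact tendsto_nhds_unique (hlim1.congr' (by filter_upwards [hev] with j hj using hid j hj)) hlim2

end

section

variable {Ω : Set R3} {n : R3 → R3}

/-! ### The transport equation along straight lines -/

lemma isOpen_flightSet (hΩ : IsOpen Ω) (s c : ℝ) :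
    IsOpen {q : R3 × R3 | ∀ r ∈ Icc s c, (freeFlight r q).1 ∈ Ω} := by
  rw [isOpen_iff_mem_nhds]
  intro q hq
  refine isCompact_Icc.eventually_forall_of_forall_eventually fun t ht => ?_
  have hc : Continuous fun z : (R3 × R3) × ℝ => (freeFlight z.2 z.1).1 := by
    unfold freeFlight; fun_prop
  exact hc.continuousAt.eventually_mem (hΩ.mem_nhds (hq t ht))

lemma measurePreserving_spaceTimeFlight :
    MeasurePreserving (fun z : ℝ × R3 × R3 => (z.1, freeFlight z.1 z.2)) volume volume := by
  have hm : Measurable (Function.uncurry freeFlight) := by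
    have : Continuous (Function.uncurry freeFlight) := by
      unfold freeFlight Function.uncurry; fun_prop
    exact this.measurable
  exact (MeasurePreserving.id (volume : Measure ℝ)).skew_product hm
    (ae_of_all _ fun t => (measurePreserving_freeFlight t).map_eq)

lemma fderiv_transport {α : ℝ → ℝ} {ψ : R3 × R3 → ℝ} (hα : ContDiff ℝ ∞ α) (hψ : ContDiff ℝ ∞ ψ)
    (z : ℝ × R3 × R3) :
    fderiv ℝ (fun z : ℝ × R3 × R3 => α z.1 * ψ (freeFlight (-z.1) z.2)) z (1, z.2.2, 0) =
      deriv α z.1 * ψ (freeFlight (-z.1) z.2) := by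
  have hφ : ContDiff ℝ ∞ fun z : ℝ × R3 × R3 => α z.1 * ψ (freeFlight (-z.1) z.2) := by
    unfold freeFlight; fun_prop
  rw [← (hφ.differentiable (by simp) z).lineDeriv_eq_fderiv]
  -- the function `ψ (x - t v, v)` is constant along the transport direction `(1, v, 0)`
  have h1 : ∀ r : ℝ, freeFlight (-(z + r • ((1 : ℝ), z.2.2, (0 : R3))).1)
      (z + r • ((1 : ℝ), z.2.2, (0 : R3))).2 = freeFlight (-z.1) z.2 := fun r => by
    ext1
    · simp only [freeFlight, Prod.fst_add, Prod.snd_add, Prod.smul_fst, Prod.smul_snd, smul_eq_mul]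
      module
    · simp [freeFlight]
  have h2 : HasDerivAt (fun r : ℝ => z.1 + r * 1) 1 0 := by
    simpa using (hasDerivAt_id (0 : ℝ)).const_add z.1
  have h3 : HasDerivAt α (deriv α z.1) (z.1 + 0 * 1) := by
    simpa using (hα.differentiable (by simp) z.1).hasDerivAt
  have h4 := (h3.comp 0 h2).mul_const (ψ (freeFlight (-z.1) z.2))
  rw [mul_one] at h4
  rw [← h4.deriv, lineDeriv]
  congr 1
  ext r
  rw [h1]
  simp

/-- Testing the transport equation with `α(t) ψ(x - t v, v)` shows that it holds weakly in time
along almost every straight line. -/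
lemma IsDistribSolution.ae_line {k h : ℝ → R3 × R3 → ℝ} (hΩ : IsOpen Ω)
    (hk : Measurable (Function.uncurry k)) (hh : Measurable (Function.uncurry h)) {C : ℝ}
    (hkC : ∀ t p, |k t p| ≤ C) (hhC : ∀ t p, |h t p| ≤ C) (heq : IsDistribSolution Ω k h)
    {s c : ℝ} (hs : 0 < s) {α : ℝ → ℝ} (hα : ContDiff ℝ ∞ α) (hα0 : ∀ r ∉ Icc s c, α r = 0) :
    ∀ᵐ q : R3 × R3, (∀ r ∈ Icc s c, (freeFlight r q).1 ∈ Ω) →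
      ∫ r, (k r (freeFlight r q) * deriv α r + h r (freeFlight r q) * α r) = 0 := by
  have hαs : HasCompactSupport α := HasCompactSupport.intro isCompact_Icc hα0
  have hαi : Integrable α := hα.continuous.integrable_of_hasCompactSupport hαs
  have hdi : Integrable (deriv α) :=
    (hα.continuous_deriv (by simp)).integrable_of_hasCompactSupport hαs.deriv
  have hfm : Measurable fun z : ℝ × R3 × R3 => (z.1, freeFlight z.1 z.2) :=
    measurePreserving_spaceTimeFlight.measurable
  have hk' : Measurable fun z : ℝ × R3 × R3 => k z.1 (freeFlight z.1 z.2) := hk.comp hfm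
  have hh' : Measurable fun z : ℝ × R3 × R3 => h z.1 (freeFlight z.1 z.2) := hh.comp hfm
  set E : ℝ × R3 × R3 → ℝ := fun z =>
    k z.1 (freeFlight z.1 z.2) * deriv α z.1 + h z.1 (freeFlight z.1 z.2) * α z.1 with hE
  set I : R3 × R3 → ℝ := fun q => ∫ r, E (r, q) with hI
  have hEm : Measurable E :=
    (hk'.mul ((hα.continuous_deriv (by simp)).measurable.comp measurable_fst)).add
      (hh'.mul (hα.continuous.measurable.comp measurable_fst))
  have hIm : StronglyMeasurable I := hEm.stronglyMeasurable.integral_prod_left'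
  have hEb : ∀ z, ‖E z‖ ≤ C * (|deriv α z.1| + |α z.1|) := fun z => by
    rw [Real.norm_eq_abs, mul_add]
    refine (abs_add_le _ _).trans ?_
    rw [abs_mul, abs_mul]
    gcongr
    · exact hkC _ _
    · exact hhC _ _
  have hbi : Integrable fun r => C * (|deriv α r| + |α r|) := (hdi.abs.add hαi.abs).const_mul C
  have hIb : ∀ q, ‖I q‖ ≤ ∫ r, C * (|deriv α r| + |α r|) := fun q =>
    norm_integral_le_of_norm_le hbi (ae_of_all _ fun r => hEb (r, q))
  have hIl : LocallyIntegrable I volume := by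
    refine (locallyIntegrable_const (∫ r, C * (|deriv α r| + |α r|))).mono
      hIm.aestronglyMeasurable (ae_of_all _ fun q => ?_)
    exact (hIb q).trans (le_abs_self _)
  refine (isOpen_flightSet hΩ s c).ae_eq_zero_of_integral_contDiff_smul_eq_zero
    (f := I) (hIl.locallyIntegrableOn _) fun ψ hψ hψs hψU => ?_
  set φ : ℝ × R3 × R3 → ℝ := fun z => α z.1 * ψ (freeFlight (-z.1) z.2) with hφdef
  have hφ : ContDiff ℝ ∞ φ := by
    simp only [hφdef]; unfold freeFlight; fun_prop
  set K : Set (ℝ × R3 × R3) :=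
    (fun z : ℝ × R3 × R3 => (z.1, freeFlight z.1 z.2)) '' (Icc s c ×ˢ tsupport ψ) with hK
  have hKc : IsCompact K := by
    refine (isCompact_Icc.prod hψs).image ?_
    unfold freeFlight; fun_prop
  have hφK : ∀ z ∉ K, φ z = 0 := fun z hz => by
    by_contra hne
    refine hz ⟨(z.1, freeFlight (-z.1) z.2), ⟨?_, ?_⟩, ?_⟩
    · by_contra h'
      exact hne (by simp only [hφdef, hα0 _ h', zero_mul])
    · refine subset_tsupport _ fun h' => hne ?_
      simp only [hφdef]
      rw [h', mul_zero]
    · ext1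
      · rfl
      · simp only [freeFlight_freeFlight, neg_add_cancel, freeFlight_zero]
  have hKΩ : K ⊆ Ioi 0 ×ˢ Ω ×ˢ univ := by
    rintro _ ⟨z, ⟨hz1, hz2⟩, rfl⟩
    exact ⟨hs.trans_le hz1.1, hψU hz2 z.1 hz1, mem_univ _⟩
  have hts : tsupport φ ⊆ K := closure_minimal (fun z hz => by
    by_contra h'
    exact hz (hφK z h')) hKc.isClosed
  have h0 := heq φ hφ (HasCompactSupport.intro hKc hφK) (hts.trans hKΩ)
  have h1 : ∀ z : ℝ × R3 × R3,
      k z.1 z.2 * fderiv ℝ φ z (1, z.2.2, 0) + h z.1 z.2 * φ z =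
        (k z.1 z.2 * deriv α z.1 + h z.1 z.2 * α z.1) * ψ (freeFlight (-z.1) z.2) := fun z => by
    rw [fderiv_transport hα hψ]; simp only [hφdef]; ring
  have hψm : Measurable ψ := hψ.continuous.measurable
  have hm2 : Measurable fun z : ℝ × R3 × R3 => ψ (freeFlight (-z.1) z.2) := by
    have : Continuous fun z : ℝ × R3 × R3 => ψ (freeFlight (-z.1) z.2) := by
      unfold freeFlight; exact hψ.continuous.comp (by fun_prop)
    exact this.measurable
  have hm3 : Measurable fun z : ℝ × R3 × R3 =>
      (k z.1 z.2 * deriv α z.1 + h z.1 z.2 * α z.1) * ψ (freeFlight (-z.1) z.2) :=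
    ((hk.mul ((hα.continuous_deriv (by simp)).measurable.comp measurable_fst)).add
      (hh.mul (hα.continuous.measurable.comp measurable_fst))).mul hm2
  simp_rw [h1] at h0
  rw [← measurePreserving_spaceTimeFlight.map_eq,
    integral_map hfm.aemeasurable hm3.aestronglyMeasurable] at h0
  have h2 : ∫ z : ℝ × R3 × R3, ψ z.2 * E z = 0 := by
    rw [← h0]
    refine integral_congr_ae (ae_of_all _ fun z => ?_)
    simp only [freeFlight_freeFlight, add_neg_cancel, freeFlight_zero, hE]
    ring
  have hψi : Integrable ψ := hψ.continuous.integrable_of_hasCompactSupport hψs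
  have hint : Integrable (fun z : ℝ × R3 × R3 => ψ z.2 * E z)
      ((volume : Measure ℝ).prod (volume : Measure (R3 × R3))) := by
    refine (hbi.mul_prod hψi).mono ((hψm.comp measurable_snd).mul hEm).aestronglyMeasurable
      (ae_of_all _ fun z => ?_)
    rw [norm_mul, norm_mul, mul_comm]
    gcongr
    exact (hEb z).trans (le_abs_self _)
  rw [← h2]
  change _ = ∫ z : ℝ × R3 × R3, ψ z.2 * E z ∂((volume : Measure ℝ).prod volume)
  rw [integral_prod_symm _ hint]
  refine integral_congr_ae (ae_of_all _ fun q => ?_)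
  simp only [hI, smul_eq_mul, integral_const_mul]

end

section

variable {Ω : Set R3} {n : R3 → R3}

/-! ### The mild form of the equation along trajectories -/

lemma timePhaseMeasure_eq_prod (Ω : Set R3) :
    timePhaseMeasure Ω = (volume.restrict (Ici (0 : ℝ))).prod (phaseMeasure Ω) := by
  rw [timePhaseMeasure, phaseMeasure, Measure.prod_restrict]; rfl

lemma IsDistribSolution.congr {f h k l : ℝ → R3 × R3 → ℝ} (hf : IsDistribSolution Ω f h)
    (hΩ : IsOpen Ω) (hfk : ∀ᵐ z ∂timePhaseMeasure Ω, f z.1 z.2 = k z.1 z.2)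
    (hhl : ∀ᵐ z ∂timePhaseMeasure Ω, h z.1 z.2 = l z.1 z.2) : IsDistribSolution Ω k l := by
  intro φ h1 h2 h3
  rw [← hf φ h1 h2 h3]
  have hms : MeasurableSet (Ici (0 : ℝ) ×ˢ Ω ×ˢ (univ : Set R3)) :=
    measurableSet_Ici.prod (hΩ.measurableSet.prod MeasurableSet.univ)
  rw [timePhaseMeasure, ae_restrict_iff' hms] at hfk hhl
  refine integral_congr_ae ?_
  filter_upwards [hfk, hhl] with z hz1 hz2
  by_cases hz : z ∈ tsupport φ
  · have hz' := h3 hz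
    have hz'' : z ∈ Ici (0 : ℝ) ×ˢ Ω ×ˢ (univ : Set R3) := ⟨le_of_lt (mem_Ioi.1 hz'.1), hz'.2⟩
    rw [hz1 hz'', hz2 hz'']
  · rw [image_eq_zero_of_notMem_tsupport hz, image_eq_zero_of_notMem_tsupport
      (fun h' => hz (tsupport_fderiv_subset ℝ h'))]
    simp

lemma measurePreserving_spaceTimeTrajectory (hΩ : IsRegularDomain Ω n) :
    MeasurePreserving (fun z : ℝ × R3 × R3 => (z.1, trajectory Ω n z.1 z.2))
      (timePhaseMeasure Ω) (timePhaseMeasure Ω) := by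
  have : SFinite (phaseMeasure Ω) := by rw [phaseMeasure]; infer_instance
  rw [timePhaseMeasure_eq_prod]
  refine (MeasurePreserving.id _).skew_product (g := fun t p => trajectory Ω n t p)
    (measurable_trajectory_uncurry hΩ.contDiff_normal.continuous) ?_
  filter_upwards [ae_restrict_mem measurableSet_Ici] with t ht
  exact (measurePreserving_trajectory hΩ ht).map_eq

/-- Almost everywhere statements on phase space hold along almost every trajectory. -/
lemma ae_ae_trajectory (hΩ : IsRegularDomain Ω n) {P : ℝ → R3 × R3 → Prop}
    (h : ∀ᵐ z ∂timePhaseMeasure Ω, P z.1 z.2) :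
    ∀ᵐ p ∂phaseMeasure Ω, ∀ᵐ t ∂(volume : Measure ℝ), 0 ≤ t → P t (trajectory Ω n t p) := by
  have : SFinite (phaseMeasure Ω) := by rw [phaseMeasure]; infer_instance
  have h1 := (measurePreserving_spaceTimeTrajectory hΩ).quasiMeasurePreserving.ae h
  rw [timePhaseMeasure_eq_prod] at h1
  have h2 := Measure.ae_ae_of_ae_prod (Measure.measurePreserving_swap.quasiMeasurePreserving.ae h1)
  filter_upwards [h2] with p hp
  exact (ae_restrict_iff' measurableSet_Ici).1 hp

/-- The transport equation along the trajectories, in integrated form. -/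
lemma ae_mild (hΩ : IsRegularDomain Ω n) {f k h : ℝ → R3 × R3 → ℝ}
    (hk : Measurable (Function.uncurry k)) (hh : Measurable (Function.uncurry h)) {C : ℝ}
    (hkC : ∀ t p, |k t p| ≤ C) (hhC : ∀ t p, |h t p| ≤ C) (heq : IsDistribSolution Ω k h)
    (hfk : ∀ᵐ z ∂timePhaseMeasure Ω, f z.1 z.2 = k z.1 z.2)
    (hcont : ∀ᵐ p ∂phaseMeasure Ω, ContinuousOn (fun t => sharp Ω n f t p) (Ici 0)) :
    ∀ᵐ p ∂phaseMeasure Ω, ∀ t, 0 ≤ t →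
      sharp Ω n f t p = sharp Ω n f 0 p + ∫ r in (0 : ℝ)..t, h r (trajectory Ω n r p) := by
  have hO := hΩ.isOpen
  have hgood : ∀ᵐ q : R3 × R3, ∀ (s t c : ℚ) (j : ℕ), 0 < (s : ℝ) → (s : ℝ) < t → (t : ℝ) < c →
      (t : ℝ) + 1 / (j + 1) ≤ c → (∀ r ∈ Icc (s : ℝ) c, (freeFlight r q).1 ∈ Ω) →
      ∫ r, (k r (freeFlight r q) * deriv (smoothWindow s t j) r +
        h r (freeFlight r q) * smoothWindow s t j r) = 0 := by
    refine ae_all_iff.2 fun s => ae_all_iff.2 fun t => ae_all_iff.2 fun c => ae_all_iff.2 fun j => ?_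
    by_cases h1 : 0 < (s : ℝ) ∧ (s : ℝ) < t ∧ (t : ℝ) + 1 / (j + 1) ≤ c
    · filter_upwards [heq.ae_line hO hk hh hkC hhC h1.1 (contDiff_smoothWindow s t j)
        fun r hr => smoothWindow_eq_zero h1.2.1.le h1.2.2 hr] with q hq _ _ _ _ h2
      exact hq h2
    · exact ae_of_all _ fun q h2 h3 _ h4 => absurd ⟨h2, h3, h4⟩ h1
  have hgood' : ∀ᵐ p ∂phaseMeasure Ω, ∀ r : ℚ, 0 ≤ (r : ℝ) →
      (trajectory Ω n r p).1 ∈ Ω ∧ ∀ (s t c : ℚ) (j : ℕ), 0 < (s : ℝ) → (s : ℝ) < t →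
      (t : ℝ) < c → (t : ℝ) + 1 / (j + 1) ≤ c →
      (∀ u ∈ Icc (s : ℝ) c, (freeFlight u (freeFlight (-r) (trajectory Ω n r p))).1 ∈ Ω) →
      ∫ u, (k u (freeFlight u (freeFlight (-r) (trajectory Ω n r p))) *
          deriv (smoothWindow s t j) u +
        h u (freeFlight u (freeFlight (-r) (trajectory Ω n r p))) * smoothWindow s t j u) = 0 := by
    refine ae_all_iff.2 fun r => ?_
    by_cases hr : 0 ≤ (r : ℝ)
    · have h1 := (measurePreserving_freeFlight (-(r : ℝ))).quasiMeasurePreserving.ae hgood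
      have h2 : ∀ᵐ q ∂phaseMeasure Ω, _ := ae_restrict_of_ae h1
      have h3 := (measurePreserving_trajectory hΩ hr).quasiMeasurePreserving.ae h2
      filter_upwards [h3, ae_trajectory hΩ hr] with p hp hp' _
      exact ⟨hp'.2.1, hp⟩
    · exact ae_of_all _ fun p h1 => absurd h1 hr
  filter_upwards [hgood', ae_ae_trajectory hΩ (P := fun t p => f t p = k t p) hfk, hcont, ae_definedAt hΩ] with p hp hpk hc hdef
  set g : ℝ → ℝ := fun t => sharp Ω n f t p with hg
  set hs : ℝ → ℝ := fun r => h r (trajectory Ω n r p) with hhs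
  have hhsm : Measurable hs :=
    hh.comp (measurable_id.prodMk ((measurable_trajectory_uncurry
      hΩ.contDiff_normal.continuous).comp (measurable_id.prodMk measurable_const)))
  have hint : ∀ a b, IntervalIntegrable hs volume a b := fun a b =>
    (intervalIntegrable_const (c := C)).mono_fun hhsm.aestronglyMeasurable
      (ae_of_all _ fun r => (hhC _ _).trans (le_abs_self C))
  set u : ℝ → ℝ := fun t => g t - ∫ r in (0 : ℝ)..t, hs r with hu
  have hucont : ContinuousOn u (Ici 0) :=
    hc.sub (intervalIntegral.continuous_primitive hint 0).continuousOn
  -- between two collisions the trajectory is a straight line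
  have hright : ∀ τ, 0 ≤ τ → ∃ δ > 0, ∀ t ∈ Ico τ (τ + δ), u t = u τ := by
    intro τ hτ
    obtain ⟨d, hd0, hd1⟩ := ENNReal.lt_iff_exists_nnreal_btwn.1 (hitTime_trajectory_pos hτ (hdef τ))
    have hd0' : 0 < (d : ℝ) := by exact_mod_cast hd0
    refine ⟨d, hd0', ?_⟩
    set q := freeFlight (-τ) (trajectory Ω n τ p) with hq
    have hfl : ∀ r ∈ Icc τ (τ + d), trajectory Ω n r p = freeFlight r q := fun r hr => by
      have h1 : ENNReal.ofReal (r - τ) < hitTime Ω (trajectory Ω n τ p) := by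
        refine lt_of_le_of_lt ?_ hd1
        rw [← ENNReal.ofReal_coe_nnreal]
        exact ENNReal.ofReal_le_ofReal (by linarith [hr.2])
      have h2 := trajectory_add_of_lt hτ (by linarith [hr.1]) (hdef τ) h1
      rw [add_sub_cancel] at h2
      rw [h2, hq, freeFlight_freeFlight]; congr 1; ring
    have hback : ∀ r ∈ Icc τ (τ + d), freeFlight (-r) (trajectory Ω n r p) = q := fun r hr => by
      rw [hfl r hr, freeFlight_freeFlight]; simp [freeFlight_zero]
    have hmem : ∀ r ∈ Ioo τ (τ + d), (freeFlight r q).1 ∈ Ω := fun r hr => by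
      obtain ⟨r₀, hr₀⟩ := exists_rat_btwn hr.1
      have h0 : (r₀ : ℝ) ∈ Icc τ (τ + d) := ⟨hr₀.1.le, hr₀.2.le.trans hr.2.le⟩
      have h1 := (hp r₀ (hτ.trans hr₀.1.le)).1
      have h2 : (trajectory Ω n τ p).1 + (r₀ - τ) • (trajectory Ω n τ p).2 ∈ Ω := by
        rw [hfl r₀ h0, hq, freeFlight_freeFlight] at h1
        convert! h1 using 3
        rw [freeFlight]; dsimp only; congr 2; ring
      have h3 : ∀ r' ∈ Ioo τ (τ + d),
          ENNReal.ofReal (r' - τ) < hitTime Ω (trajectory Ω n τ p) := fun r' hr' => by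
        refine lt_of_le_of_lt ?_ hd1
        rw [← ENNReal.ofReal_coe_nnreal]
        exact ENNReal.ofReal_le_ofReal (by linarith [hr'.2])
      have h4 := mem_of_lt_hitTime hO (sub_pos.2 hr₀.1) (h3 r₀ ⟨hr₀.1, hr₀.2.trans hr.2⟩) h2
        (sub_pos.2 hr.1) (h3 r hr)
      rw [hq, freeFlight_freeFlight]
      convert! h4 using 3
      rw [freeFlight]; dsimp only; congr 2; ring
    have hkey : ∀ s t : ℚ, (s : ℝ) ∈ Ioo τ (τ + d) → (t : ℝ) ∈ Ioo τ (τ + d) → (s : ℝ) < t →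
        u t = u s := by
      intro s t hs' ht' hst
      obtain ⟨c, hc1, hc2⟩ := exists_rat_btwn ht'.2
      have hs0 : 0 < (s : ℝ) := hτ.trans_lt hs'.1
      have hsub : Icc (s : ℝ) c ⊆ Ioo τ (τ + d) := fun r hr =>
        ⟨hs'.1.trans_le hr.1, hr.2.trans_lt hc2⟩
      have hbq := hback s ⟨hs'.1.le, hs'.2.le⟩
      have hline := (hp s hs0.le).2 s t c
      rw [hbq] at hline
      have hgc : ContinuousOn g (Icc (s : ℝ) c) :=
        hc.mono fun r hr => hs0.le.trans hr.1
      have hlm : Measurable fun r => h r (freeFlight r q) := by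
        have : Continuous fun r => freeFlight r q := by unfold freeFlight; fun_prop
        exact hh.comp (measurable_id.prodMk this.measurable)
      have h1 := sub_eq_integral_of_smoothWindow (k := fun r => k r (freeFlight r q)) hst hc1 hlm
        (fun r => hhC _ _) hgc (by
          filter_upwards [hpk] with r hr hrc
          rw [← hfl r (Ioo_subset_Icc_self (hsub hrc)), ← hr (hs0.le.trans hrc.1)]
          rfl) (fun j hj => hline j hs0 hst hc1 hj fun r hr => hmem r (hsub hr))
      have h2 : ∫ r in (s : ℝ)..t, h r (freeFlight r q) = ∫ r in (s : ℝ)..t, hs r := by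
        refine intervalIntegral.integral_congr fun r hr => ?_
        rw [uIcc_of_le hst.le] at hr
        simp only [hhs]
        rw [hfl r (Ioo_subset_Icc_self (hsub ⟨hr.1, hr.2.trans hc1.le⟩))]
      rw [h2] at h1
      have h3 := intervalIntegral.integral_add_adjacent_intervals (hint 0 s) (hint s t)
      simp only [hu]
      linarith
    obtain ⟨s₀, hs₀⟩ := exists_rat_btwn (show τ < τ + d by linarith)
    have hEq : EqOn u (fun _ => u s₀) (Ioo τ (τ + d) ∩ range ((↑) : ℚ → ℝ)) := by
      rintro _ ⟨ht, t, rfl⟩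
      rcases lt_trichotomy (s₀ : ℝ) t with h1 | h1 | h1
      · exact hkey s₀ t hs₀ ht h1
      · dsimp only; rw [h1]
      · exact (hkey t s₀ ht hs₀ h1).symm
    have hcl : Icc τ (τ + d) ⊆ closure (Ioo τ (τ + d) ∩ range ((↑) : ℚ → ℝ)) := by
      rw [← closure_Ioo (show τ ≠ τ + d by linarith)]
      exact closure_minimal (Rat.denseRange_cast.open_subset_closure_inter isOpen_Ioo)
        isClosed_closure
    have hEq2 := hEq.of_subset_closure (hucont.mono fun r (hr : r ∈ Icc τ (τ + d)) =>
      hτ.trans hr.1) continuousOn_const (fun r hr => Ioo_subset_Icc_self hr.1) hcl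
    intro t ht
    rw [hEq2 (Ico_subset_Icc_self ht), hEq2 ⟨le_rfl, by linarith⟩]
  intro t ht
  have h0 := constant_of_has_deriv_right_zero (f := u) (a := 0) (b := t)
    (hucont.mono fun r hr => hr.1) (fun τ hτ => ?_) t ⟨ht, le_rfl⟩
  · simp only [hu, intervalIntegral.integral_same, sub_zero] at h0
    change g t = g 0 + ∫ r in (0 : ℝ)..t, hs r
    linarith
  · obtain ⟨δ, hδ, hcst⟩ := hright τ hτ.1
    refine (hasDerivWithinAt_const τ (Ici τ) (u τ)).congr_of_eventuallyEq ?_ rfl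
    filter_upwards [Ico_mem_nhdsGE (show τ < τ + δ by linarith)] with r hr using hcst r hr

end

section

variable {Ω : Set R3} {n : R3 → R3}

/-! ### Integrals along trajectories -/

instance sFinite_phaseMeasure : SFinite (phaseMeasure Ω) := by
  rw [phaseMeasure]; infer_instance

/-- The integral `∫₀ᵗ H(s, Ψˢ(p)) ds`. -/
def pathIntegral (Ω : Set R3) (n : R3 → R3) (H : ℝ → R3 × R3 → ℝ≥0∞) (t : ℝ) (p : R3 × R3) :
    ℝ≥0∞ := ∫⁻ s in Icc 0 t, H s (trajectory Ω n s p)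

section
variable {H : ℝ → R3 × R3 → ℝ≥0∞}

lemma measurable_comp_trajectory (hn : Continuous n) (hH : Measurable (Function.uncurry H)) :
    Measurable fun z : ℝ × R3 × R3 => H z.1 (trajectory Ω n z.1 z.2) :=
  hH.comp (measurable_fst.prodMk (measurable_trajectory_uncurry hn))

lemma measurable_along_trajectory (hn : Continuous n) (hH : Measurable (Function.uncurry H))
    (p : R3 × R3) : Measurable fun s => H s (trajectory Ω n s p) :=
  (measurable_comp_trajectory hn hH).comp measurable_prodMk_right

lemma measurable_pathIntegral (hn : Continuous n) (hH : Measurable (Function.uncurry H)) :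
    Measurable (Function.uncurry (pathIntegral Ω n H)) := by
  set A : Set ((ℝ × R3 × R3) × ℝ) := {z | 0 ≤ z.2 ∧ z.2 ≤ z.1.1}
  have hA : MeasurableSet A :=
    (measurableSet_le measurable_const measurable_snd).inter
      (measurableSet_le measurable_snd measurable_fst.fst)
  have h1 : Measurable (A.indicator fun z : (ℝ × R3 × R3) × ℝ =>
      H z.2 (trajectory Ω n z.2 z.1.2)) :=
    Measurable.indicator ((measurable_comp_trajectory hn hH).comp
      (measurable_snd.prodMk measurable_fst.snd)) hA
  have h2 : Function.uncurry (pathIntegral Ω n H) = fun z => ∫⁻ s,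
      A.indicator (fun z : (ℝ × R3 × R3) × ℝ => H z.2 (trajectory Ω n z.2 z.1.2)) (z, s) := by
    ext z
    rw [Function.uncurry, pathIntegral, ← lintegral_indicator measurableSet_Icc]
    rfl
  rw [h2]
  exact h1.lintegral_prod_right'

lemma lintegral_mul_trajectory (hΩ : IsRegularDomain Ω n) {m : R3 → ℝ≥0∞}
    (hm : IsCollisionInvariant m) {s : ℝ} (hs : 0 ≤ s) {K : R3 × R3 → ℝ≥0∞} (hK : Measurable K) :
    ∫⁻ p, m p.2 * K (trajectory Ω n s p) ∂phaseMeasure Ω = ∫⁻ p, m p.2 * K p ∂phaseMeasure Ω := by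
  rw [← (measurePreserving_trajectory hΩ hs).lintegral_comp (hm.measurable_mul hK)]
  refine lintegral_congr_ae ?_
  filter_upwards [ae_trajectory hΩ hs] with p hp
  rw [hm.norm_eq _ _ hp.2.2.1]

lemma lintegral_mul_back (hΩ : IsRegularDomain Ω n) {m : R3 → ℝ≥0∞}
    (hm : IsCollisionInvariant m) {s : ℝ} (hs : 0 ≤ s) {K : R3 × R3 → ℝ≥0∞} (hK : Measurable K) :
    ∫⁻ p, m p.2 * K (backTrajectory Ω n s p) ∂phaseMeasure Ω =
      ∫⁻ p, m p.2 * K p ∂phaseMeasure Ω := by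
  have hb : Measurable fun p => K (backTrajectory Ω n s p) :=
    hK.comp (measurable_backTrajectory hΩ.contDiff_normal.continuous s)
  rw [← lintegral_mul_trajectory hΩ hm hs hb]
  refine lintegral_congr_ae ?_
  filter_upwards [ae_back_trajectory hΩ hs] with p hp
  rw [hp]

lemma lintegral_mul_setLIntegral (hΩ : IsRegularDomain Ω n) {m : R3 → ℝ≥0∞}
    (hm : IsCollisionInvariant m) (hH : Measurable (Function.uncurry H)) {A : Set ℝ}
    (hA : MeasurableSet A) (hA0 : A ⊆ Ici 0) :
    ∫⁻ p, m p.2 * (∫⁻ s in A, H s (trajectory Ω n s p)) ∂phaseMeasure Ω =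
      ∫⁻ s in A, ∫⁻ p, m p.2 * H s p ∂phaseMeasure Ω := by
  have h1 := measurable_comp_trajectory (Ω := Ω) hΩ.contDiff_normal.continuous hH
  have h2 : ∀ p : R3 × R3, m p.2 * ∫⁻ s in A, H s (trajectory Ω n s p) =
      ∫⁻ s in A, m p.2 * H s (trajectory Ω n s p) := fun p =>
    (lintegral_const_mul _ (h1.comp measurable_prodMk_right)).symm
  simp_rw [h2]
  have h3 : Measurable fun z : (R3 × R3) × ℝ => m z.1.2 * H z.2 (trajectory Ω n z.2 z.1) :=
    (hm.measurable.comp measurable_fst.snd).mul (h1.comp measurable_swap)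
  rw [lintegral_lintegral_swap h3.aemeasurable]
  refine setLIntegral_congr_fun hA fun s hs => ?_
  exact lintegral_mul_trajectory hΩ hm (hA0 hs) (hH.comp measurable_prodMk_left)

lemma lintegral_mul_pathIntegral (hΩ : IsRegularDomain Ω n) {m : R3 → ℝ≥0∞}
    (hm : IsCollisionInvariant m) (hH : Measurable (Function.uncurry H)) (t : ℝ) :
    ∫⁻ p, m p.2 * pathIntegral Ω n H t p ∂phaseMeasure Ω =
      ∫⁻ s in Icc 0 t, ∫⁻ p, m p.2 * H s p ∂phaseMeasure Ω :=
  lintegral_mul_setLIntegral hΩ hm hH measurableSet_Icc fun _ hs => hs.1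

/-- Inequalities valid almost everywhere at each time can be integrated along almost every
trajectory. -/
lemma ae_pathIntegral_mono (hΩ : IsRegularDomain Ω n) {K : ℝ → R3 × R3 → ℝ≥0∞}
    (hH : Measurable (Function.uncurry H)) (hK : Measurable (Function.uncurry K))
    (h : ∀ s, 0 ≤ s → ∀ᵐ p ∂phaseMeasure Ω, H s p ≤ K s p) :
    ∀ᵐ p ∂phaseMeasure Ω, ∀ t, pathIntegral Ω n H t p ≤ pathIntegral Ω n K t p := by
  have h1 : ∀ᵐ z ∂timePhaseMeasure Ω, H z.1 z.2 ≤ K z.1 z.2 := by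
    have hms : MeasurableSet {z : ℝ × R3 × R3 | H z.1 z.2 ≤ K z.1 z.2} := measurableSet_le hH hK
    rw [timePhaseMeasure_eq_prod, Measure.ae_prod_iff_ae_ae hms]
    filter_upwards [ae_restrict_mem measurableSet_Ici] with s hs using h s hs
  filter_upwards [ae_ae_trajectory hΩ (P := fun t p => H t p ≤ K t p) h1] with p hp t
  refine setLIntegral_mono_ae' measurableSet_Icc ?_
  filter_upwards [hp] with s hs hst using hs hst.1

end

lemma setLIntegral_ofReal_deriv {φ φ' : ℝ → ℝ} {t : ℝ} (ht : 0 ≤ t)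
    (hφ : ∀ s, HasDerivAt φ (φ' s) s) (hc : Continuous φ') (h0 : ∀ s, 0 ≤ s → 0 ≤ φ' s) :
    ∫⁻ s in Icc 0 t, ENNReal.ofReal (φ' s) = ENNReal.ofReal (φ t - φ 0) := by
  rw [← ofReal_integral_eq_lintegral_ofReal (hc.integrableOn_Icc), integral_Icc_eq_integral_Ioc,
    ← intervalIntegral.integral_of_le ht,
    intervalIntegral.integral_eq_sub_of_hasDerivAt (fun s _ => hφ s) (hc.intervalIntegrable _ _)]
  filter_upwards [ae_restrict_mem measurableSet_Icc] with s hs using h0 s hs.1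

/-! ### Mild solutions -/

variable {β : R3 → S2 → ℝ}

/-- Mild solutions of the Boltzmann–Fermi–Dirac equation with values in `[0, 1]`; the losses are
kept on the left hand side in order to avoid subtractions. -/
structure IsMildSolution (Ω : Set R3) (n : R3 → R3) (β : R3 → S2 → ℝ)
    (F : ℝ → R3 × R3 → ℝ≥0∞) : Prop where
  measurable : Measurable (Function.uncurry F)
  le_one : ∀ t p, F t p ≤ 1
  mild : ∀ t, 0 ≤ t → ∀ᵐ p ∂phaseMeasure Ω,
    F t (trajectory Ω n t p) + pathIntegral Ω n (fun s => lossOp β (F s)) t p =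
      F 0 p + pathIntegral Ω n (fun s => gainOp β (F s)) t p

/-- The Picard iterates of the equation in which the losses and the exclusion factors are
dropped, truncated at `1`. -/
def picard (Ω : Set R3) (n : R3 → R3) (β : R3 → S2 → ℝ) (F₀ : R3 × R3 → ℝ≥0∞) :
    ℕ → ℝ → R3 × R3 → ℝ≥0∞
  | 0 => fun _ _ => 0
  | k + 1 => fun t q => min 1 (F₀ (backTrajectory Ω n t q) +
      pathIntegral Ω n (fun s => pairOp β (picard Ω n β F₀ k s)) t (backTrajectory Ω n t q))

section
variable {F₀ : R3 × R3 → ℝ≥0∞}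

lemma measurable_picard (hn : Continuous n) (hβ : IsSymmetricKernel β) (hF₀ : Measurable F₀)
    (k : ℕ) : Measurable (Function.uncurry (picard Ω n β F₀ k)) := by
  induction k with
  | zero => exact measurable_const
  | succ k ih =>
    have h1 := measurable_pathIntegral (Ω := Ω) hn (measurable_pairOp hβ ih)
    have h2 := measurable_backTrajectory_uncurry (Ω := Ω) hn
    exact measurable_const.min ((hF₀.comp h2).add (h1.comp (measurable_fst.prodMk h2)))

lemma picard_le_one (k : ℕ) (t : ℝ) (p : R3 × R3) : picard Ω n β F₀ k t p ≤ 1 := by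
  cases k with
  | zero => exact zero_le
  | succ k => exact min_le_left _ _

lemma IsSymmetricKernel.ofReal_toReal_kernelNorm (hβ : IsSymmetricKernel β) :
    ENNReal.ofReal (kernelNorm β).toReal = kernelNorm β :=
  ENNReal.ofReal_toReal hβ.kernelNorm_lt_top.ne

/-- Gronwall's argument for the Picard iterates, by induction on `k` and uniformly in `k`. -/
lemma lintegral_mul_picard_le (hΩ : IsRegularDomain Ω n) (hβ : IsSymmetricKernel β)
    {m : R3 → ℝ≥0∞} (hm : IsCollisionInvariant m) (hF₀ : Measurable F₀) (k : ℕ) {t : ℝ}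
    (ht : 0 ≤ t) :
    ∫⁻ p, m p.2 * picard Ω n β F₀ k t p ∂phaseMeasure Ω ≤
      ENNReal.ofReal (Real.exp ((kernelNorm β).toReal * t)) *
        ∫⁻ p, m p.2 * F₀ p ∂phaseMeasure Ω := by
  have hn := hΩ.contDiff_normal.continuous
  induction k generalizing t with
  | zero => simp [picard]
  | succ k ih =>
    set κ := (kernelNorm β).toReal with hκ
    set M := ∫⁻ p, m p.2 * F₀ p ∂phaseMeasure Ω with hM
    have hG := measurable_picard (Ω := Ω) hn hβ hF₀ k
    have hP := measurable_pairOp hβ hG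
    have hI := measurable_pathIntegral (Ω := Ω) hn hP
    have hI' : Measurable (pathIntegral Ω n (fun s => pairOp β (picard Ω n β F₀ k s)) t) :=
      hI.comp measurable_prodMk_left
    have hexp : ∫⁻ s in Icc 0 t, ENNReal.ofReal (κ * Real.exp (κ * s)) =
        ENNReal.ofReal (Real.exp (κ * t) - 1) := by
      have := setLIntegral_ofReal_deriv (φ := fun s => Real.exp (κ * s))
        (φ' := fun s => κ * Real.exp (κ * s)) ht (fun s => by
          have h1 : HasDerivAt (fun s : ℝ => κ * s) κ s := by
            simpa using (hasDerivAt_id s).const_mul κ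
          simpa [mul_comm] using h1.exp) (by fun_prop) (fun s _ => by positivity)
      simpa using this
    calc ∫⁻ p, m p.2 * picard Ω n β F₀ (k + 1) t p ∂phaseMeasure Ω
        ≤ ∫⁻ p, m p.2 * (fun p => F₀ p + pathIntegral Ω n
            (fun s => pairOp β (picard Ω n β F₀ k s)) t p) (backTrajectory Ω n t p)
            ∂phaseMeasure Ω := by
          refine lintegral_mono fun p => ?_
          gcongr
          exact min_le_right _ _
      _ = ∫⁻ p, (m p.2 * F₀ p + m p.2 * pathIntegral Ω n
            (fun s => pairOp β (picard Ω n β F₀ k s)) t p) ∂phaseMeasure Ω := by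
          have hadd : Measurable fun p => F₀ p + pathIntegral Ω n
            (fun s => pairOp β (picard Ω n β F₀ k s)) t p := hF₀.add hI'
          rw [lintegral_mul_back hΩ hm ht hadd]
          simp_rw [mul_add]
      _ = M + ∫⁻ s in Icc 0 t, ∫⁻ p, m p.2 * pairOp β (picard Ω n β F₀ k s) p
            ∂phaseMeasure Ω := by
          rw [lintegral_add_left (hm.measurable_mul hF₀), lintegral_mul_pathIntegral hΩ hm hP]
      _ ≤ M + ∫⁻ s in Icc 0 t, ENNReal.ofReal (κ * Real.exp (κ * s)) * M := by
          refine add_le_add le_rfl ?_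
          refine setLIntegral_mono' measurableSet_Icc fun s hs => ?_
          refine (lintegral_mul_pairOp_le hβ hm (hG.comp measurable_prodMk_left)
            (picard_le_one k s)).trans ?_
          rw [ENNReal.ofReal_mul ENNReal.toReal_nonneg, hβ.ofReal_toReal_kernelNorm, mul_assoc]
          gcongr
          exact ih hs.1
      _ = ENNReal.ofReal (Real.exp (κ * t)) * M := by
          rw [lintegral_mul_const _ (by fun_prop), hexp]
          nth_rewrite 1 [← one_mul M]
          rw [← add_mul, ← ENNReal.ofReal_one, ← ENNReal.ofReal_add zero_le_one]
          · congr 2; ring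
          · rw [sub_nonneg]; exact Real.one_le_exp (by positivity)

/-- A mild solution exceeds the Picard iterates only by the tail of an exponential series. -/
lemma IsMildSolution.le_picard {F : ℝ → R3 × R3 → ℝ≥0∞} (hF : IsMildSolution Ω n β F)
    (hΩ : IsRegularDomain Ω n) (hβ : IsSymmetricKernel β) (k : ℕ) {t : ℝ} (ht : 0 ≤ t) :
    ∀ᵐ p ∂phaseMeasure Ω, F t p ≤ picard Ω n β (F 0) k t p +
      ENNReal.ofReal ((2 * (kernelNorm β).toReal * t) ^ k / k.factorial) := by
  have hn := hΩ.contDiff_normal.continuous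
  have hF0 : Measurable (F 0) := hF.measurable.comp measurable_prodMk_left
  induction k generalizing t with
  | zero => exact ae_of_all _ fun p => by simpa [picard] using hF.le_one t p
  | succ k ih =>
    set κ := (kernelNorm β).toReal with hκ
    have hκ0 : 0 ≤ κ := ENNReal.toReal_nonneg
    set ε : ℕ → ℝ → ℝ := fun k s => (2 * κ * s) ^ k / k.factorial with hε
    set G := picard Ω n β (F 0) k with hGdef
    have hG : Measurable (Function.uncurry G) := measurable_picard hn hβ hF0 k
    have hGm := measurable_pairOp hβ hG
    have hFm := measurable_pairOp hβ hF.measurable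
    have hstep : ∀ s, 0 ≤ s → ∀ᵐ p ∂phaseMeasure Ω, gainOp β (F s) p ≤
        pairOp β (G s) p + ENNReal.ofReal (2 * κ * ε k s) := by
      intro s hs
      have hF1 : Measurable (pairOp β (F s)) := hFm.comp measurable_prodMk_left
      have hG1 : Measurable (pairOp β (G s)) := hGm.comp measurable_prodMk_left
      have h1 := ih hs
      rw [phaseMeasure_eq_prod] at h1 ⊢
      have h2 : ∀ᵐ p ∂(volume.restrict Ω).prod (volume : Measure R3), pairOp β (F s) p ≤
          pairOp β (G s) p + ENNReal.ofReal (2 * κ * ε k s) := by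
        rw [Measure.ae_prod_iff_ae_ae (measurableSet_le hF1 (hG1.add_const _))]
        filter_upwards [Measure.ae_ae_of_ae_prod h1] with x hx
        have h3 := pairOp_le_add hβ (hF.le_one s) (picard_le_one k s) hx
        filter_upwards [h3] with v hv
        refine hv.trans_eq ?_
        rw [ENNReal.ofReal_mul (by positivity), ENNReal.ofReal_mul zero_le_two,
          hβ.ofReal_toReal_kernelNorm, ENNReal.ofReal_ofNat]
      filter_upwards [h2] with p hp using (gainOp_le_pairOp _ _).trans hp
    have hεm : Measurable fun s : ℝ => ENNReal.ofReal (2 * κ * ε k s) := by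
      simp only [hε]; fun_prop
    have hε1 : ∫⁻ s in Icc 0 t, ENNReal.ofReal (2 * κ * ε k s) = ENNReal.ofReal (ε (k + 1) t) := by
      have := setLIntegral_ofReal_deriv (φ := ε (k + 1)) (φ' := fun s => 2 * κ * ε k s) ht
        (fun s => by
          have h1 : HasDerivAt (fun s : ℝ => 2 * κ * s) (2 * κ) s := by
            simpa using (hasDerivAt_id s).const_mul (2 * κ)
          have h2 := (h1.pow (k + 1)).div_const ((k + 1).factorial : ℝ)
          convert! h2 using 1
          simp only [hε, Nat.factorial_succ]
          push_cast
          field_simp) (by simp only [hε]; fun_prop) (fun s hs => by simp only [hε]; positivity)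
      rw [this]; congr 1; simp [hε]
    have hint := ae_pathIntegral_mono hΩ (measurable_gainOp hβ hF.measurable)
      (K := fun s p => pairOp β (G s) p + ENNReal.ofReal (2 * κ * ε k s))
      (hGm.add (hεm.comp measurable_fst)) hstep
    have hlag : ∀ᵐ p ∂phaseMeasure Ω, F t (trajectory Ω n t p) ≤
        F 0 p + pathIntegral Ω n (fun s => pairOp β (G s)) t p + ENNReal.ofReal (ε (k + 1) t) := by
      filter_upwards [hint, hF.mild t ht] with p hp1 hp2
      calc F t (trajectory Ω n t p) ≤ F t (trajectory Ω n t p) +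
            pathIntegral Ω n (fun s => lossOp β (F s)) t p := le_self_add
        _ = F 0 p + pathIntegral Ω n (fun s => gainOp β (F s)) t p := hp2
        _ ≤ F 0 p + pathIntegral Ω n
            (fun s p => pairOp β (G s) p + ENNReal.ofReal (2 * κ * ε k s)) t p := by
          gcongr; exact hp1 t
        _ = _ := by
          rw [pathIntegral, lintegral_add_right _ hεm, hε1, add_assoc]; rfl
    have heul := (measurePreserving_backTrajectory hΩ ht).quasiMeasurePreserving.ae hlag
    filter_upwards [heul, ae_trajectory_back hΩ ht] with q hq1 hq2
    rw [hq2] at hq1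
    change F t q ≤ min 1 _ + ENNReal.ofReal (ε (k + 1) t)
    rw [min_add]
    exact le_min ((hF.le_one t q).trans le_self_add) hq1

end

/-- Propagation of integrability: the Picard iterates satisfy a uniform bound by Gronwall's
argument, and Fatou's lemma carries it over to the solution. -/
lemma IsMildSolution.lintegral_mul_le {F : ℝ → R3 × R3 → ℝ≥0∞} (hF : IsMildSolution Ω n β F)
    (hΩ : IsRegularDomain Ω n) (hβ : IsSymmetricKernel β) {m : R3 → ℝ≥0∞}
    (hm : IsCollisionInvariant m) {t : ℝ} (ht : 0 ≤ t) :
    ∫⁻ p, m p.2 * F t p ∂phaseMeasure Ω ≤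
      ENNReal.ofReal (Real.exp ((kernelNorm β).toReal * t)) *
        ∫⁻ p, m p.2 * F 0 p ∂phaseMeasure Ω := by
  have hF0 : Measurable (F 0) := hF.measurable.comp measurable_prodMk_left
  have hFt : Measurable (F t) := hF.measurable.comp measurable_prodMk_left
  set ε : ℕ → ℝ≥0∞ := fun k =>
    ENNReal.ofReal ((2 * (kernelNorm β).toReal * t) ^ k / k.factorial) with hε
  have hε0 : Tendsto ε atTop (𝓝 0) := by
    have := ENNReal.tendsto_ofReal
      (FloorSemiring.tendsto_pow_div_factorial_atTop (2 * (kernelNorm β).toReal * t))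
    simpa using this
  have hlim : ∀ p : R3 × R3, Tendsto (fun k => m p.2 * (F t p - ε k)) atTop
      (𝓝 (m p.2 * F t p)) := fun p => by
    have h1 : Tendsto (fun k => F t p - ε k) atTop (𝓝 (F t p - 0)) :=
      ENNReal.Tendsto.sub tendsto_const_nhds hε0
        (Or.inl ((hF.le_one t p).trans_lt ENNReal.one_lt_top).ne)
    rw [tsub_zero] at h1
    exact ENNReal.Tendsto.const_mul h1 (Or.inr (hm.ne_top _))
  calc ∫⁻ p, m p.2 * F t p ∂phaseMeasure Ω
      = ∫⁻ p, liminf (fun k => m p.2 * (F t p - ε k)) atTop ∂phaseMeasure Ω :=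
        lintegral_congr fun p => (hlim p).liminf_eq.symm
    _ ≤ liminf (fun k => ∫⁻ p, m p.2 * (F t p - ε k) ∂phaseMeasure Ω) atTop :=
        lintegral_liminf_le fun k => hm.measurable_mul (hFt.sub_const _)
    _ ≤ liminf (fun _ : ℕ => ENNReal.ofReal (Real.exp ((kernelNorm β).toReal * t)) *
          ∫⁻ p, m p.2 * F 0 p ∂phaseMeasure Ω) atTop := by
        refine liminf_le_liminf (Eventually.of_forall fun k => ?_)
        refine le_trans (lintegral_mono_ae ?_) (lintegral_mul_picard_le hΩ hβ hm hF0 k ht)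
        filter_upwards [hF.le_picard hΩ hβ k ht] with p hp
        gcongr
        exact tsub_le_iff_right.2 hp
    _ = _ := by simp

/-- Conservation of the integral of a collision invariant. -/
theorem IsMildSolution.lintegral_mul_eq {F : ℝ → R3 × R3 → ℝ≥0∞} (hF : IsMildSolution Ω n β F)
    (hΩ : IsRegularDomain Ω n) (hβ : IsSymmetricKernel β) {m : R3 → ℝ≥0∞}
    (hm : IsCollisionInvariant m) (hfin : ∫⁻ p, m p.2 * F 0 p ∂phaseMeasure Ω ≠ ⊤) {t : ℝ}
    (ht : 0 ≤ t) :
    ∫⁻ p, m p.2 * F t p ∂phaseMeasure Ω = ∫⁻ p, m p.2 * F 0 p ∂phaseMeasure Ω := by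
  have hn := hΩ.contDiff_normal.continuous
  set M := ∫⁻ p, m p.2 * F 0 p ∂phaseMeasure Ω with hM
  set κ := (kernelNorm β).toReal with hκ
  have hsl : ∀ s, Measurable (F s) := fun s => hF.measurable.comp measurable_prodMk_left
  have hL := measurable_lossOp hβ hF.measurable
  have hG := measurable_gainOp hβ hF.measurable
  have hLp : Measurable (pathIntegral Ω n (fun s => lossOp β (F s)) t) :=
    (measurable_pathIntegral (Ω := Ω) hn hL).comp measurable_prodMk_left
  have hGp : Measurable (pathIntegral Ω n (fun s => gainOp β (F s)) t) :=
    (measurable_pathIntegral (Ω := Ω) hn hG).comp measurable_prodMk_left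
  have hFt : Measurable fun p => F t (trajectory Ω n t p) :=
    (hsl t).comp (measurable_trajectory hn t)
  have hgl : ∫⁻ p, m p.2 * pathIntegral Ω n (fun s => gainOp β (F s)) t p ∂phaseMeasure Ω =
      ∫⁻ p, m p.2 * pathIntegral Ω n (fun s => lossOp β (F s)) t p ∂phaseMeasure Ω := by
    rw [lintegral_mul_pathIntegral hΩ hm hG, lintegral_mul_pathIntegral hΩ hm hL]
    exact setLIntegral_congr_fun measurableSet_Icc fun s hs => lintegral_mul_gainOp hβ hm (hsl s)
  have hlfin : ∫⁻ p, m p.2 * pathIntegral Ω n (fun s => lossOp β (F s)) t p ∂phaseMeasure Ω ≠ ⊤ := by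
    rw [lintegral_mul_pathIntegral hΩ hm hL]
    refine ne_top_of_le_ne_top (b := ∫⁻ s in Icc 0 t,
      kernelNorm β * (ENNReal.ofReal (Real.exp (κ * t)) * M)) ?_ ?_
    · rw [setLIntegral_const]
      exact ENNReal.mul_ne_top (ENNReal.mul_ne_top hβ.kernelNorm_lt_top.ne
        (ENNReal.mul_ne_top ENNReal.ofReal_ne_top hfin)) (by simp)
    · refine setLIntegral_mono' measurableSet_Icc fun s hs => ?_
      refine (lintegral_mul_lossOp_le hβ hm (hsl s) (hF.le_one s)).trans ?_
      gcongr
      refine (hF.lintegral_mul_le hΩ hβ hm hs.1).trans ?_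
      gcongr
      exact hs.2
  have hmain : ∫⁻ p, m p.2 * (F t (trajectory Ω n t p) +
        pathIntegral Ω n (fun s => lossOp β (F s)) t p) ∂phaseMeasure Ω =
      ∫⁻ p, m p.2 * (F 0 p + pathIntegral Ω n (fun s => gainOp β (F s)) t p) ∂phaseMeasure Ω := by
    refine lintegral_congr_ae ?_
    filter_upwards [hF.mild t ht] with p hp
    rw [hp]
  simp_rw [mul_add] at hmain
  rw [lintegral_add_left (hm.measurable_mul hFt), lintegral_add_left (hm.measurable_mul (hsl 0)),
    hgl, lintegral_mul_trajectory hΩ hm ht (hsl t)] at hmain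
  exact (ENNReal.add_left_inj hlfin).1 hmain

end

section

variable {Ω : Set R3} {n : R3 → R3}

/-! ### Distributional solutions are mild solutions -/

/-- Bounds which hold at almost all times extend to all times by continuity. -/
lemma mem_Icc_of_ae {g : ℝ → ℝ} (hg : ContinuousOn g (Ici 0))
    (h : ∀ᵐ t ∂(volume : Measure ℝ), 0 ≤ t → g t ∈ Icc (0 : ℝ) 1) {t : ℝ} (ht : 0 ≤ t) :
    g t ∈ Icc (0 : ℝ) 1 := by
  set S : Set ℝ := {t | 0 ≤ t → g t ∈ Icc (0 : ℝ) 1}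
  have hS : Dense S := Measure.dense_of_ae h
  have h1 : t ∈ closure (Ioi 0 ∩ S) := by
    have h2 : closure (Ioi (0 : ℝ)) ⊆ closure (Ioi 0 ∩ S) :=
      closure_minimal (hS.open_subset_closure_inter isOpen_Ioi) isClosed_closure
    exact h2 (by rw [closure_Ioi]; exact ht)
  have h3 : ContinuousWithinAt g (Ioi 0 ∩ S) t :=
    (hg t ht).mono fun s hs => le_of_lt (mem_Ioi.1 hs.1)
  refine isClosed_Icc.closure_subset_iff.2 ?_ (h3.mem_closure_image h1)
  rintro _ ⟨s, hs, rfl⟩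
  exact hs.2 (le_of_lt (mem_Ioi.1 hs.1))

variable {β : R3 → S2 → ℝ} {b : R3 → S2 → ℝ} {f : ℝ → R3 × R3 → ℝ}

/-- The net collision rate in terms of gain and loss. -/
def netRate (β : R3 → S2 → ℝ) (F : ℝ → R3 × R3 → ℝ≥0∞) (t : ℝ) (p : R3 × R3) : ℝ :=
  (gainOp β (F t) p).toReal - (lossOp β (F t) p).toReal

lemma measurable_netRate (hβ : IsSymmetricKernel β) {F : ℝ → R3 × R3 → ℝ≥0∞}
    (hF : Measurable (Function.uncurry F)) : Measurable (Function.uncurry (netRate β F)) :=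
  (measurable_gainOp hβ hF).ennreal_toReal.sub (measurable_lossOp hβ hF).ennreal_toReal

lemma abs_netRate_le (hβ : IsSymmetricKernel β) {F : ℝ → R3 × R3 → ℝ≥0∞}
    (hF1 : ∀ t p, F t p ≤ 1) (t : ℝ) (p : R3 × R3) :
    |netRate β F t p| ≤ (kernelNorm β).toReal := by
  have h1 := ENNReal.toReal_mono hβ.kernelNorm_lt_top.ne (gainOp_le hβ (hF1 t) p)
  have h2 := ENNReal.toReal_mono hβ.kernelNorm_lt_top.ne (lossOp_le hβ (hF1 t) p)
  have h3 : 0 ≤ (gainOp β (F t) p).toReal := ENNReal.toReal_nonneg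
  have h4 : 0 ≤ (lossOp β (F t) p).toReal := ENNReal.toReal_nonneg
  rw [netRate, abs_le]
  constructor <;> linarith

lemma ae_Q_eq_netRate (hβ : IsSymmetricKernel β)
    (hb : ∀ᵐ p : R3 × S2 ∂((volume : Measure R3).prod surfaceS2), b p.1 p.2 = β p.1 p.2)
    {F : ℝ → R3 × R3 → ℝ≥0∞} (hF : Measurable (Function.uncurry F)) (hF1 : ∀ t p, F t p ≤ 1)
    (hfF : ∀ᵐ z ∂timePhaseMeasure Ω, f z.1 z.2 = (F z.1 z.2).toReal) :
    ∀ᵐ z ∂timePhaseMeasure Ω, Q b f z.1 z.2 = netRate β F z.1 z.2 := by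
  have hassoc := measurePreserving_prodAssoc (volume.restrict (Ici (0 : ℝ)))
    (volume.restrict Ω) (volume : Measure R3)
  have hT : timePhaseMeasure Ω = (volume.restrict (Ici (0 : ℝ))).prod
      ((volume.restrict Ω).prod (volume : Measure R3)) := by
    rw [timePhaseMeasure_eq_prod, phaseMeasure_eq_prod]
  rw [hT] at hfF ⊢
  have h1 := ae_ae_collision_prod (hassoc.quasiMeasurePreserving.ae hfF)
  have h2 := (hassoc.symm MeasurableEquiv.prodAssoc).quasiMeasurePreserving.ae h1
  filter_upwards [h2] with z hz
  exact collisionIntegral_eq hβ hb (F := F z.1) (hF.comp measurable_prodMk_left) (hF1 z.1)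
    (x := z.2.1) (v := z.2.2) (g := fun w => f z.1 (z.2.1, w)) hz

/-- The mild equation for `f♯`, with the gain and loss terms of a measurable version `F` of `f`.  The
finiteness of the losses allows rearrangement in `ℝ≥0∞`. -/
lemma IsBFDSolution.ae_mild_eq {f₀ : R3 × R3 → ℝ} (hf : IsBFDSolution Ω n b f₀ f)
    (hΩ : IsRegularDomain Ω n) (hβ : IsSymmetricKernel β)
    (hb : ∀ᵐ p : R3 × S2 ∂((volume : Measure R3).prod surfaceS2), b p.1 p.2 = β p.1 p.2)
    {F : ℝ → R3 × R3 → ℝ≥0∞} (hF : Measurable (Function.uncurry F)) (hF1 : ∀ t p, F t p ≤ 1)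
    (hfF : ∀ᵐ z ∂timePhaseMeasure Ω, f z.1 z.2 = (F z.1 z.2).toReal) :
    ∀ᵐ p ∂phaseMeasure Ω, ∀ t, 0 ≤ t → sharp Ω n f t p ∈ Icc (0 : ℝ) 1 ∧
      ENNReal.ofReal (sharp Ω n f t p) + pathIntegral Ω n (fun s => lossOp β (F s)) t p =
      ENNReal.ofReal (f 0 p) + pathIntegral Ω n (fun s => gainOp β (F s)) t p ∧
      pathIntegral Ω n (fun s => lossOp β (F s)) t p ≠ ⊤ := by
  have hn := hΩ.contDiff_normal.continuous
  set κ := (kernelNorm β).toReal with hκ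
  have hκ0 : 0 ≤ κ := ENNReal.toReal_nonneg
  have hFr : ∀ t p, (F t p).toReal ∈ Icc (0 : ℝ) 1 := fun t p =>
    ⟨ENNReal.toReal_nonneg, by
      simpa using ENNReal.toReal_mono ENNReal.one_ne_top (hF1 t p)⟩
  have hd := hf.equation.congr hΩ.isOpen (k := fun t p => (F t p).toReal) (l := netRate β F) hfF
    (ae_Q_eq_netRate hβ hb hF hF1 hfF)
  have hmild := ae_mild hΩ (f := f) (k := fun t p => (F t p).toReal) (C := 1 + κ) hF.ennreal_toReal (measurable_netRate hβ hF)
    (fun t p => by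
      rw [abs_of_nonneg (hFr t p).1]; linarith [(hFr t p).2])
    (fun t p => (abs_netRate_le hβ hF1 t p).trans (by linarith)) hd hfF hf.boundary
  have hbd : ∀ᵐ z ∂timePhaseMeasure Ω, f z.1 z.2 ∈ Icc (0 : ℝ) 1 := by
    filter_upwards [hfF] with z hz
    rw [hz]; exact hFr _ _
  filter_upwards [hmild, ae_ae_trajectory hΩ (P := fun t p => f t p ∈ Icc (0 : ℝ) 1) hbd,
    hf.boundary, ae_phaseMeasure_mem hΩ.isOpen] with p hp1 hp2 hp3 hp4 t ht
  have hmem : ∀ t, 0 ≤ t → sharp Ω n f t p ∈ Icc (0 : ℝ) 1 := fun t ht => mem_Icc_of_ae hp3 hp2 ht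
  have hg := measurable_along_trajectory (Ω := Ω) (H := fun s => gainOp β (F s)) hn
    (measurable_gainOp hβ hF) p
  have hl := measurable_along_trajectory (Ω := Ω) (H := fun s => lossOp β (F s)) hn
    (measurable_lossOp hβ hF) p
  have hfin : ∀ H : ℝ → ℝ≥0∞, (∀ s, H s ≤ kernelNorm β) → ∫⁻ s in Icc 0 t, H s ≠ ⊤ := fun H hH => by
    have h1 : ∫⁻ s in Icc 0 t, H s ≤ ∫⁻ _ in Icc 0 t, kernelNorm β := lintegral_mono fun s => hH s
    refine ne_top_of_le_ne_top ?_ h1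
    rw [setLIntegral_const]
    exact ENNReal.mul_ne_top hβ.kernelNorm_lt_top.ne (by simp)
  have hgf := hfin _ fun s => gainOp_le hβ (hF1 s) (trajectory Ω n s p)
  have hlf := hfin _ fun s => lossOp_le hβ (hF1 s) (trajectory Ω n s p)
  refine ⟨hmem t ht, ?_, hlf⟩
  have h0 : sharp Ω n f 0 p = f 0 p := by rw [sharp, trajectory_zero hΩ.isOpen hp4]
  have h1 := hp1 t ht
  have h2 : ∫ r in (0 : ℝ)..t, netRate β F r (trajectory Ω n r p) =
      (pathIntegral Ω n (fun s => gainOp β (F s)) t p).toReal -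
        (pathIntegral Ω n (fun s => lossOp β (F s)) t p).toReal := by
    rw [intervalIntegral.integral_of_le ht, ← integral_Icc_eq_integral_Ioc]
    simp only [netRate]
    rw [integral_sub (integrable_toReal_of_lintegral_ne_top hg.aemeasurable hgf)
      (integrable_toReal_of_lintegral_ne_top hl.aemeasurable hlf),
      integral_toReal hg.aemeasurable (ae_of_all _ fun s =>
        (gainOp_le hβ (hF1 s) _).trans_lt hβ.kernelNorm_lt_top),
      integral_toReal hl.aemeasurable (ae_of_all _ fun s =>
        (lossOp_le hβ (hF1 s) _).trans_lt hβ.kernelNorm_lt_top)]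
    rfl
  rw [h2] at h1
  have hG : pathIntegral Ω n (fun s => gainOp β (F s)) t p =
      ENNReal.ofReal (pathIntegral Ω n (fun s => gainOp β (F s)) t p).toReal :=
    (ENNReal.ofReal_toReal hgf).symm
  have hL : pathIntegral Ω n (fun s => lossOp β (F s)) t p =
      ENNReal.ofReal (pathIntegral Ω n (fun s => lossOp β (F s)) t p).toReal :=
    (ENNReal.ofReal_toReal hlf).symm
  have h00 := (hmem 0 le_rfl).1
  rw [hG, hL, ← ENNReal.ofReal_add (hmem t ht).1 ENNReal.toReal_nonneg,
    ← ENNReal.ofReal_add (h0 ▸ h00) ENNReal.toReal_nonneg]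
  congr 1
  rw [h0] at h1
  linarith

/-- A solution has a version which is a mild solution at all times. -/
theorem IsBFDSolution.exists_isMildSolution {f₀ : R3 × R3 → ℝ} (hf : IsBFDSolution Ω n b f₀ f)
    (hf₀ : AEMeasurable f₀ (phaseMeasure Ω)) (hΩ : IsRegularDomain Ω n)
    (hβ : IsSymmetricKernel β)
    (hb : ∀ᵐ p : R3 × S2 ∂((volume : Measure R3).prod surfaceS2), b p.1 p.2 = β p.1 p.2) :
    ∃ F, IsMildSolution Ω n β F ∧
      (∀ t, 0 ≤ t → ∀ᵐ p ∂phaseMeasure Ω, f t p = (F t p).toReal) ∧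
      ∀ᵐ z ∂timePhaseMeasure Ω, Q b f z.1 z.2 = netRate β F z.1 z.2 := by
  have hn := hΩ.contDiff_normal.continuous
  -- a first version, which determines the collision terms
  set F₁ : ℝ → R3 × R3 → ℝ≥0∞ := fun t p =>
    min 1 (ENNReal.ofReal (hf.aemeasurable.mk _ (t, p))) with hF₁
  have hF₁m : Measurable (Function.uncurry F₁) :=
    measurable_const.min hf.aemeasurable.measurable_mk.ennreal_ofReal
  have hF₁1 : ∀ t p, F₁ t p ≤ 1 := fun t p => min_le_left _ _
  have hfF₁ : ∀ᵐ z ∂timePhaseMeasure Ω, f z.1 z.2 = (F₁ z.1 z.2).toReal := by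
    filter_upwards [hf.aemeasurable.ae_eq_mk, hf.bounds] with z hz1 hz2
    simp only [hF₁]
    rw [← hz1, min_eq_right (ENNReal.ofReal_le_one.2 hz2.2), ENNReal.toReal_ofReal hz2.1]
  clear_value F₁
  have hm₁ := hf.ae_mild_eq hΩ hβ hb hF₁m hF₁1 hfF₁
  have hL := measurable_pathIntegral (Ω := Ω) hn (measurable_lossOp hβ hF₁m)
  have hG := measurable_pathIntegral (Ω := Ω) hn (measurable_gainOp hβ hF₁m)
  -- the mild formula itself provides a version that is correct at all times
  set U : ℝ → R3 × R3 → ℝ≥0∞ := fun t p => min 1 (ENNReal.ofReal (hf₀.mk _ p) +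
    pathIntegral Ω n (fun s => gainOp β (F₁ s)) t p -
    pathIntegral Ω n (fun s => lossOp β (F₁ s)) t p) with hU
  have hUm : Measurable (Function.uncurry U) := by
    have h1 : Measurable fun z : ℝ × R3 × R3 => ENNReal.ofReal (hf₀.mk _ z.2) :=
      hf₀.measurable_mk.ennreal_ofReal.comp measurable_snd
    have h2 := (h1.add hG).sub hL
    exact Measurable.min measurable_const h2
  have hU1 : ∀ t p r, r ≤ 1 → ENNReal.ofReal (hf₀.mk _ p) +
      pathIntegral Ω n (fun s => gainOp β (F₁ s)) t p =
      r + pathIntegral Ω n (fun s => lossOp β (F₁ s)) t p →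
      pathIntegral Ω n (fun s => lossOp β (F₁ s)) t p ≠ ⊤ → U t p = r := fun t p r hr h1 h2 => by
    simp only [hU]
    rw [h1, ENNReal.add_sub_cancel_right h2, min_eq_right hr]
  have hU2 : ∀ t p, U t p ≤ 1 := fun t p => min_le_left _ _
  clear_value U
  set F₂ : ℝ → R3 × R3 → ℝ≥0∞ := fun t q => U t (backTrajectory Ω n t q) with hF₂
  have hF₂m : Measurable (Function.uncurry F₂) :=
    hUm.comp (measurable_fst.prodMk (measurable_backTrajectory_uncurry hn))
  have hF₂1 : ∀ t p, F₂ t p ≤ 1 := fun t p => hU2 _ _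
  have hUf : ∀ᵐ p ∂phaseMeasure Ω, ∀ t, 0 ≤ t → sharp Ω n f t p = (U t p).toReal := by
    filter_upwards [hm₁, hf.initial, hf₀.ae_eq_mk] with p hp1 hp2 hp3 t ht
    obtain ⟨h1, h2, h3⟩ := hp1 t ht
    have h4 : U t p = ENNReal.ofReal (sharp Ω n f t p) := by
      refine hU1 t p _ (ENNReal.ofReal_le_one.2 h1.2) ?_ h3
      rw [← hp3, ← hp2, h2]
    rw [h4, ENNReal.toReal_ofReal h1.1]
  have hfF₂ : ∀ t, 0 ≤ t → ∀ᵐ p ∂phaseMeasure Ω, f t p = (F₂ t p).toReal := by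
    intro t ht
    filter_upwards [(measurePreserving_backTrajectory hΩ ht).quasiMeasurePreserving.ae hUf,
      ae_trajectory_back hΩ ht] with q hq1 hq2
    have := hq1 t ht
    rwa [sharp, hq2] at this
  have hfF₂' : ∀ᵐ z ∂timePhaseMeasure Ω, f z.1 z.2 = (F₂ z.1 z.2).toReal := by
    have h1 : ∀ᵐ z ∂timePhaseMeasure Ω, F₁ z.1 z.2 = F₂ z.1 z.2 := by
      have hms : MeasurableSet {z : ℝ × R3 × R3 | F₁ z.1 z.2 = F₂ z.1 z.2} :=
        measurableSet_eq_fun hF₁m hF₂m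
      rw [timePhaseMeasure_eq_prod] at hfF₁ ⊢
      rw [Measure.ae_prod_iff_ae_ae hms]
      filter_upwards [Measure.ae_ae_of_ae_prod hfF₁, ae_restrict_mem measurableSet_Ici]
        with t ht1 ht2
      filter_upwards [ht1, hfF₂ t ht2] with p hp1 hp2
      rw [hp1] at hp2
      exact (ENNReal.toReal_eq_toReal_iff' ((hF₁1 t p).trans_lt ENNReal.one_lt_top).ne
        ((hF₂1 t p).trans_lt ENNReal.one_lt_top).ne).1 hp2
    filter_upwards [hfF₁, h1] with z hz1 hz2
    rw [hz1, hz2]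
  have hof : ∀ t p r, r = (F₂ t p).toReal → ENNReal.ofReal r = F₂ t p := fun t p r hr => by
    rw [hr, ENNReal.ofReal_toReal ((hF₂1 t p).trans_lt ENNReal.one_lt_top).ne]
  refine ⟨F₂, ⟨hF₂m, hF₂1, fun t ht => ?_⟩, hfF₂, ae_Q_eq_netRate hβ hb hF₂m hF₂1 hfF₂'⟩
  filter_upwards [hf.ae_mild_eq hΩ hβ hb hF₂m hF₂1 hfF₂', hfF₂ 0 le_rfl,
    (measurePreserving_trajectory hΩ ht).quasiMeasurePreserving.ae (hfF₂ t ht)] with p hp1 hp2 hp3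
  have h1 := (hp1 t ht).2.1
  rwa [hof _ _ _ hp2, sharp, hof _ _ _ hp3] at h1

end

section

variable {Ω : Set R3} {n : R3 → R3}

/-! ### Strong continuity of the flow in `L¹` -/

lemma ae_norm_back (hΩ : IsRegularDomain Ω n) {s : ℝ} (hs : 0 ≤ s) :
    ∀ᵐ q ∂phaseMeasure Ω, ‖q.2‖ = ‖(backTrajectory Ω n s q).2‖ ∧
      ‖q.1‖ ≤ ‖(backTrajectory Ω n s q).1‖ + s * ‖(backTrajectory Ω n s q).2‖ := by
  filter_upwards [(measurePreserving_backTrajectory hΩ hs).quasiMeasurePreserving.ae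
    (ae_trajectory hΩ hs), ae_trajectory_back hΩ hs] with q hq1 hq2
  obtain ⟨-, -, h1, h2, -⟩ := hq1
  rw [hq2] at h1 h2
  exact ⟨h1, h2⟩

lemma ae_continuousAt_back (hΩ : IsRegularDomain Ω n) {t : ℝ} (ht : 0 ≤ t) :
    ∀ᵐ q ∂phaseMeasure Ω, ContinuousAt (fun s => backTrajectory Ω n s q) t := by
  filter_upwards [(measurePreserving_reverse_phase hΩ.isOpen).quasiMeasurePreserving.ae
    (ae_trajectory hΩ ht), ae_phaseMeasure_mem hΩ.isOpen] with q hq1 hq2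
  exact continuous_reverse.continuousAt.comp
    (continuousAt_trajectory hΩ.isOpen (p := reverse q) hq2 ht hq1.1 hq1.2.1)

lemma tendsto_lintegral_comp_back_of_hasCompactSupport (hΩ : IsRegularDomain Ω n)
    {c : R3 × R3 → ℝ} (hc : Continuous c) (hcs : HasCompactSupport c) {t : ℝ} (ht : 0 ≤ t) :
    Tendsto (fun s => ∫⁻ q, ‖c (backTrajectory Ω n s q) - c (backTrajectory Ω n t q)‖ₑ
      ∂phaseMeasure Ω) (𝓝[Ici 0] t) (𝓝 0) := by
  have hn := hΩ.contDiff_normal.continuous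
  obtain ⟨M, hM⟩ := hcs.exists_bound_of_continuous hc
  obtain ⟨R, hR⟩ := hcs.isBounded.subset_closedBall (0 : R3 × R3)
  set R' := max R 0 with hR'
  have hR0 : 0 ≤ R' := le_max_right _ _
  set K : Set (R3 × R3) := Metric.closedBall 0 (R' + (t + 1) * R') with hK
  -- trajectories of bounded speed ending in the support of `c` have started in a fixed ball
  have hb : ∀ s, 0 ≤ s → s ≤ t + 1 → ∀ᵐ q ∂phaseMeasure Ω,
      ‖c (backTrajectory Ω n s q)‖ₑ ≤ K.indicator (fun _ => ENNReal.ofReal M) q := by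
    intro s hs0 hs1
    filter_upwards [ae_norm_back hΩ hs0] with q hq
    by_cases hcq : c (backTrajectory Ω n s q) = 0
    · rw [hcq, enorm_zero]; exact zero_le
    · have h1 := hR (subset_tsupport _ (Function.mem_support.2 hcq))
      rw [mem_closedBall_zero_iff, Prod.norm_def] at h1
      have h2 := (le_max_left _ _).trans (h1.trans (le_max_left R 0))
      have h3 := (le_max_right _ _).trans (h1.trans (le_max_left R 0))
      have h4 : q ∈ K := by
        rw [hK, mem_closedBall_zero_iff, Prod.norm_def]
        refine max_le ?_ ?_
        · refine hq.2.trans (add_le_add h2 ?_)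
          exact mul_le_mul hs1 h3 (norm_nonneg _) (by linarith)
        · rw [hq.1]
          refine h3.trans ?_
          have : 0 ≤ (t + 1) * R' := by positivity
          linarith
      rw [indicator_of_mem h4, ← ofReal_norm]
      exact ENNReal.ofReal_le_ofReal (hM _)
  have h0 : ∫⁻ _ : R3 × R3, (0 : ℝ≥0∞) ∂phaseMeasure Ω = 0 := lintegral_zero
  rw [← h0]
  refine tendsto_lintegral_filter_of_dominated_convergence
    (fun q => K.indicator (fun _ => ENNReal.ofReal M) q + K.indicator (fun _ => ENNReal.ofReal M) q)
    (Eventually.of_forall fun s => ?_) ?_ ?_ ?_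
  · have h1 : Measurable fun q => c (backTrajectory Ω n s q) :=
      hc.measurable.comp (measurable_backTrajectory hn s)
    have h2 : Measurable fun q => c (backTrajectory Ω n t q) :=
      hc.measurable.comp (measurable_backTrajectory hn t)
    exact (h1.sub h2).enorm
  · filter_upwards [self_mem_nhdsWithin,
      mem_nhdsWithin_of_mem_nhds (Iic_mem_nhds (show t < t + 1 by linarith))] with s hs1 hs2
    filter_upwards [hb s hs1 hs2, hb t ht (by linarith)] with q hq1 hq2
    exact (enorm_sub_le).trans (add_le_add hq1 hq2)
  · have hKm : MeasurableSet K := Metric.isClosed_closedBall.measurableSet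
    have hKf : phaseMeasure Ω K ≠ ⊤ :=
      ne_top_of_le_ne_top (isCompact_closedBall _ _).measure_ne_top (Measure.restrict_apply_le _ _)
    rw [lintegral_add_left (measurable_const.indicator hKm), lintegral_indicator_const hKm]
    exact ENNReal.add_ne_top.2 ⟨ENNReal.mul_ne_top ENNReal.ofReal_ne_top hKf,
      ENNReal.mul_ne_top ENNReal.ofReal_ne_top hKf⟩
  · filter_upwards [ae_continuousAt_back hΩ ht] with q hq
    have h1 : ContinuousAt (fun s => ‖c (backTrajectory Ω n s q) - c (backTrajectory Ω n t q)‖ₑ) t :=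
      ((hc.continuousAt.comp hq).sub continuousAt_const).enorm
    have h2 := h1.tendsto.mono_left (nhdsWithin_le_nhds (s := Ici 0))
    simpa using h2

lemma lintegral_enorm_comp_back (hΩ : IsRegularDomain Ω n) {w : R3 × R3 → ℝ} (hw : Measurable w)
    {s : ℝ} (hs : 0 ≤ s) :
    ∫⁻ q, ‖w (backTrajectory Ω n s q)‖ₑ ∂phaseMeasure Ω = ∫⁻ q, ‖w q‖ₑ ∂phaseMeasure Ω :=
  (measurePreserving_backTrajectory hΩ hs).lintegral_comp hw.enorm

/-- The flow acts strongly continuously on `L¹`. -/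
lemma tendsto_lintegral_comp_back (hΩ : IsRegularDomain Ω n) {w : R3 × R3 → ℝ}
    (hw : Measurable w) (hwi : Integrable w (phaseMeasure Ω)) {t : ℝ} (ht : 0 ≤ t) :
    Tendsto (fun s => ∫⁻ q, ‖w (backTrajectory Ω n s q) - w (backTrajectory Ω n t q)‖ₑ
      ∂phaseMeasure Ω) (𝓝[Ici 0] t) (𝓝 0) := by
  have hn := hΩ.contDiff_normal.continuous
  have : IsLocallyFiniteMeasure (phaseMeasure Ω) := by rw [phaseMeasure]; infer_instance
  rw [ENNReal.tendsto_nhds_zero]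
  intro ε hε
  have hε3 : ε / 3 ≠ 0 := (ENNReal.div_pos hε.ne' (by simp)).ne'
  obtain ⟨c, hcs, hcw, hc, -⟩ := hwi.exists_hasCompactSupport_lintegral_sub_le hε3
  have hwc : Measurable fun q => w q - c q := hw.sub hc.measurable
  filter_upwards [(ENNReal.tendsto_nhds_zero.1
    (tendsto_lintegral_comp_back_of_hasCompactSupport hΩ hc hcs ht)) (ε / 3)
      (pos_iff_ne_zero.2 hε3), self_mem_nhdsWithin] with s hs hs0
  have hm : ∀ r {u : R3 × R3 → ℝ}, Measurable u →
      Measurable fun q => u (backTrajectory Ω n r q) := fun r u hu =>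
    hu.comp (measurable_backTrajectory hn r)
  calc ∫⁻ q, ‖w (backTrajectory Ω n s q) - w (backTrajectory Ω n t q)‖ₑ ∂phaseMeasure Ω
      ≤ ∫⁻ q, (‖w (backTrajectory Ω n s q) - c (backTrajectory Ω n s q)‖ₑ +
          (‖c (backTrajectory Ω n s q) - c (backTrajectory Ω n t q)‖ₑ +
          ‖w (backTrajectory Ω n t q) - c (backTrajectory Ω n t q)‖ₑ)) ∂phaseMeasure Ω := by
        refine lintegral_mono fun q => ?_
        have h1 : w (backTrajectory Ω n s q) - w (backTrajectory Ω n t q) =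
            (w (backTrajectory Ω n s q) - c (backTrajectory Ω n s q)) +
            ((c (backTrajectory Ω n s q) - c (backTrajectory Ω n t q)) -
            (w (backTrajectory Ω n t q) - c (backTrajectory Ω n t q))) := by ring
        rw [h1]
        exact (enorm_add_le _ _).trans (add_le_add le_rfl enorm_sub_le)
    _ = ∫⁻ q, ‖w q - c q‖ₑ ∂phaseMeasure Ω +
        (∫⁻ q, ‖c (backTrajectory Ω n s q) - c (backTrajectory Ω n t q)‖ₑ ∂phaseMeasure Ω +
        ∫⁻ q, ‖w q - c q‖ₑ ∂phaseMeasure Ω) := by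
        have h1 := hm s hwc
        have h2 : Measurable fun q =>
            ‖c (backTrajectory Ω n s q) - c (backTrajectory Ω n t q)‖ₑ :=
          ((hm s hc.measurable).sub (hm t hc.measurable)).enorm
        rw [lintegral_add_left h1.enorm, lintegral_add_left h2,
          lintegral_enorm_comp_back hΩ hwc hs0, lintegral_enorm_comp_back hΩ hwc ht]
    _ ≤ ε / 3 + (ε / 3 + ε / 3) := by gcongr
    _ = ε := by rw [← add_assoc, ENNReal.add_thirds]

/-! ### Continuity in time of mild solutions -/

variable {β : R3 → S2 → ℝ} {F : ℝ → R3 × R3 → ℝ≥0∞} {m : R3 → ℝ≥0∞}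

lemma enorm_toReal_sub_le {x y g l : ℝ≥0∞} (hx : x ≠ ⊤) (hy : y ≠ ⊤) (h : x + l = y + g) :
    ‖x.toReal - y.toReal‖ₑ ≤ g + l := by
  rcases eq_or_ne g ⊤ with rfl | hg
  · simp
  rcases eq_or_ne l ⊤ with rfl | hl
  · simp
  have h1 := congrArg ENNReal.toReal h
  rw [ENNReal.toReal_add hx hl, ENNReal.toReal_add hy hg] at h1
  have hg0 : 0 ≤ g.toReal := ENNReal.toReal_nonneg
  have hl0 : 0 ≤ l.toReal := ENNReal.toReal_nonneg
  rw [Real.enorm_eq_ofReal_abs, ← ENNReal.ofReal_toReal (ENNReal.add_ne_top.2 ⟨hg, hl⟩),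
    ENNReal.toReal_add hg hl]
  refine ENNReal.ofReal_le_ofReal (abs_le.2 ⟨?_, ?_⟩) <;> linarith

/-- The gain and loss terms are bounded in weighted `L¹`, uniformly in time. -/
lemma IsMildSolution.lintegral_rate_le (hF : IsMildSolution Ω n β F) (hΩ : IsRegularDomain Ω n)
    (hβ : IsSymmetricKernel β) (hm : IsCollisionInvariant m)
    (hfin : ∫⁻ p, m p.2 * F 0 p ∂phaseMeasure Ω ≠ ⊤) {t : ℝ} (ht : 0 ≤ t) :
    ∫⁻ p, m p.2 * (gainOp β (F t) p + lossOp β (F t) p) ∂phaseMeasure Ω ≤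
      2 * (kernelNorm β * ∫⁻ p, m p.2 * F 0 p ∂phaseMeasure Ω) := by
  have hsl : Measurable (F t) := hF.measurable.comp measurable_prodMk_left
  have hG : Measurable (gainOp β (F t)) :=
    (measurable_gainOp hβ hF.measurable).comp (measurable_prodMk_left (x := t))
  have h1 := lintegral_mul_lossOp_le (Ω := Ω) hβ hm hsl (hF.le_one t)
  rw [hF.lintegral_mul_eq hΩ hβ hm hfin ht] at h1
  simp_rw [mul_add]
  rw [lintegral_add_left (hm.measurable_mul hG), lintegral_mul_gainOp hβ hm hsl, two_mul]
  exact add_le_add h1 h1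

/-- Along the trajectories a mild solution is Lipschitz in time with values in weighted `L¹`. -/
lemma IsMildSolution.lintegral_sharp_sub_le (hF : IsMildSolution Ω n β F)
    (hΩ : IsRegularDomain Ω n) (hβ : IsSymmetricKernel β) (hm : IsCollisionInvariant m)
    (hfin : ∫⁻ p, m p.2 * F 0 p ∂phaseMeasure Ω ≠ ⊤) {s t : ℝ} (hs : 0 ≤ s) (hst : s ≤ t) :
    ∫⁻ p, m p.2 * ‖(F t (trajectory Ω n t p)).toReal - (F s (trajectory Ω n s p)).toReal‖ₑ
      ∂phaseMeasure Ω ≤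
      2 * (kernelNorm β * ∫⁻ p, m p.2 * F 0 p ∂phaseMeasure Ω) * ENNReal.ofReal (t - s) := by
  have hn := hΩ.contDiff_normal.continuous
  have hL := measurable_lossOp hβ hF.measurable
  have hG := measurable_gainOp hβ hF.measurable
  have hGL : Measurable (Function.uncurry fun s p => gainOp β (F s) p + lossOp β (F s) p) :=
    hG.add hL
  have hsub : Ioc s t ⊆ Ici (0 : ℝ) := fun r hr => hs.trans hr.1.le
  have hsplit : ∀ H : ℝ → R3 × R3 → ℝ≥0∞, ∀ p, pathIntegral Ω n H t p =
      pathIntegral Ω n H s p + ∫⁻ r in Ioc s t, H r (trajectory Ω n r p) := fun H p => by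
    rw [pathIntegral, pathIntegral, ← Icc_union_Ioc_eq_Icc hs hst,
      lintegral_union measurableSet_Ioc]
    exact Set.disjoint_left.2 fun r hr hr' => absurd hr'.1 (not_lt.2 hr.2)
  have hne : ∀ r p, F r p ≠ ⊤ := fun r p => ((hF.le_one r p).trans_lt ENNReal.one_lt_top).ne
  have hLfin : ∀ p, pathIntegral Ω n (fun s => lossOp β (F s)) s p ≠ ⊤ := fun p => by
    have h1 : pathIntegral Ω n (fun s => lossOp β (F s)) s p ≤ ∫⁻ _ in Icc 0 s, kernelNorm β :=
      lintegral_mono fun r => lossOp_le hβ (hF.le_one r) _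
    refine ne_top_of_le_ne_top ?_ h1
    rw [setLIntegral_const]
    exact ENNReal.mul_ne_top hβ.kernelNorm_lt_top.ne (by simp)
  have hpt : ∀ᵐ p ∂phaseMeasure Ω,
      ‖(F t (trajectory Ω n t p)).toReal - (F s (trajectory Ω n s p)).toReal‖ₑ ≤
        ∫⁻ r in Ioc s t, (fun s p => gainOp β (F s) p + lossOp β (F s) p) r
          (trajectory Ω n r p) := by
    filter_upwards [hF.mild t (hs.trans hst), hF.mild s hs] with p hpt hps
    rw [hsplit, hsplit] at hpt
    have hg := measurable_along_trajectory (Ω := Ω) (H := fun s => gainOp β (F s)) hn hG p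
    rw [lintegral_add_left hg]
    refine enorm_toReal_sub_le (hne _ _) (hne _ _) ?_
    set Ls := pathIntegral Ω n (fun s => lossOp β (F s)) s p
    set Gs := pathIntegral Ω n (fun s => gainOp β (F s)) s p
    refine (ENNReal.add_right_inj (hLfin p)).1 ?_
    rw [add_left_comm, hpt, ← add_assoc, ← hps]
    ring
  calc ∫⁻ p, m p.2 * ‖(F t (trajectory Ω n t p)).toReal - (F s (trajectory Ω n s p)).toReal‖ₑ
        ∂phaseMeasure Ω
      ≤ ∫⁻ p, m p.2 * (∫⁻ r in Ioc s t, (fun s p => gainOp β (F s) p + lossOp β (F s) p) r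
          (trajectory Ω n r p)) ∂phaseMeasure Ω := by
        refine lintegral_mono_ae ?_
        filter_upwards [hpt] with p hp
        gcongr
    _ = ∫⁻ r in Ioc s t, ∫⁻ p, m p.2 * (gainOp β (F r) p + lossOp β (F r) p) ∂phaseMeasure Ω :=
        lintegral_mul_setLIntegral hΩ hm hGL measurableSet_Ioc hsub
    _ ≤ ∫⁻ _ in Ioc s t, 2 * (kernelNorm β * ∫⁻ p, m p.2 * F 0 p ∂phaseMeasure Ω) :=
        setLIntegral_mono' measurableSet_Ioc fun r hr =>
          hF.lintegral_rate_le hΩ hβ hm hfin (hsub hr)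
    _ = _ := by rw [setLIntegral_const, Real.volume_Ioc]

end

section

variable {Ω : Set R3} {n : R3 → R3}

variable {β : R3 → S2 → ℝ} {F : ℝ → R3 × R3 → ℝ≥0∞} {m : R3 → ℝ≥0∞}

/-! ### Conservation laws and continuity in `L¹` -/

/-- The density `m f`, as a real function, for a mild solution `F`. -/
def weightedDensity (m : R3 → ℝ≥0∞) (F : ℝ → R3 × R3 → ℝ≥0∞) (t : ℝ) (p : R3 × R3) : ℝ :=
  (m p.2).toReal * (F t p).toReal

lemma enorm_toReal_of_ne_top {x : ℝ≥0∞} (hx : x ≠ ⊤) : ‖x.toReal‖ₑ = x := by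
  rw [Real.enorm_eq_ofReal ENNReal.toReal_nonneg, ENNReal.ofReal_toReal hx]

lemma enorm_weightedDensity (hm : IsCollisionInvariant m) (hF1 : ∀ t p, F t p ≤ 1) (t : ℝ)
    (p : R3 × R3) : ‖weightedDensity m F t p‖ₑ = m p.2 * F t p := by
  rw [weightedDensity, ← ENNReal.toReal_mul, enorm_toReal_of_ne_top]
  exact ENNReal.mul_ne_top (hm.ne_top _) ((hF1 t p).trans_lt ENNReal.one_lt_top).ne

lemma measurable_weightedDensity (hm : IsCollisionInvariant m)
    (hF : Measurable (Function.uncurry F)) (t : ℝ) : Measurable (weightedDensity m F t) := by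
  have h : Measurable (F t) := hF.comp measurable_prodMk_left
  exact (hm.measurable.comp measurable_snd).ennreal_toReal.mul h.ennreal_toReal

lemma IsMildSolution.integrable_weightedDensity (hF : IsMildSolution Ω n β F)
    (hΩ : IsRegularDomain Ω n) (hβ : IsSymmetricKernel β) (hm : IsCollisionInvariant m)
    (hfin : ∫⁻ p, m p.2 * F 0 p ∂phaseMeasure Ω ≠ ⊤) {t : ℝ} (ht : 0 ≤ t) :
    Integrable (weightedDensity m F t) (phaseMeasure Ω) := by
  refine ⟨(measurable_weightedDensity hm hF.measurable t).aestronglyMeasurable, ?_⟩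
  rw [hasFiniteIntegral_iff_enorm]
  simp_rw [enorm_weightedDensity hm hF.le_one]
  rw [hF.lintegral_mul_eq hΩ hβ hm hfin ht]
  exact hfin.lt_top

lemma integral_weightedDensity (hm : IsCollisionInvariant m)
    (hF : Measurable (Function.uncurry F)) (hF1 : ∀ t p, F t p ≤ 1) (t : ℝ) :
    ∫ p, weightedDensity m F t p ∂phaseMeasure Ω =
      (∫⁻ p, m p.2 * F t p ∂phaseMeasure Ω).toReal := by
  have h : Measurable (F t) := hF.comp measurable_prodMk_left
  rw [← integral_toReal (hm.measurable_mul h).aemeasurable]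
  · simp only [weightedDensity, ENNReal.toReal_mul]
  · exact ae_of_all _ fun p => ENNReal.mul_lt_top (hm.ne_top _).lt_top
      ((hF1 t p).trans_lt ENNReal.one_lt_top)

/-- In `L¹` the Lipschitz continuity along the trajectories and the strong continuity of the flow
combine to the continuity of the density in time. -/
lemma IsMildSolution.tendsto_weightedDensity (hF : IsMildSolution Ω n β F)
    (hΩ : IsRegularDomain Ω n) (hβ : IsSymmetricKernel β) (hm : IsCollisionInvariant m)
    (hfin : ∫⁻ p, m p.2 * F 0 p ∂phaseMeasure Ω ≠ ⊤) {t : ℝ} (ht : 0 ≤ t) :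
    Tendsto (fun s => ∫⁻ q, ‖weightedDensity m F s q - weightedDensity m F t q‖ₑ ∂phaseMeasure Ω)
      (𝓝[Ici 0] t) (𝓝 0) := by
  have hn := hΩ.contDiff_normal.continuous
  set C := 2 * (kernelNorm β * ∫⁻ p, m p.2 * F 0 p ∂phaseMeasure Ω) with hC
  have hCfin : C ≠ ⊤ := ENNReal.mul_ne_top (by simp)
    (ENNReal.mul_ne_top hβ.kernelNorm_lt_top.ne hfin)
  -- the density in the coordinates that are constant along trajectories
  set w : ℝ → R3 × R3 → ℝ := fun s p =>
    (m p.2).toReal * (F s (trajectory Ω n s p)).toReal with hw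
  have hwm : ∀ s, Measurable (w s) := fun s => by
    have h : Measurable fun p => F s (trajectory Ω n s p) :=
      (hF.measurable.comp measurable_prodMk_left).comp (measurable_trajectory hn s)
    exact (hm.measurable.comp measurable_snd).ennreal_toReal.mul h.ennreal_toReal
  have hWw : ∀ s, 0 ≤ s → ∀ᵐ q ∂phaseMeasure Ω,
      weightedDensity m F s q = w s (backTrajectory Ω n s q) := fun s hs => by
    filter_upwards [ae_norm_back hΩ hs, ae_trajectory_back hΩ hs] with q hq1 hq2
    simp only [hw]
    rw [hq2, weightedDensity, hm.norm_eq _ _ hq1.1]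
  have hwd : ∀ s, 0 ≤ s →
      ∫⁻ p, ‖w s p - w t p‖ₑ ∂phaseMeasure Ω ≤ C * ENNReal.ofReal |s - t| := by
    have h1 : ∀ a b p, ‖w b p - w a p‖ₑ = m p.2 *
        ‖(F b (trajectory Ω n b p)).toReal - (F a (trajectory Ω n a p)).toReal‖ₑ :=
      fun a b p => by
        simp only [hw]
        rw [← mul_sub, enorm_mul, enorm_toReal_of_ne_top (hm.ne_top _)]
    have h2 : ∀ a b, 0 ≤ a → a ≤ b →
        ∫⁻ p, ‖w b p - w a p‖ₑ ∂phaseMeasure Ω ≤ C * ENNReal.ofReal (b - a) := fun a b ha hab => by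
      simp_rw [h1]
      exact hF.lintegral_sharp_sub_le hΩ hβ hm hfin ha hab
    intro s hs
    rcases le_total t s with h | h
    · rw [abs_of_nonneg (sub_nonneg.2 h)]; exact h2 t s ht h
    · rw [abs_of_nonpos (sub_nonpos.2 h), neg_sub]
      refine le_trans (le_of_eq (lintegral_congr fun p => ?_)) (h2 s t hs h)
      exact enorm_sub_rev _ _
  have hwi : Integrable (w t) (phaseMeasure Ω) := by
    have h1 := (hF.integrable_weightedDensity hΩ hβ hm hfin ht).congr (hWw t ht)
    have h2 := (measurePreserving_trajectory hΩ ht).integrable_comp_of_integrable h1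
    refine h2.congr ?_
    filter_upwards [ae_back_trajectory hΩ ht] with p hp
    simp only [Function.comp, hp]
  have hlim : Tendsto (fun s => C * ENNReal.ofReal |s - t| +
      ∫⁻ q, ‖w t (backTrajectory Ω n s q) - w t (backTrajectory Ω n t q)‖ₑ ∂phaseMeasure Ω)
      (𝓝[Ici 0] t) (𝓝 0) := by
    have h1 : Tendsto (fun s : ℝ => ENNReal.ofReal |s - t|) (𝓝[Ici 0] t) (𝓝 0) := by
      have h3 : Continuous fun s : ℝ => ENNReal.ofReal |s - t| :=
        ENNReal.continuous_ofReal.comp (by fun_prop)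
      have h4 := (h3.tendsto t).mono_left (nhdsWithin_le_nhds (s := Ici 0))
      simpa using h4
    have h2 := ENNReal.Tendsto.const_mul h1 (Or.inr hCfin)
    rw [mul_zero] at h2
    simpa using h2.add (tendsto_lintegral_comp_back hΩ (hwm t) hwi ht)
  refine tendsto_of_tendsto_of_tendsto_of_le_of_le' tendsto_const_nhds hlim
    (Eventually.of_forall fun s => zero_le) ?_
  filter_upwards [self_mem_nhdsWithin] with s hs
  have hcm : ∀ r u, Measurable fun q => w u (backTrajectory Ω n r q) := fun r u =>
    (hwm u).comp (measurable_backTrajectory hn r)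
  calc ∫⁻ q, ‖weightedDensity m F s q - weightedDensity m F t q‖ₑ ∂phaseMeasure Ω
      ≤ ∫⁻ q, (‖w s (backTrajectory Ω n s q) - w t (backTrajectory Ω n s q)‖ₑ +
          ‖w t (backTrajectory Ω n s q) - w t (backTrajectory Ω n t q)‖ₑ) ∂phaseMeasure Ω := by
        refine lintegral_mono_ae ?_
        filter_upwards [hWw s hs, hWw t ht] with q hq1 hq2
        rw [hq1, hq2, ← sub_add_sub_cancel _ (w t (backTrajectory Ω n s q))]
        exact enorm_add_le _ _
    _ = ∫⁻ p, ‖w s p - w t p‖ₑ ∂phaseMeasure Ω +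
          ∫⁻ q, ‖w t (backTrajectory Ω n s q) - w t (backTrajectory Ω n t q)‖ₑ
            ∂phaseMeasure Ω := by
        have h1 : Measurable fun q =>
            ‖w s (backTrajectory Ω n s q) - w t (backTrajectory Ω n s q)‖ₑ :=
          ((hcm s s).sub (hcm s t)).enorm
        have h2 : Measurable fun p => w s p - w t p := (hwm s).sub (hwm t)
        rw [lintegral_add_left h1, lintegral_enorm_comp_back hΩ h2 hs]
    _ ≤ _ := by gcongr; exact hwd s hs

lemma IsMildSolution.memC0L1 (hF : IsMildSolution Ω n β F)
    (hΩ : IsRegularDomain Ω n) (hβ : IsSymmetricKernel β) (hm : IsCollisionInvariant m)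
    (hfin : ∫⁻ p, m p.2 * F 0 p ∂phaseMeasure Ω ≠ ⊤) : MemC0L1 Ω (weightedDensity m F) := by
  have hL : ∀ t : ℝ≥0, MemLp (weightedDensity m F t) 1 (phaseMeasure Ω) := fun t =>
    memLp_one_iff_integrable.2 (hF.integrable_weightedDensity hΩ hβ hm hfin t.2)
  refine ⟨⟨fun t => (hL t).toLp _, ?_⟩, fun t => (hL t).coeFn_toLp⟩
  rw [continuous_iff_continuousAt]
  intro t
  refine (Lp.tendsto_Lp_iff_tendsto_eLpNorm'' _ hL _ (hL t)).2 ?_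
  simp_rw [eLpNorm_one_eq_lintegral_enorm]
  refine (hF.tendsto_weightedDensity hΩ hβ hm hfin t.2).comp ?_
  exact tendsto_nhdsWithin_iff.2 ⟨NNReal.continuous_coe.tendsto t,
    Eventually.of_forall fun s => s.2⟩

lemma IsMildSolution.memLinftyL1 (hF : IsMildSolution Ω n β F)
    (hΩ : IsRegularDomain Ω n) (hβ : IsSymmetricKernel β) (hm : IsCollisionInvariant m)
    (hfin : ∫⁻ p, m p.2 * F 0 p ∂phaseMeasure Ω ≠ ⊤) {g : ℝ → R3 × R3 → ℝ}
    (hg : ∀ᵐ z ∂timePhaseMeasure Ω, g z.1 z.2 = netRate β F z.1 z.2) :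
    MemLinftyL1 Ω fun t p => (m p.2).toReal * g t p := by
  have hmr : Measurable fun p : R3 × R3 => (m p.2).toReal :=
    (hm.measurable.comp measurable_snd).ennreal_toReal
  have hnm := measurable_netRate hβ hF.measurable
  set C := 2 * (kernelNorm β * ∫⁻ p, m p.2 * F 0 p ∂phaseMeasure Ω) with hC
  have hCfin : C ≠ ⊤ := ENNReal.mul_ne_top (by simp)
    (ENNReal.mul_ne_top hβ.kernelNorm_lt_top.ne hfin)
  constructor
  · have h1 : Measurable fun z : ℝ × R3 × R3 => (m z.2.2).toReal * netRate β F z.1 z.2 :=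
      (hmr.comp measurable_snd).mul hnm
    refine h1.aestronglyMeasurable.congr ?_
    filter_upwards [hg] with z hz
    rw [hz]
  · refine ⟨C.toReal, ?_⟩
    rw [timePhaseMeasure_eq_prod] at hg
    filter_upwards [Measure.ae_ae_of_ae_prod hg, ae_restrict_mem measurableSet_Ici] with t ht ht0
    have hnt : Measurable (netRate β F t) := hnm.of_uncurry_left
    have hm1 : Measurable fun p : R3 × R3 => (m p.2).toReal * netRate β F t p :=
      hmr.mul hnt
    have hae : (fun p : R3 × R3 => (m p.2).toReal * netRate β F t p) =ᵐ[phaseMeasure Ω]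
        fun p => (m p.2).toReal * g t p := by
      filter_upwards [ht] with p hp
      rw [hp]
    have hle : ∫⁻ p, ‖(m p.2).toReal * netRate β F t p‖ₑ ∂phaseMeasure Ω ≤ C := by
      refine le_trans (lintegral_mono fun p => ?_) (hF.lintegral_rate_le hΩ hβ hm hfin ht0)
      rw [enorm_mul, enorm_toReal_of_ne_top (hm.ne_top _)]
      gcongr
      have hgt := ((gainOp_le hβ (hF.le_one t) p).trans_lt hβ.kernelNorm_lt_top).ne
      have hlt := ((lossOp_le hβ (hF.le_one t) p).trans_lt hβ.kernelNorm_lt_top).ne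
      exact enorm_toReal_sub_le hgt hlt (add_comm _ _)
    have hint : Integrable (fun p : R3 × R3 => (m p.2).toReal * netRate β F t p)
        (phaseMeasure Ω) :=
      ⟨hm1.aestronglyMeasurable, hasFiniteIntegral_iff_enorm.2 (hle.trans_lt hCfin.lt_top)⟩
    refine ⟨hint.congr hae, ?_⟩
    have h2 : ∫ p, |(m p.2).toReal * g t p| ∂phaseMeasure Ω =
        ∫ p, ‖(m p.2).toReal * netRate β F t p‖ ∂phaseMeasure Ω := by
      refine integral_congr_ae ?_
      filter_upwards [hae] with p hp
      rw [← hp, Real.norm_eq_abs]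
    rw [h2, integral_norm_eq_lintegral_enorm hm1.aestronglyMeasurable]
    exact ENNReal.toReal_mono hCfin hle

/-- Conservation and continuity for an arbitrary collision invariant. -/
theorem IsBFDSolution.conservation {b : R3 → S2 → ℝ} {f₀ : R3 × R3 → ℝ} {f : ℝ → R3 × R3 → ℝ}
    (hf : IsBFDSolution Ω n b f₀ f) (hf₀ : AEMeasurable f₀ (phaseMeasure Ω))
    (hΩ : IsRegularDomain Ω n) (hb : IsCollisionKernel b) (hm : IsCollisionInvariant m)
    (hint : Integrable (fun p => (m p.2).toReal * f₀ p) (phaseMeasure Ω)) :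
    MemC0L1 Ω (fun t p => (m p.2).toReal * f t p) ∧
    (∀ t : ℝ, 0 ≤ t → ∫ p, (m p.2).toReal * f t p ∂(phaseMeasure Ω) =
      ∫ p, (m p.2).toReal * f₀ p ∂(phaseMeasure Ω)) ∧
    MemLinftyL1 Ω (fun t p => (m p.2).toReal * Q b f t p) := by
  obtain ⟨β, hβ, hbβ⟩ := hb.exists_symmetric
  obtain ⟨F, hF, hfF, hQ⟩ := hf.exists_isMildSolution hf₀ hΩ hβ hbβ
  have hae : ∀ t, 0 ≤ t →
      (fun p => (m p.2).toReal * f t p) =ᵐ[phaseMeasure Ω] weightedDensity m F t := fun t ht => by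
    filter_upwards [hfF t ht] with p hp
    rw [weightedDensity, hp]
  have hae₀ : (fun p => (m p.2).toReal * f₀ p) =ᵐ[phaseMeasure Ω] weightedDensity m F 0 := by
    filter_upwards [hae 0 le_rfl, hf.initial] with p hp1 hp2
    rw [← hp1, hp2]
  have hfin : ∫⁻ p, m p.2 * F 0 p ∂phaseMeasure Ω ≠ ⊤ := by
    have h1 := hasFiniteIntegral_iff_enorm.1 (hint.congr hae₀).2
    simp_rw [enorm_weightedDensity hm hF.le_one] at h1
    exact h1.ne
  refine ⟨?_, fun t ht => ?_, hF.memLinftyL1 hΩ hβ hm hfin hQ⟩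
  · obtain ⟨G, hG⟩ := hF.memC0L1 hΩ hβ hm hfin
    exact ⟨G, fun t => (hG t).trans (hae t t.2).symm⟩
  · rw [integral_congr_ae (hae t ht), integral_congr_ae hae₀,
      integral_weightedDensity hm hF.measurable hF.le_one,
      integral_weightedDensity hm hF.measurable hF.le_one, hF.lintegral_mul_eq hΩ hβ hm hfin ht]

end

end

theorem mainTheorem2 (Ω : Set R3) (n : R3 → R3) (hΩ : IsRegularDomain Ω n)
    (b : R3 → S2 → ℝ) (hb : IsCollisionKernel b)
    (f₀ : R3 × R3 → ℝ) (hf₀_meas : AEMeasurable f₀ (phaseMeasure Ω))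
    (hf₀ : ∀ᵐ p ∂(phaseMeasure Ω), 0 ≤ f₀ p ∧ f₀ p ≤ 1)
    (f : ℝ → R3 × R3 → ℝ) (hf : IsBFDSolution Ω n b f₀ f) :
    (Integrable f₀ (phaseMeasure Ω) →
      MemC0L1 Ω f ∧
      ∀ t : ℝ, 0 ≤ t → ∫ p, f t p ∂(phaseMeasure Ω) = ∫ p, f₀ p ∂(phaseMeasure Ω)) ∧
    (Integrable (fun p : R3 × R3 => ‖p.2‖ ^ 2 * f₀ p) (phaseMeasure Ω) →
      MemC0L1 Ω (fun t p => ‖p.2‖ ^ 2 * f t p) ∧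
      (∀ t : ℝ, 0 ≤ t → ∫ p, ‖p.2‖ ^ 2 * f t p ∂(phaseMeasure Ω) =
        ∫ p, ‖p.2‖ ^ 2 * f₀ p ∂(phaseMeasure Ω)) ∧
      MemLinftyL1 Ω (fun t p => ‖p.2‖ ^ 2 * Q b f t p)) := by
  refine ⟨fun hint => ?_, fun hint => ?_⟩
  · have h := hf.conservation hf₀_meas hΩ hb isCollisionInvariant_one (by simpa using hint)
    simp only [Pi.one_apply, ENNReal.toReal_one, one_mul] at h
    exact ⟨h.1, h.2.1⟩
  · have h2 : ∀ p : R3 × R3, (ENNReal.ofReal (‖p.2‖ ^ 2)).toReal = ‖p.2‖ ^ 2 := fun p =>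
      ENNReal.toReal_ofReal (by positivity)
    have h := hf.conservation hf₀_meas hΩ hb isCollisionInvariant_energy
      (by simpa only [h2] using hint)
    simpa only [h2] using h
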